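/- Let $K,L\subset\mathbf R^2$ be closed convex sets with interior points, both different from $\mathbf R^2$. A congruence is an isometry of $\mathbf R^2$ onto itself (orientation preserving or reversing); it is non-trivial if it is not the identity. "Circle" means a closed disk of positive radius, and parallel strips (of positive width) and half-planes are closed. The following are equivalent. (1) For all orientation preserving congruences $\varphi,\psi$ of $\mathbf R^2$ for which $(\varphi K)\cap(\psi L)$ has interior points, $(\varphi K)\cap(\psi L)$ admits some non-trivial congruence, i.e. is mapped onto itself by one. (2) $K$ and $L$ are (in general incongruent) circles, or one of them is a circle and the other one is a parallel strip or a half-plane, or they are two (in general incongruent) parallel strips, or they are two half-planes. In particular, (1) with "is centrally symmetric" in place of "admits some non-trivial congruence" holds if and only if $K$ and $L$ are two congruent circles or two (in general incongruent) parallel strips. Similarly, (1) with "is axially symmetric" (i.e. symmetric with respect to some straight line) in place of "admits some non-trivial congruence" holds if and only if (2) holds and moreover, in the case when $K$ and $L$ are two parallel strips, these strips are congruent. -/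

import Mathlib

/-- The Euclidean plane. -/
abbrev Plane : Type := EuclideanSpace ℝ (Fin 2)

/-- A congruence of the plane onto itself is orientation preserving if its linear part has positive
determinant (equivalently, determinant `1`). -/
def OrientationPreserving (φ : Plane ≃ᵃⁱ[ℝ] Plane) : Prop :=
  0 < LinearMap.det (φ.linearIsometryEquiv.toLinearEquiv : Plane →ₗ[ℝ] Plane)

/-- Closed convex proper subsets of the plane, with interior points. -/
structure IsProperClosedConvex (K : Set Plane) : Prop where
  isClosed : IsClosed K
  convex : Convex ℝ K
  ne_univ : K ≠ Set.univ
  interior_nonempty : (interior K).Nonempty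

/-- `M` is mapped onto itself by some congruence (direct or indirect) other than the identity. -/
def AdmitsNontrivialCongruence (M : Set Plane) : Prop :=
  ∃ χ : Plane ≃ᵃⁱ[ℝ] Plane, χ ≠ AffineIsometryEquiv.refl ℝ Plane ∧ χ '' M = M

/-- `M` is mapped onto itself by the reflection in some point. -/
def IsCentrallySymmetric (M : Set Plane) : Prop :=
  ∃ c : Plane, AffineIsometryEquiv.pointReflection ℝ c '' M = M

/-- `M` is mapped onto itself by the reflection in some straight line. -/
def IsAxiallySymmetric (M : Set Plane) : Prop :=
  ∃ (l : AffineSubspace ℝ Plane) (_ : Nonempty l),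
    Module.finrank ℝ l.direction = 1 ∧ EuclideanGeometry.reflection l '' M = M

/-- Two plane sets are congruent. -/
def AreCongruent (K L : Set Plane) : Prop :=
  ∃ χ : Plane ≃ᵃⁱ[ℝ] Plane, χ '' K = L

/-- A circle, meant as a closed disk of positive radius. -/
def IsCircle (K : Set Plane) : Prop :=
  ∃ (c : Plane) (r : ℝ), 0 < r ∧ K = Metric.closedBall c r

/-- A closed parallel strip, of positive width `b - a`. -/
def IsParallelStrip (K : Set Plane) : Prop :=
  ∃ (u : Plane) (a b : ℝ), ‖u‖ = 1 ∧ a < b ∧ K = {x | a ≤ inner ℝ u x ∧ inner ℝ u x ≤ b}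

/-- A closed half-plane. -/
def IsHalfPlane (K : Set Plane) : Prop :=
  ∃ (u : Plane) (a : ℝ), ‖u‖ = 1 ∧ K = {x | a ≤ inner ℝ u x}

/-- Every intersection with interior points of directly congruent copies of `K` and `L` has the
property `P`. -/
def AllIntersections (P : Set Plane → Prop) (K L : Set Plane) : Prop :=
  ∀ φ ψ : Plane ≃ᵃⁱ[ℝ] Plane, OrientationPreserving φ → OrientationPreserving ψ →
    (interior ((φ '' K) ∩ (ψ '' L))).Nonempty → P ((φ '' K) ∩ (ψ '' L))

section

open Set Filter Topology

/-! ### Coordinates in the plane -/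

/-! The hard direction is that symmetry of all intersections forces each of `K` and `L` to be a
disk, a strip or a half-plane (`AllIntersections.classification`). Small intersections reveal the
local shape of the boundary.

No corners (`AllIntersections.isSmoothSet`): every proper closed convex set has a smooth boundary
point, where it looks like a half-plane under magnification. If `K` had a corner, `L` could cut off
from it small pieces that, rescaled, converge to a scalene triangle. Symmetry passes to such limits
(`admitsNontrivialCongruence_of_approx`), because a bounded set with a non-trivial symmetry has one
bounded away from the identity; but a scalene triangle has no symmetry.

Balanced chords (`IsLocalGraph.isBalanced`): the boundaries are now locally graphs of `C¹`
functions. Take chords of `K` and `L` of the same small length and glue the two caps along them into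
a lens. The chord is the only diameter of the lens, so a symmetry preserves it, and either the two
caps are congruent or each is symmetric about the bisector of the chord (`lens_symmetry`). A
symmetric cap has equal base angles. If some cap of `K` is not symmetric, then the cap of `L` is not
either, so all caps of `K` over nearby chords of that length are congruent to it and have the same
area; a Lagrange multiplier argument again gives equal base angles.

Constant curvature (`IsLocalGraph.exists_curvature`): with one end fixed, equal base angles say that
the distance of the other end from the tangent at the fixed end, divided by the squared chord
length, has derivative zero. So the boundary is locally an arc of a circle or a line. Uniqueness of
the osculating circle propagates this along the whole circle or line
(`eventually_mem_iff_of_isPreconnected`), and convexity identifies the set.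

Of the remaining pairs, strip and half-plane is excluded by an oblique half-strip. The other pairs
have explicit symmetries, and explicit placements show where central or axial symmetry fails. -/

lemma Plane.inner_eq (u z : Plane) : inner ℝ u z = u 0 * z 0 + u 1 * z 1 := by
  simp [PiLp.inner_apply, Fin.sum_univ_two]; ring

lemma Plane.norm_sq_eq (z : Plane) : ‖z‖ ^ 2 = z 0 ^ 2 + z 1 ^ 2 := by
  rw [← real_inner_self_eq_norm_sq, Plane.inner_eq]; ring

lemma Plane.norm_eq_one_iff (z : Plane) : ‖z‖ = 1 ↔ z 0 ^ 2 + z 1 ^ 2 = 1 := by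
  rw [← Plane.norm_sq_eq]
  exact ⟨fun h => by rw [h]; norm_num, fun h => by
    nlinarith [norm_nonneg z]⟩

lemma Plane.dist_sq_eq (z w : Plane) : dist z w ^ 2 = (z 0 - w 0) ^ 2 + (z 1 - w 1) ^ 2 := by
  rw [dist_eq_norm, Plane.norm_sq_eq]; simp

lemma Plane.ext {z w : Plane} (h0 : z 0 = w 0) (h1 : z 1 = w 1) : z = w := by
  ext i; fin_cases i <;> simp_all

lemma Plane.continuous_coord (i : Fin 2) : Continuous fun z : Plane => z i := by fun_prop

/-! ### Rigid motions -/

/-- The affine isometry with given linear part and translation part. -/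
noncomputable def AffineIsometryEquiv.ofParts (A : Plane ≃ₗᵢ[ℝ] Plane) (b : Plane) :
    Plane ≃ᵃⁱ[ℝ] Plane :=
  A.toAffineIsometryEquiv.trans (AffineIsometryEquiv.constVAdd ℝ Plane b)

@[simp] lemma AffineIsometryEquiv.ofParts_apply (A : Plane ≃ₗᵢ[ℝ] Plane) (b z : Plane) :
    AffineIsometryEquiv.ofParts A b z = A z + b := by
  simp [AffineIsometryEquiv.ofParts, add_comm]

lemma AffineIsometryEquiv.apply_eq (χ : Plane ≃ᵃⁱ[ℝ] Plane) (z : Plane) :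
    χ z = χ.linearIsometryEquiv z + χ 0 := by
  have := χ.map_vadd 0 z
  simpa using this

lemma AffineIsometryEquiv.linear_ofParts (A : Plane ≃ₗᵢ[ℝ] Plane) (b : Plane) :
    (AffineIsometryEquiv.ofParts A b).linearIsometryEquiv = A := by
  ext1 z
  have := AffineIsometryEquiv.apply_eq (AffineIsometryEquiv.ofParts A b) z
  simpa using this.symm

/-- The linear map with columns `(a, b)` and `(c, d)`. -/
noncomputable def Plane.linearMap (a b c d : ℝ) : Plane →ₗ[ℝ] Plane :=
  Matrix.toLin (EuclideanSpace.basisFun (Fin 2) ℝ).toBasis (EuclideanSpace.basisFun (Fin 2) ℝ).toBasis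
    !![a, c; b, d]

lemma Plane.linearMap_apply (a b c d : ℝ) (z : Plane) :
    Plane.linearMap a b c d z = !₂[a * z 0 + c * z 1, b * z 0 + d * z 1] := by
  rw [Plane.linearMap, Matrix.toLin_apply]
  apply Plane.ext <;>
  simp [Fin.sum_univ_two, Matrix.mulVec, dotProduct]

lemma Plane.det_linearMap (a b c d : ℝ) : LinearMap.det (Plane.linearMap a b c d) = a * d - c * b := by
  rw [Plane.linearMap, LinearMap.det_toLin, Matrix.det_fin_two_of]

/-- The isometry with first column `(a, b)` and second column `±(-b, a)`. -/
noncomputable def Plane.orthogonal (a b ε : ℝ) (h : a ^ 2 + b ^ 2 = 1) (hε : ε ^ 2 = 1) :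
    Plane ≃ₗᵢ[ℝ] Plane :=
  LinearIsometry.toLinearIsometryEquiv
    { toLinearMap := Plane.linearMap a b (-b * ε) (a * ε)
      norm_map' := fun z => by
        rw [← sq_eq_sq₀ (norm_nonneg _) (norm_nonneg _), Plane.norm_sq_eq, Plane.norm_sq_eq,
          Plane.linearMap_apply]
        simp only [Matrix.cons_val_zero, Matrix.cons_val_one]
        linear_combination (z 0 ^ 2 + ε ^ 2 * z 1 ^ 2) * h + z 1 ^ 2 * hε } rfl

lemma Plane.orthogonal_apply (a b ε : ℝ) (h : a ^ 2 + b ^ 2 = 1) (hε : ε ^ 2 = 1) (z : Plane) :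
    Plane.orthogonal a b ε h hε z = !₂[a * z 0 + -b * ε * z 1, b * z 0 + a * ε * z 1] := by
  rw [← Plane.linearMap_apply]; rfl

lemma exists_rigid (a b : ℝ) (h : a ^ 2 + b ^ 2 = 1) (v : Plane) :
    ∃ φ : Plane ≃ᵃⁱ[ℝ] Plane, OrientationPreserving φ ∧
      ∀ z, φ z = !₂[a * z 0 - b * z 1 + v 0, b * z 0 + a * z 1 + v 1] := by
  refine ⟨AffineIsometryEquiv.ofParts (Plane.orthogonal a b 1 h (by norm_num)) v, ?_, fun z => ?_⟩
  · rw [OrientationPreserving, AffineIsometryEquiv.linear_ofParts]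
    have : ((Plane.orthogonal a b 1 h (by norm_num)).toLinearEquiv : Plane →ₗ[ℝ] Plane) =
      Plane.linearMap a b (-b * 1) (a * 1) := rfl
    rw [this, Plane.det_linearMap]
    nlinarith
  · rw [AffineIsometryEquiv.ofParts_apply, Plane.orthogonal_apply]
    apply Plane.ext
    · simp [sub_eq_add_neg]
    · simp

lemma OrientationPreserving.refl : OrientationPreserving (AffineIsometryEquiv.refl ℝ Plane) := by
  have : (((AffineIsometryEquiv.refl ℝ Plane).linearIsometryEquiv).toLinearEquiv : Plane →ₗ[ℝ] Plane)
    = LinearMap.id := by ext; rfl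
  rw [OrientationPreserving, this, LinearMap.det_id]; exact one_pos

lemma OrientationPreserving.trans {φ ψ : Plane ≃ᵃⁱ[ℝ] Plane} (hφ : OrientationPreserving φ)
    (hψ : OrientationPreserving ψ) : OrientationPreserving (φ.trans ψ) := by
  have : ((φ.trans ψ).linearIsometryEquiv.toLinearEquiv : Plane →ₗ[ℝ] Plane)
    = (ψ.linearIsometryEquiv.toLinearEquiv : Plane →ₗ[ℝ] Plane) ∘ₗ
      (φ.linearIsometryEquiv.toLinearEquiv : Plane →ₗ[ℝ] Plane) := by ext; rfl
  rw [OrientationPreserving, this, LinearMap.det_comp]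
  exact mul_pos hψ hφ

lemma AllIntersections.image {P : Set Plane → Prop} {K L : Set Plane} (H : AllIntersections P K L)
    {φ ψ : Plane ≃ᵃⁱ[ℝ] Plane} (hφ : OrientationPreserving φ) (hψ : OrientationPreserving ψ) :
    AllIntersections P (φ '' K) (ψ '' L) := by
  intro φ' ψ' h1 h2 h3
  have := H (φ.trans φ') (ψ.trans ψ') (hφ.trans h1) (hψ.trans h2)
  simp only [AffineIsometryEquiv.coe_trans, image_comp] at this
  exact this h3

lemma AllIntersections.swap {P : Set Plane → Prop} {K L : Set Plane} (H : AllIntersections P K L) :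
    AllIntersections P L K := by
  intro φ ψ h1 h2 h3
  rw [inter_comm] at h3 ⊢
  exact H ψ φ h2 h1 h3

lemma AllIntersections.inter {P : Set Plane → Prop} {K L : Set Plane} (H : AllIntersections P K L)
    (h : (interior (K ∩ L)).Nonempty) : P (K ∩ L) := by
  have := H _ _ OrientationPreserving.refl OrientationPreserving.refl
  simp only [AffineIsometryEquiv.coe_refl, image_id] at this
  exact this h

lemma AllIntersections.mono {P Q : Set Plane → Prop} {K L : Set Plane} (H : AllIntersections P K L)
    (h : ∀ M, P M → Q M) : AllIntersections Q K L :=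
  fun φ ψ h1 h2 h3 => h _ (H φ ψ h1 h2 h3)

lemma AffineIsometryEquiv.convex_image (φ : Plane ≃ᵃⁱ[ℝ] Plane) {K : Set Plane} (hK : Convex ℝ K) :
    Convex ℝ (φ '' K) :=
  hK.affine_image φ.toAffineEquiv.toAffineMap

lemma IsProperClosedConvex.image {K : Set Plane} (hK : IsProperClosedConvex K)
    (φ : Plane ≃ᵃⁱ[ℝ] Plane) : IsProperClosedConvex (φ '' K) where
  isClosed := φ.toHomeomorph.isClosedMap _ hK.isClosed
  convex := φ.convex_image hK.convex
  ne_univ := fun h => hK.ne_univ <| by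
    rw [← φ.symm.surjective.range_eq, ← image_univ, ← h]
    ext z; simp
  interior_nonempty := by
    have : interior (φ '' K) = φ '' interior K := (φ.toHomeomorph.image_interior K).symm
    rw [this]; exact hK.interior_nonempty.image _

lemma AffineIsometryEquiv.mem_image_iff (φ : Plane ≃ᵃⁱ[ℝ] Plane) {K : Set Plane} {z : Plane} :
    z ∈ φ '' K ↔ φ.symm z ∈ K :=
  ⟨by rintro ⟨w, hw, rfl⟩; simpa, fun h => ⟨_, h, by simp⟩⟩

/-! ### Supporting lines -/

/-- `u` is a unit inner normal of `K` at `x`. -/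
def IsInnerNormal (K : Set Plane) (x u : Plane) : Prop :=
  ‖u‖ = 1 ∧ ∀ z ∈ K, 0 ≤ inner ℝ u (z - x)

/-- Each boundary point of `K` has at most one unit inner normal. -/
def IsSmoothSet (K : Set Plane) : Prop :=
  ∀ x ∈ K, ∀ u v, IsInnerNormal K x u → IsInnerNormal K x v → u = v

lemma AffineIsometryEquiv.inner_linear_sub (φ : Plane ≃ᵃⁱ[ℝ] Plane) (u z x : Plane) :
    inner ℝ (φ.linearIsometryEquiv u) (φ z - φ x) = inner ℝ u (z - x) := by
  have := φ.map_vsub z x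
  simp only [vsub_eq_sub] at this
  rw [← this, LinearIsometryEquiv.inner_map_map]

lemma IsInnerNormal.image {K : Set Plane} {x u : Plane} (h : IsInnerNormal K x u)
    (φ : Plane ≃ᵃⁱ[ℝ] Plane) : IsInnerNormal (φ '' K) (φ x) (φ.linearIsometryEquiv u) := by
  refine ⟨by simpa using h.1, ?_⟩
  rintro _ ⟨z, hz, rfl⟩
  rw [AffineIsometryEquiv.inner_linear_sub]
  exact h.2 z hz

lemma IsSmoothSet.image {K : Set Plane} (h : IsSmoothSet K) (φ : Plane ≃ᵃⁱ[ℝ] Plane) :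
    IsSmoothSet (φ '' K) := by
  rintro _ ⟨x, hx, rfl⟩ u v hu hv
  have hu' := hu.image φ.symm
  have hv' := hv.image φ.symm
  have hKK : φ.symm '' (φ '' K) = K := by ext; simp
  rw [hKK, AffineIsometryEquiv.symm_apply_apply] at hu' hv'
  exact φ.symm.linearIsometryEquiv.injective (h x hx _ _ hu' hv')

lemma exists_separating {C D : Set Plane} (hC : Convex ℝ C) (hCo : (interior C).Nonempty)
    (hD : Convex ℝ D) (h : Disjoint (interior C) D) :
    ∃ u : Plane, ‖u‖ = 1 ∧ ∀ z ∈ C, ∀ w ∈ D, inner ℝ u w ≤ inner ℝ u z := by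
  rcases D.eq_empty_or_nonempty with rfl | ⟨d, hd⟩
  · exact ⟨!₂[1, 0], by rw [Plane.norm_eq_one_iff]; simp, by simp⟩
  obtain ⟨f, c, h1, h2⟩ := geometric_hahn_banach_open hC.interior isOpen_interior hD h
  obtain ⟨v, rfl⟩ := (InnerProductSpace.toDual ℝ Plane).surjective f
  replace h1 : ∀ a ∈ interior C, inner ℝ v a < c := h1
  replace h2 : ∀ b ∈ D, c ≤ inner ℝ v b := h2
  have hv : v ≠ 0 := by
    rintro rfl
    obtain ⟨a, ha⟩ := hCo
    have := h1 a ha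
    have := h2 d hd
    simp at *
    linarith
  have hv' : 0 < ‖v‖ := norm_pos_iff.2 hv
  refine ⟨-(‖v‖⁻¹ • v), by rw [norm_neg, norm_smul]; simp [hv'.ne'], fun z hz w hw => ?_⟩
  have hz' : z ∈ closure (interior C) := by
    rw [hC.closure_interior_eq_closure_of_nonempty_interior hCo]; exact subset_closure hz
  have : inner ℝ v z ≤ c := by
    have hcl : IsClosed {z : Plane | inner ℝ v z ≤ c} := isClosed_le (by fun_prop) (by fun_prop)
    exact closure_minimal (fun a ha => (h1 a ha).le) hcl hz'
  have h3 := h2 w hw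
  rw [inner_neg_left, inner_neg_left, real_inner_smul_left, real_inner_smul_left]
  have : ‖v‖⁻¹ * inner ℝ v z ≤ ‖v‖⁻¹ * inner ℝ v w := by
    apply mul_le_mul_of_nonneg_left (by linarith) (by positivity)
  linarith

lemma IsProperClosedConvex.exists_isInnerNormal {K : Set Plane} (hK : IsProperClosedConvex K)
    {x : Plane} (hx : x ∈ frontier K) : ∃ u, IsInnerNormal K x u := by
  obtain ⟨u, hu, h⟩ := exists_separating hK.convex hK.interior_nonempty (convex_singleton x)
    (by simpa using hx.2)
  refine ⟨u, hu, fun z hz => ?_⟩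
  rw [inner_sub_right]
  linarith [h z hz x rfl]

lemma IsInnerNormal.notMem_interior {K : Set Plane} {x u : Plane} (h : IsInnerNormal K x u) :
    x ∉ interior K := by
  intro hx
  have h1 : Tendsto (fun t : ℝ => x - t • u) (𝓝[>] 0) (𝓝 x) := by
    have : Continuous fun t : ℝ => x - t • u := by fun_prop
    have := this.tendsto 0
    simp only [zero_smul, sub_zero] at this
    exact this.mono_left nhdsWithin_le_nhds
  have h2 := h1.eventually (isOpen_interior.mem_nhds hx)
  obtain ⟨t, ht, ht0⟩ := (h2.and self_mem_nhdsWithin).exists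
  have := h.2 _ (interior_subset ht)
  rw [sub_sub_cancel_left, inner_neg_right, real_inner_smul_right, real_inner_self_eq_norm_sq, h.1] at this
  have : 0 < t := ht0
  linarith

/-- A point of the largest disk about an interior point that touches the boundary is smooth. -/
lemma IsProperClosedConvex.exists_smooth_point {K : Set Plane} (hK : IsProperClosedConvex K) :
    ∃ x ∈ K, ∃ u, IsInnerNormal K x u ∧ ∀ v, IsInnerNormal K x v → v = u := by
  obtain ⟨z, hz⟩ := hK.interior_nonempty
  have hne : (Kᶜ).Nonempty := by
    rw [nonempty_compl]; exact hK.ne_univ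
  obtain ⟨x, hx, hd⟩ := isClosed_closure.exists_infDist_eq_dist hne.closure z
  rw [Metric.infDist_closure] at hd
  set r := dist z x
  have hr : 0 < r := by
    apply dist_pos.2
    rintro rfl
    rw [closure_compl] at hx
    exact hx hz
  have hball : Metric.ball z r ⊆ K := by
    intro w hw
    by_contra hw'
    have := Metric.infDist_le_dist_of_mem (x := z) (show w ∈ Kᶜ from hw')
    rw [hd, dist_comm] at this
    exact absurd (Metric.mem_ball.1 hw) (not_lt.2 this)
  have hcb : Metric.closedBall z r ⊆ K := by
    rw [← closure_ball z hr.ne']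
    exact closure_minimal hball hK.isClosed
  have hxK : x ∈ K := hcb (by rw [Metric.mem_closedBall, dist_comm])
  have hxf : x ∈ frontier K := by
    refine ⟨subset_closure hxK, ?_⟩
    rwa [closure_compl] at hx
  -- A supporting line at `x` cannot cut the disk. Testing it at `z - r • v`, the point of the disk
  -- farthest against `v`, gives `⟨v, z - x⟩ ≥ r = ‖z - x‖`, the equality case of Cauchy–Schwarz.
  have key : ∀ v, IsInnerNormal K x v → v = r⁻¹ • (z - x) := by
    intro v hv
    have h1 := hv.2 (z - r • v) (hcb (by
      rw [Metric.mem_closedBall, dist_eq_norm, sub_sub_cancel_left, norm_neg, norm_smul, hv.1,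
        mul_one, Real.norm_of_nonneg hr.le]))
    have h2 : ‖z - x‖ = r := (dist_eq_norm z x).symm
    have h3 : z - r • v - x = (z - x) - r • v := by abel
    rw [h3, inner_sub_right, real_inner_smul_right, real_inner_self_eq_norm_sq, hv.1] at h1
    have h4 : ‖(z - x) - r • v‖ ^ 2 ≤ 0 := by
      rw [norm_sub_sq_real, real_inner_smul_right, norm_smul, hv.1, h2, real_inner_comm,
        Real.norm_of_nonneg hr.le]
      nlinarith
    have h5 : (z - x) - r • v = 0 := by
      rw [← norm_eq_zero]
      exact pow_eq_zero_iff (two_ne_zero) |>.1 (le_antisymm h4 (by positivity))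
    rw [sub_eq_zero.1 h5, smul_smul, inv_mul_cancel₀ hr.ne', one_smul]
  obtain ⟨u, hu⟩ := hK.exists_isInnerNormal hxf
  exact ⟨x, hxK, u, hu, fun v hv => by rw [key v hv, key u hu]⟩

/-- At a smooth point of `K` every ray into the open supporting half-plane starts inside `K`. -/
lemma eventually_smul_mem_of_unique_normal {K : Set Plane} (hK : IsProperClosedConvex K)
    (h0 : (0 : Plane) ∈ K) {u : Plane} (hu : ∀ v, IsInnerNormal K 0 v → v = u) {z : Plane}
    (hz : 0 < inner ℝ u z) : ∃ ε > 0, ∀ t : ℝ, 0 ≤ t → t ≤ ε → t • z ∈ K := by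
  suffices h : ∃ ε > (0 : ℝ), ε • z ∈ K by
    obtain ⟨ε, hε, h⟩ := h
    refine ⟨ε, hε, fun t ht0 ht => ?_⟩
    have := hK.convex.starConvex h0 h (a := 1 - t / ε) (b := t / ε)
      (sub_nonneg.2 ((div_le_one hε).2 ht)) (by positivity) (by ring)
    rwa [smul_zero, zero_add, smul_smul, div_mul_cancel₀ _ hε.ne'] at this
  by_contra! h
  -- If the open ray misses `K`, a line separates them. As the ray accumulates at `0`, the
  -- separating vector is an inner normal at `0`, hence equals `u`; but it is nonpositive on `z`.
  have hD : Convex ℝ ((fun t : ℝ => t • z) '' Ioi 0) :=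
    (convex_Ioi 0).is_linear_image ⟨fun x y => add_smul x y z, fun c x => by simp [mul_smul]⟩
  obtain ⟨v, hv, hsep⟩ := exists_separating hK.convex hK.interior_nonempty hD (by
    rw [disjoint_right]
    rintro _ ⟨t, ht, rfl⟩ h'
    exact h t ht (interior_subset h'))
  have hlim : ∀ w ∈ K, ∀ t > (0 : ℝ), t * inner ℝ v z ≤ inner ℝ v w := by
    intro w hw t ht
    rw [← real_inner_smul_right]
    exact hsep w hw _ ⟨t, ht, rfl⟩
  have hnv : IsInnerNormal K 0 v := by
    refine ⟨hv, fun w hw => ?_⟩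
    rw [sub_zero]
    by_contra! hneg
    rcases le_or_gt 0 (inner ℝ v z) with h1 | h1
    · have := hlim w hw 1 one_pos; linarith
    · have := hlim w hw (inner ℝ v w / (2 * inner ℝ v z)) (div_pos_of_neg_of_neg hneg (by linarith))
      have h2 : inner ℝ v w / (2 * inner ℝ v z) * inner ℝ v z = inner ℝ v w / 2 := by
        rw [div_mul_eq_mul_div, div_eq_div_iff (by linarith) two_ne_zero]; ring
      linarith
  have := hlim 0 h0 1 one_pos
  rw [hu v hnv, inner_zero_right] at this
  linarith

/-! ### Symmetries of limits -/

lemma AffineIsometryEquiv.image_eq_self_iff (χ : Plane ≃ᵃⁱ[ℝ] Plane) (M : Set Plane) :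
    χ '' M = M ↔ ∀ z, χ z ∈ M ↔ z ∈ M := by
  constructor
  · intro h z
    conv_lhs => rw [← h]
    exact χ.injective.mem_set_image
  · intro h
    ext z
    rw [AffineIsometryEquiv.mem_image_iff, ← h (χ.symm z), AffineIsometryEquiv.apply_symm_apply]

lemma AdmitsNontrivialCongruence.smul_preimage {M : Set Plane} (h : AdmitsNontrivialCongruence M)
    {c : ℝ} (hc : c ≠ 0) : AdmitsNontrivialCongruence {z | c • z ∈ M} := by
  obtain ⟨χ, hχ, hM⟩ := h
  rw [AffineIsometryEquiv.image_eq_self_iff] at hM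
  have key : ∀ z, c • (AffineIsometryEquiv.ofParts χ.linearIsometryEquiv (c⁻¹ • χ 0)) z = χ (c • z) := by
    intro z
    rw [AffineIsometryEquiv.ofParts_apply, χ.apply_eq (c • z), smul_add, smul_smul, mul_inv_cancel₀ hc,
      one_smul, map_smul]
  refine ⟨AffineIsometryEquiv.ofParts χ.linearIsometryEquiv (c⁻¹ • χ 0), ?_, ?_⟩
  · intro h
    apply hχ
    ext1 z
    have h1 := key (c⁻¹ • z)
    rw [h, smul_smul, mul_inv_cancel₀ hc, one_smul, AffineIsometryEquiv.coe_refl, id, smul_smul,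
      mul_inv_cancel₀ hc, one_smul] at h1
    rw [← h1]; rfl
  · rw [AffineIsometryEquiv.image_eq_self_iff]
    intro z
    rw [mem_ofPred_eq, mem_ofPred_eq, key, hM]

/-- The linear part of a congruence as a continuous linear map. -/
noncomputable def AffineIsometryEquiv.clm (χ : Plane ≃ᵃⁱ[ℝ] Plane) : Plane →L[ℝ] Plane :=
  χ.linearIsometryEquiv.toLinearIsometry.toContinuousLinearMap

lemma AffineIsometryEquiv.clm_apply (χ : Plane ≃ᵃⁱ[ℝ] Plane) (z : Plane) :
    χ.clm z = χ.linearIsometryEquiv z := rfl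

lemma AffineIsometryEquiv.norm_clm_le (χ : Plane ≃ᵃⁱ[ℝ] Plane) : ‖χ.clm‖ ≤ 1 :=
  ContinuousLinearMap.opNorm_le_bound _ zero_le_one fun z => by
    rw [AffineIsometryEquiv.clm_apply, LinearIsometryEquiv.norm_map, one_mul]

/-- A bounded set with a non-trivial symmetry has one whose linear part is far from the identity. -/
lemma AdmitsNontrivialCongruence.exists_far {M : Set Plane} (h : AdmitsNontrivialCongruence M)
    (hb : Bornology.IsBounded M) (hne : M.Nonempty) :
    ∃ χ : Plane ≃ᵃⁱ[ℝ] Plane, χ '' M = M ∧ 1 / 2 ≤ ‖χ.clm - 1‖ := by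
  by_contra! hcon
  obtain ⟨χ, hχ, hM⟩ := h
  -- Squaring a symmetry with linear part `1 + B`, `‖B‖ < 1 / 2`, gives `1 + 2B + B²`, and `‖2B +
  -- B²‖ ≥ (3 / 2) ‖B‖`. Iteration would exceed `1 / 2` unless `B = 0`; then the symmetry is a
  -- translation, and a bounded set admits only the trivial one.
  have hpow : ∀ n : ℕ, ∃ ψ : Plane ≃ᵃⁱ[ℝ] Plane, ψ '' M = M ∧ (3 / 2) ^ n * ‖χ.clm - 1‖ ≤ ‖ψ.clm - 1‖ := by
    intro n
    induction n with
    | zero => exact ⟨χ, hM, by simp⟩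
    | succ n ih =>
      obtain ⟨ψ, h1, h2⟩ := ih
      refine ⟨ψ.trans ψ, by rw [AffineIsometryEquiv.coe_trans, image_comp, h1, h1], ?_⟩
      have h3 : (ψ.trans ψ).clm - 1 = (2 : ℝ) • (ψ.clm - 1) - (-((ψ.clm - 1) * (ψ.clm - 1))) := by
        have : (ψ.trans ψ).clm = ψ.clm * ψ.clm := rfl
        rw [this, two_smul ℝ (ψ.clm - 1), sub_mul, mul_sub, mul_one, one_mul]; abel
      have h4 := norm_sub_norm_le ((2 : ℝ) • (ψ.clm - 1)) (-((ψ.clm - 1) * (ψ.clm - 1)))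
      rw [← h3, norm_smul, norm_neg, Real.norm_of_nonneg (by norm_num : (0 : ℝ) ≤ 2)] at h4
      have h5 := norm_mul_le (ψ.clm - 1) (ψ.clm - 1)
      have h6 := hcon ψ h1
      have h7 := norm_nonneg (ψ.clm - 1)
      rw [pow_succ]
      nlinarith
  have h0 : ‖χ.clm - 1‖ = 0 := by
    by_contra hne0
    have hpos : 0 < ‖χ.clm - 1‖ := lt_of_le_of_ne (norm_nonneg _) (Ne.symm hne0)
    obtain ⟨n, hn⟩ := pow_unbounded_of_one_lt (1 / ‖χ.clm - 1‖) (by norm_num : (1 : ℝ) < 3 / 2)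
    obtain ⟨ψ, h1, h2⟩ := hpow n
    have := hcon ψ h1
    rw [div_lt_iff₀ hpos] at hn
    linarith
  have h1 : χ.clm = 1 := sub_eq_zero.1 (norm_eq_zero.1 h0)
  have htrans : ∀ z, χ z = z + χ 0 := by
    intro z
    rw [χ.apply_eq z, ← AffineIsometryEquiv.clm_apply, h1]; rfl
  rw [AffineIsometryEquiv.image_eq_self_iff] at hM
  obtain ⟨z, hz⟩ := hne
  have hiter : ∀ n : ℕ, z + (n : ℝ) • χ 0 ∈ M := by
    intro n
    induction n with
    | zero => simpa
    | succ n ih =>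
      rw [← hM, htrans] at ih
      rw [Nat.cast_succ, add_smul, one_smul, ← add_assoc]; exact ih
  have hχ0 : χ 0 = 0 := by
    by_contra hne0
    obtain ⟨C, hC⟩ := hb.exists_norm_le
    have hpos := norm_pos_iff.2 hne0
    obtain ⟨n, hn⟩ := exists_nat_gt ((2 * C) / ‖χ 0‖)
    rw [div_lt_iff₀ hpos] at hn
    have h2 := hC _ (hiter n)
    have h3 := hC _ hz
    have h4 := norm_sub_le (z + (n : ℝ) • χ 0) z
    rw [add_sub_cancel_left, norm_smul, Real.norm_of_nonneg (Nat.cast_nonneg n)] at h4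
    linarith
  apply hχ
  ext1 w
  rw [htrans, hχ0, add_zero]; rfl

/-- Symmetries of the sets `N n`, chosen with linear part at distance at least `1 / 2` from the
identity, lie in a compact set of pairs (linear part, translation). A limit of them maps `T` to
itself, as does its inverse, and is still far from the identity. -/
lemma admitsNontrivialCongruence_of_approx {T D : Set Plane} (hT : IsCompact T)
    (hDT : T ⊆ closure D) (hne : D.Nonempty) (N : ℕ → Set Plane) (hN : ∀ n, N n ⊆ T)
    (hDN : ∀ z ∈ D, ∀ᶠ n in atTop, z ∈ N n)
    (hs : ∀ᶠ n in atTop, AdmitsNontrivialCongruence (N n)) : AdmitsNontrivialCongruence T := by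
  obtain ⟨d, hd⟩ := hne
  have hex : ∀ᶠ n in atTop, ∃ χ : Plane ≃ᵃⁱ[ℝ] Plane, (χ '' N n = N n ∧ 1 / 2 ≤ ‖χ.clm - 1‖) := by
    filter_upwards [hs, hDN d hd] with n h1 h2
    exact h1.exists_far (hT.isBounded.subset (hN n)) ⟨d, h2⟩
  have hex' : ∀ n, ∃ χ : Plane ≃ᵃⁱ[ℝ] Plane,
      (∃ χ : Plane ≃ᵃⁱ[ℝ] Plane, (χ '' N n = N n ∧ 1 / 2 ≤ ‖χ.clm - 1‖)) →
      (χ '' N n = N n ∧ 1 / 2 ≤ ‖χ.clm - 1‖) := by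
    intro n
    by_cases h : ∃ χ : Plane ≃ᵃⁱ[ℝ] Plane, (χ '' N n = N n ∧ 1 / 2 ≤ ‖χ.clm - 1‖)
    · obtain ⟨χ, hχ⟩ := h; exact ⟨χ, fun _ => hχ⟩
    · exact ⟨AffineIsometryEquiv.refl ℝ Plane, fun h' => absurd h' h⟩
  choose χ hχ using hex'
  obtain ⟨R, hR⟩ := hT.isBounded.exists_norm_le
  -- Limits along an ultrafilter replace the choice of a convergent subsequence.
  set U : Ultrafilter ℕ := hyperfilter ℕ
  have hU : (U : Filter ℕ) ≤ atTop := Nat.hyperfilter_le_atTop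
  have hsym : ∀ᶠ n in (U : Filter ℕ), χ n '' N n = N n ∧ 1 / 2 ≤ ‖(χ n).clm - 1‖ :=
    hU (hex.mono fun n hn => hχ n hn)
  have hdN : ∀ z ∈ D, ∀ᶠ n in (U : Filter ℕ), z ∈ N n := fun z hz => hU (hDN z hz)
  have hbound : ∀ᶠ n in (U : Filter ℕ), ((χ n).clm, χ n 0) ∈
      (Metric.closedBall (0 : Plane →L[ℝ] Plane) 1 ×ˢ Metric.closedBall (0 : Plane) (2 * R)) := by
    filter_upwards [hsym, hdN d hd] with n h1 h2
    rw [AffineIsometryEquiv.image_eq_self_iff] at h1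
    refine ⟨by simpa using (χ n).norm_clm_le, ?_⟩
    have h3 := hR _ (hN n ((h1.1 d).2 h2))
    have h4 := hR _ (hN n h2)
    have h5 : χ n 0 = χ n d - (χ n).linearIsometryEquiv d := by rw [(χ n).apply_eq d]; abel
    simp only [mem_closedBall_zero_iff]
    rw [h5]
    have := norm_sub_le (χ n d) ((χ n).linearIsometryEquiv d)
    rw [LinearIsometryEquiv.norm_map] at this
    linarith
  have : ProperSpace (Plane →L[ℝ] Plane) := FiniteDimensional.proper ℝ _
  have hcpt : IsCompact (Metric.closedBall (0 : Plane →L[ℝ] Plane) 1 ×ˢ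
      Metric.closedBall (0 : Plane) (2 * R)) :=
    (isCompact_closedBall _ _).prod (isCompact_closedBall _ _)
  obtain ⟨⟨A, b⟩, -, hlim⟩ := isCompact_iff_ultrafilter_le_nhds.1 hcpt
    (U.map fun n => ((χ n).clm, χ n 0)) (le_principal_iff.2 hbound)
  have hlim' : Tendsto (fun n => ((χ n).clm, χ n 0)) U (𝓝 (A, b)) := hlim
  have hA : Tendsto (fun n => (χ n).clm) U (𝓝 A) := (continuous_fst.tendsto _).comp hlim'
  have hb : Tendsto (fun n => χ n 0) U (𝓝 b) := (continuous_snd.tendsto _).comp hlim'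
  have hAz : ∀ z, Tendsto (fun n => (χ n).clm z) U (𝓝 (A z)) := fun z =>
    ((ContinuousLinearMap.apply ℝ Plane z).continuous.tendsto A).comp hA
  have hχz : ∀ z, Tendsto (fun n => χ n z) U (𝓝 (A z + b)) := fun z => by
    have := (hAz z).add hb
    refine this.congr fun n => ?_
    rw [(χ n).apply_eq z]; rfl
  have hnorm : ∀ z, ‖A z‖ = ‖z‖ := fun z => by
    refine tendsto_nhds_unique (hAz z).norm ?_
    simp only [AffineIsometryEquiv.clm_apply, LinearIsometryEquiv.norm_map]
    exact tendsto_const_nhds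
  have hfar : 1 / 2 ≤ ‖A - 1‖ :=
    ge_of_tendsto (hA.sub_const 1).norm (hsym.mono fun n hn => hn.2)
  let Ae : Plane ≃ₗᵢ[ℝ] Plane := LinearIsometry.toLinearIsometryEquiv ⟨A.toLinearMap, hnorm⟩ rfl
  have hAe : ∀ z, Ae z = A z := fun z => rfl
  let ψ := AffineIsometryEquiv.ofParts Ae b
  have hψ : ∀ z, ψ z = A z + b := fun z => AffineIsometryEquiv.ofParts_apply Ae b z
  have himg : ∀ z ∈ T, ψ z ∈ T := by
    have h1 : MapsTo ψ D T := fun z hz => by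
      rw [hψ]
      refine hT.isClosed.mem_of_tendsto (hχz z) ?_
      filter_upwards [hsym, hdN z hz] with n h1 h2
      rw [AffineIsometryEquiv.image_eq_self_iff] at h1
      exact hN n ((h1.1 z).2 h2)
    intro z hz
    have := h1.closure ψ.continuous (hDT hz)
    rwa [hT.isClosed.closure_eq] at this
  have hinv : ∀ z ∈ T, ψ.symm z ∈ T := by
    have h1 : MapsTo ψ.symm D T := fun z hz => by
      refine hT.isClosed.mem_of_tendsto (f := fun n => (χ n).symm z) (b := (U : Filter ℕ)) ?_ ?_
      · rw [tendsto_iff_dist_tendsto_zero]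
        have h2 := (hχz (ψ.symm z)).dist (tendsto_const_nhds (x := z))
        rw [← hψ, ψ.apply_symm_apply, dist_self] at h2
        refine h2.congr fun n => ?_
        rw [← (χ n).dist_map ((χ n).symm z), (χ n).apply_symm_apply, dist_comm]
      · filter_upwards [hsym, hdN z hz] with n h1 h2
        rw [AffineIsometryEquiv.image_eq_self_iff] at h1
        apply hN n
        rw [← h1.1, (χ n).apply_symm_apply]; exact h2
    intro z hz
    have := h1.closure ψ.symm.continuous (hDT hz)
    rwa [hT.isClosed.closure_eq] at this
  refine ⟨ψ, fun h => ?_, ?_⟩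
  · have h2 : A = 1 := by
      ext1 z
      have h3 := hψ z
      have h4 := hψ 0
      rw [h] at h3 h4
      simp only [AffineIsometryEquiv.coe_refl, id, map_zero, zero_add] at h3 h4
      rw [← h4, add_zero] at h3
      exact h3.symm
    rw [h2, sub_self, norm_zero] at hfar
    linarith
  · rw [AffineIsometryEquiv.image_eq_self_iff]
    exact fun z => ⟨fun h => by simpa using hinv _ h, himg z⟩

/-! ### Triangles -/

/-- The determinant of two vectors. -/
def Plane.cross (z w : Plane) : ℝ := z 0 * w 1 - z 1 * w 0

/-- The hull is spanned by its extreme points, which are among the three vertices. If `p` were not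
one of them, it would lie on the segment from `q` to `r`. -/
lemma mem_extremePoints_triangle {p q r : Plane} (h : Plane.cross (q - p) (r - p) ≠ 0) :
    p ∈ (convexHull ℝ {p, q, r}).extremePoints ℝ := by
  by_contra hp
  have h1 : (convexHull ℝ ({p, q, r} : Set Plane)).extremePoints ℝ ⊆ {q, r} := fun z hz => by
    rcases extremePoints_convexHull_subset hz with rfl | h
    · exact absurd hz hp
    · exact h
  have hfin : ({p, q, r} : Set Plane).Finite := by simp
  have h2 := closure_convexHull_extremePoints (hfin.isCompact_convexHull (𝕜 := ℝ)) (convex_convexHull ℝ _)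
  have h3 : p ∈ convexHull ℝ ({p, q, r} : Set Plane) := subset_convexHull _ _ (by simp)
  rw [← h2] at h3
  have hfin' : ({q, r} : Set Plane).Finite := by simp
  have h4 : p ∈ convexHull ℝ ({q, r} : Set Plane) :=
    closure_minimal (convexHull_mono h1) (hfin'.isCompact_convexHull (𝕜 := ℝ)).isClosed h3
  rw [convexHull_pair] at h4
  obtain ⟨a, b, -, -, hab, rfl⟩ := h4
  apply h
  obtain rfl : b = 1 - a := by linarith
  simp [Plane.cross]; ring

lemma AffineIsometryEquiv.eq_refl_of_fix {χ : Plane ≃ᵃⁱ[ℝ] Plane} {p q r : Plane}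
    (h : Plane.cross (q - p) (r - p) ≠ 0) (hp : χ p = p) (hq : χ q = q) (hr : χ r = r) :
    χ = AffineIsometryEquiv.refl ℝ Plane := by
  ext1 z
  have hlin : ∀ w, χ.linearIsometryEquiv (w - p) = χ w - p := fun w => by
    have := χ.map_vsub w p
    rwa [hp] at this
  set D := Plane.cross (q - p) (r - p) with hD
  have hz : z - p = (Plane.cross (z - p) (r - p) / D) • (q - p) +
      (Plane.cross (q - p) (z - p) / D) • (r - p) := by
    apply Plane.ext
    all_goals
      simp only [Plane.cross, PiLp.sub_apply, PiLp.add_apply, PiLp.smul_apply, smul_eq_mul] at hD ⊢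
      field_simp
      rw [hD]; ring
  have h1 := hlin z
  rw [hz, map_add, map_smul, map_smul, hlin, hlin, hq, hr, ← hz] at h1
  exact (sub_left_inj.1 h1).symm

/-- A symmetry permutes the extreme points, that is the vertices, and preserves their distances.
Three different side lengths leave only the identity permutation, and an isometry fixing three
non-collinear points is the identity. -/
lemma not_admitsNontrivialCongruence_triangle {p q r : Plane} (h : Plane.cross (q - p) (r - p) ≠ 0)
    (h1 : dist p q ≠ dist p r) (h2 : dist p q ≠ dist q r) (h3 : dist p r ≠ dist q r) :
    ¬ AdmitsNontrivialCongruence (convexHull ℝ {p, q, r}) := by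
  rintro ⟨χ, hχ, hT⟩
  set T := convexHull ℝ ({p, q, r} : Set Plane) with hTdef
  have hext : χ '' (T.extremePoints ℝ) = T.extremePoints ℝ := by
    conv_rhs => rw [← hT]
    ext z
    rw [AffineIsometryEquiv.mem_image_iff]
    simp only [mem_extremePoints, AffineIsometryEquiv.mem_image_iff]
    have hseg : ∀ x y w : Plane, w ∈ openSegment ℝ x y ↔ χ.symm w ∈ openSegment ℝ (χ.symm x) (χ.symm y) := by
      intro x y w
      have := image_openSegment ℝ χ.symm.toAffineEquiv.toAffineMap x y
      have h' : χ.symm '' openSegment ℝ x y = openSegment ℝ (χ.symm x) (χ.symm y) := this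
      rw [← h']
      exact (χ.symm.injective.mem_set_image).symm
    constructor
    · rintro ⟨hz, h⟩
      refine ⟨hz, fun x hx y hy hw => ?_⟩
      have := h _ hx _ hy ((hseg _ _ _).1 hw)
      exact ⟨χ.symm.injective this.1, χ.symm.injective this.2⟩
    · rintro ⟨hz, h⟩
      refine ⟨hz, fun x hx y hy hw => ?_⟩
      have := h (χ x) (by simpa) (χ y) (by simpa) ((hseg _ _ _).2 (by simpa using hw))
      exact ⟨by rw [← this.1]; simp, by rw [← this.2]; simp⟩
  have hsub : ∀ z ∈ T.extremePoints ℝ, χ z = p ∨ χ z = q ∨ χ z = r := fun z hz => by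
    have : χ z ∈ T.extremePoints ℝ := by rw [← hext]; exact mem_image_of_mem _ hz
    have h' : χ z ∈ ({p, q, r} : Set Plane) := extremePoints_convexHull_subset this
    exact h'
  have hq : Plane.cross (p - q) (r - q) ≠ 0 := by
    contrapose! h
    simp only [Plane.cross, PiLp.sub_apply] at h ⊢
    linear_combination -h
  have hr : Plane.cross (p - r) (q - r) ≠ 0 := by
    contrapose! h
    simp only [Plane.cross, PiLp.sub_apply] at h ⊢
    linear_combination h
  have hqT : q ∈ T.extremePoints ℝ := by
    have := mem_extremePoints_triangle hq
    rwa [insert_comm] at this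
  have hrT : r ∈ T.extremePoints ℝ := by
    have := mem_extremePoints_triangle hr
    rwa [insert_comm, pair_comm] at this
  have hp' := hsub p (mem_extremePoints_triangle h)
  have hq' := hsub q hqT
  have hr' := hsub r hrT
  have hpq : p ≠ q := by rintro rfl; simp [Plane.cross] at h
  have hpr : p ≠ r := by rintro rfl; simp [Plane.cross] at h
  have hqr : q ≠ r := by rintro rfl; simp [Plane.cross] at hq
  have d1 := χ.dist_map p q
  have d2 := χ.dist_map p r
  have d3 := χ.dist_map q r
  have e1 := dist_pos.2 hpq
  have e2 := dist_pos.2 hpr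
  have e3 := dist_pos.2 hqr
  suffices χ p = p ∧ χ q = q ∧ χ r = r from hχ (χ.eq_refl_of_fix h this.1 this.2.1 this.2.2)
  have c1 := dist_comm p q
  have c2 := dist_comm p r
  have c3 := dist_comm q r
  have s1 := dist_self p
  have s2 := dist_self q
  have s3 := dist_self r
  rcases hp' with hp' | hp' | hp' <;> rcases hq' with hq' | hq' | hq' <;>
    rcases hr' with hr' | hr' | hr' <;> rw [hp', hq'] at d1 <;> rw [hp', hr'] at d2 <;>
    rw [hq', hr'] at d3 <;>
    first
    | exact ⟨hp', hq', hr'⟩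
    | (exfalso; linarith)
    | (exfalso; apply h1; linarith)
    | (exfalso; apply h2; linarith)
    | (exfalso; apply h3; linarith)

lemma Convex.interior_nonempty_of_corner {M : Set Plane} (hM : Convex ℝ M) {d : Plane} {η : ℝ}
    (hη : 0 < η) (h0 : d ∈ M) (h1 : d + !₂[η, 0] ∈ M) (h2 : d + !₂[0, η] ∈ M) :
    (interior M).Nonempty := by
  have hU : IsOpen {z : Plane | d 0 < z 0 ∧ d 1 < z 1 ∧ (z 0 - d 0) + (z 1 - d 1) < η} := by
    have c0 := Plane.continuous_coord 0
    have c1 := Plane.continuous_coord 1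
    exact (isOpen_lt continuous_const c0).inter ((isOpen_lt continuous_const c1).inter
      (isOpen_lt ((c0.sub continuous_const).add (c1.sub continuous_const)) continuous_const))
  refine ⟨d + !₂[η / 3, η / 3], interior_maximal ?_ hU ?_⟩
  · rintro z ⟨hz0, hz1, hz2⟩
    have := hM.sum_mem (t := Finset.univ) (w := ![1 - (z 0 - d 0) / η - (z 1 - d 1) / η,
      (z 0 - d 0) / η, (z 1 - d 1) / η]) (z := ![d, d + !₂[η, 0], d + !₂[0, η]]) (by
        have e1 : 0 ≤ 1 - (z 0 - d 0) / η - (z 1 - d 1) / η := by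
          have : (z 0 - d 0) / η + (z 1 - d 1) / η ≤ 1 := by
            rw [← add_div]; exact (div_le_one hη).2 hz2.le
          linarith
        have e2 : 0 ≤ (z 0 - d 0) / η := div_nonneg (by linarith) hη.le
        have e3 : 0 ≤ (z 1 - d 1) / η := div_nonneg (by linarith) hη.le
        intro i _
        fin_cases i
        · exact e1
        · exact e2
        · exact e3) (by simp [Fin.sum_univ_three]; ring) (by
        intro i _
        fin_cases i
        · exact h0
        · exact h1
        · exact h2)
    convert this using 1
    simp only [Fin.sum_univ_three, Matrix.cons_val_zero, Matrix.cons_val_one, Matrix.cons_val]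
    apply Plane.ext <;> simp <;> field_simp <;> ring
  · refine ⟨?_, ?_, ?_⟩ <;> simp <;> linarith

/-! ### Corners -/

lemma Plane.smul_mk (c a b : ℝ) : c • (!₂[a, b] : Plane) = !₂[c * a, c * b] := by
  apply Plane.ext <;> simp

lemma exists_rigid_normalize (x : Plane) {u v : Plane} (hu : ‖u‖ = 1) (hv : ‖v‖ = 1) :
    ∃ φ : Plane ≃ᵃⁱ[ℝ] Plane, OrientationPreserving φ ∧ φ x = 0 ∧ φ.linearIsometryEquiv u = v := by
  rw [Plane.norm_eq_one_iff] at hu hv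
  set a := u 0 * v 0 + u 1 * v 1 with ha
  set b := u 0 * v 1 - u 1 * v 0 with hb
  obtain ⟨φ, h1, h2⟩ := exists_rigid a b (by
    rw [ha, hb]; linear_combination (v 0 ^ 2 + v 1 ^ 2) * hu + hv)
    !₂[-(a * x 0 - b * x 1), -(b * x 0 + a * x 1)]
  refine ⟨φ, h1, ?_, ?_⟩
  · rw [h2]; apply Plane.ext <;> simp
  · have h3 := φ.apply_eq u
    rw [← sub_eq_iff_eq_add] at h3
    rw [← h3, h2, h2]
    apply Plane.ext
    · simp [ha, hb]; linear_combination (v 0) * hu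
    · simp [ha, hb]; linear_combination (v 1) * hu

lemma exists_rigid_translation (v : Plane) :
    ∃ φ : Plane ≃ᵃⁱ[ℝ] Plane, OrientationPreserving φ ∧ ∀ z, φ z = z + v := by
  obtain ⟨φ, h1, h2⟩ := exists_rigid 1 0 (by norm_num) v
  exact ⟨φ, h1, fun z => by rw [h2]; apply Plane.ext <;> simp⟩

lemma Convex.smul_add_smul_mem {K : Set Plane} (hK : Convex ℝ K) (h0 : (0 : Plane) ∈ K) {p q : Plane}
    (hp : p ∈ K) (hq : q ∈ K) {s t : ℝ} (hs : 0 ≤ s) (ht : 0 ≤ t) (hst : s + t ≤ 1) :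
    s • p + t • q ∈ K := by
  have := hK.sum_mem (t := Finset.univ) (w := ![1 - s - t, s, t]) (z := ![0, p, q])
    (by intro i _; fin_cases i <;> simp <;> linarith) (by simp [Fin.sum_univ_three]; ring)
    (by intro i _; fin_cases i <;> simp [*])
  simpa [Fin.sum_univ_three] using this

lemma triangle_coords {A B z : Plane} (h : z ∈ convexHull ℝ ({0, A, B} : Set Plane)) :
    ∃ s t : ℝ, 0 ≤ s ∧ 0 ≤ t ∧ s + t ≤ 1 ∧ z = s • A + t • B := by
  rw [convexHull_insert (by simp), convexHull_pair] at h
  obtain ⟨o, ho, w, ⟨a, b, ha, hb, hab, rfl⟩, c, d, hc, hd, hcd, rfl⟩ := mem_convexJoin.1 h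
  obtain rfl := mem_singleton_iff.1 ho
  refine ⟨d * a, d * b, by positivity, by positivity, by rw [← mul_add, hab]; linarith, ?_⟩
  simp [smul_smul]

/-- For the triangle with vertices `0`, `(a * r, a)` and `(l, 1)`, the three inequations say that no
two sides are equal. -/
lemma exists_scalene (r l : ℝ) : ∃ a : ℝ, 0 < a ∧ a ^ 2 * (r ^ 2 + 1) ≠ l ^ 2 + 1 ∧
    l ^ 2 + 1 ≠ 2 * a * (r * l + 1) ∧ a * (r ^ 2 + 1) ≠ 2 * (r * l + 1) := by
  set k := |r * l + 1| with hk
  have hk0 : 0 ≤ k := abs_nonneg _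
  have hinv : 0 ≤ 1 / k := by positivity
  have hle := le_abs_self (r * l + 1)
  -- The witness exceeds every bad value of `a`: the summand with `1 / k` makes `2 * a * k` larger
  -- than `l ^ 2 + 1`, and `2 * k + 1` serves the last inequation. For `k = 0` the convention `1 / 0
  -- = 0` is harmless, since then `r * l + 1 ≤ 0` falls under the other case.
  refine ⟨(l ^ 2 + 1) * (1 + 1 / k) + 2 * k + 1, by positivity, ne_of_gt ?_, ?_, ne_of_gt ?_⟩
  · have h1 : l ^ 2 + 1 < (l ^ 2 + 1) * (1 + 1 / k) + 2 * k + 1 := by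
      nlinarith [mul_nonneg (by positivity : 0 ≤ l ^ 2 + 1) hinv]
    have h2 : 1 ≤ (l ^ 2 + 1) * (1 + 1 / k) + 2 * k + 1 := by nlinarith [sq_nonneg l]
    nlinarith [sq_nonneg r, sq_nonneg (((l ^ 2 + 1) * (1 + 1 / k) + 2 * k + 1) * r)]
  · rcases le_or_gt (r * l + 1) 0 with h | h
    · apply ne_of_gt
      have : 0 ≤ (l ^ 2 + 1) * (1 + 1 / k) + 2 * k + 1 := by positivity
      nlinarith [sq_nonneg l]
    · have hkk : k = r * l + 1 := abs_of_pos h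
      apply ne_of_lt
      rw [← hkk] at h ⊢
      have : 2 * ((l ^ 2 + 1) * (1 + 1 / k) + 2 * k + 1) * k
        = 2 * (l ^ 2 + 1) + 2 * (l ^ 2 + 1) * k + 4 * k ^ 2 + 2 * k := by field_simp; ring
      rw [this]
      nlinarith [sq_nonneg l, mul_pos (by positivity : 0 < l ^ 2 + 1) h]
  · have h1 : 2 * k + 1 ≤ (l ^ 2 + 1) * (1 + 1 / k) + 2 * k + 1 := by
      have : 0 ≤ (l ^ 2 + 1) * (1 + 1 / k) := by positivity
      linarith
    nlinarith [sq_nonneg r]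

/-- Magnified at the apex, `K` fills out its tangent cone and a copy of `L` touching at a smooth
point fills out a half-plane. The half-plane is chosen to cut a scalene triangle from the cone, so
sufficiently magnified intersections approximate a triangle without symmetry. -/
lemma not_allIntersections_of_cone {K L : Set Plane} (hK : IsProperClosedConvex K)
    (hL : IsProperClosedConvex L) (h0 : (0 : Plane) ∈ K) {m : ℝ} (hm : 0 < m)
    (hcone : ∀ z ∈ K, |z 0| ≤ m * z 1) (H : AllIntersections AdmitsNontrivialCongruence K L) :
    False := by
  have hz1 : ∀ z ∈ K, 0 ≤ z 1 := fun z hz => by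
    have := (abs_nonneg _).trans (hcone z hz)
    exact nonneg_of_mul_nonneg_right this hm
  -- the slopes of the tangent cone
  set S : Set ℝ := {x | ∃ z ∈ K, 0 < z 1 ∧ x = z 0 / z 1} with hS
  have hSb : ∀ x ∈ S, |x| ≤ m := by
    rintro _ ⟨z, hz, h1, rfl⟩
    rw [abs_div, abs_of_pos h1, div_le_iff₀ h1]
    exact hcone z hz
  have hSa : BddAbove S := ⟨m, fun x hx => (abs_le.1 (hSb x hx)).2⟩
  have hSbel : BddBelow S := ⟨-m, fun x hx => (abs_le.1 (hSb x hx)).1⟩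
  obtain ⟨c, hc⟩ := hK.interior_nonempty
  obtain ⟨η, hη, hηK⟩ : ∃ η > 0, c + !₂[η, 0] ∈ K := by
    have h1 : Tendsto (fun t : ℝ => c + t • !₂[(1 : ℝ), 0]) (𝓝[>] 0) (𝓝 c) := by
      have : Continuous fun t : ℝ => c + t • !₂[(1 : ℝ), 0] := by fun_prop
      have := this.tendsto 0
      simp only [zero_smul, add_zero] at this
      exact this.mono_left nhdsWithin_le_nhds
    obtain ⟨t, ht, ht0⟩ := ((h1.eventually (isOpen_interior.mem_nhds hc)).and self_mem_nhdsWithin).exists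
    refine ⟨t, ht0, ?_⟩
    have := interior_subset ht
    convert this using 2
    apply Plane.ext <;> simp
  have hcK := interior_subset hc
  have hc1 : 0 < c 1 := by
    refine lt_of_le_of_ne (hz1 c hcK) fun h => ?_
    have e1 := hcone c hcK
    have e2 := hcone _ hηK
    simp only [PiLp.add_apply, Matrix.cons_val_zero, Matrix.cons_val_one] at e2
    rw [← h, mul_zero] at e1
    have e3 := abs_nonpos_iff.1 e1
    rw [e3, ← h, zero_add, add_zero, mul_zero] at e2
    exact hη.ne' (abs_nonpos_iff.1 e2)
  have hcS : c 0 / c 1 ∈ S := ⟨c, hcK, hc1, rfl⟩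
  have hcS' : (c 0 + η) / c 1 ∈ S := ⟨_, hηK, by simpa using hc1, by simp⟩
  set l := sInf S with hl
  set r := sSup S with hr
  have hlr : l < r := by
    have e1 : l ≤ c 0 / c 1 := csInf_le hSbel hcS
    have e2 : (c 0 + η) / c 1 ≤ r := le_csSup hSa hcS'
    have e3 : c 0 / c 1 < (c 0 + η) / c 1 := by gcongr; linarith
    linarith
  have hd : 0 < r - l := sub_pos.2 hlr
  have hsub : ∀ z ∈ K, l * z 1 ≤ z 0 ∧ z 0 ≤ r * z 1 := by
    intro z hz
    rcases (hz1 z hz).eq_or_lt with h | h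
    · have := hcone z hz
      rw [← h, mul_zero] at this
      rw [abs_nonpos_iff.1 this, ← h]; simp
    · have e1 : l ≤ z 0 / z 1 := csInf_le hSbel ⟨z, hz, h, rfl⟩
      have e2 : z 0 / z 1 ≤ r := le_csSup hSa ⟨z, hz, h, rfl⟩
      rw [le_div_iff₀ h] at e1
      rw [div_le_iff₀ h] at e2
      exact ⟨e1, e2⟩
  -- A direction strictly between the extreme slopes is a positive combination of two points `p`,
  -- `q` of `K`, so convexity with the apex puts the start of its ray in `K`.
  have hin : ∀ z : Plane, l * z 1 < z 0 → z 0 < r * z 1 → ∃ ε > 0, ∀ t : ℝ, 0 ≤ t → t ≤ ε → t • z ∈ K := by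
    intro z h1 h2
    have hzp : 0 < z 1 := by nlinarith
    obtain ⟨_, ⟨p, hp, hp1, rfl⟩, hlt⟩ := exists_lt_of_csInf_lt ⟨_, hcS⟩ ((lt_div_iff₀ hzp).2 h1)
    obtain ⟨_, ⟨q, hq, hq1, rfl⟩, hlt'⟩ := exists_lt_of_lt_csSup ⟨_, hcS⟩ ((div_lt_iff₀ hzp).2 h2)
    rw [div_lt_div_iff₀ hp1 hzp] at hlt
    rw [div_lt_div_iff₀ hzp hq1] at hlt'
    have hdet : 0 < q 0 * p 1 - p 0 * q 1 := by
      have e1 := mul_lt_mul_of_pos_right hlt hq1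
      have e2 := mul_lt_mul_of_pos_right hlt' hp1
      have : 0 < (q 0 * p 1 - p 0 * q 1) * z 1 := by nlinarith
      exact pos_of_mul_pos_left this hzp.le
    obtain ⟨Δ, hΔ⟩ : ∃ Δ, Δ = q 0 * p 1 - p 0 * q 1 := ⟨_, rfl⟩
    rw [← hΔ] at hdet
    set α := (q 0 * z 1 - q 1 * z 0) / Δ with hα
    set β := (p 1 * z 0 - p 0 * z 1) / Δ with hβ
    have hα0 : 0 < α := div_pos (by linarith) hdet
    have hβ0 : 0 < β := div_pos (by linarith) hdet
    have hz : z = α • p + β • q := by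
      apply Plane.ext <;> simp only [PiLp.add_apply, PiLp.smul_apply, smul_eq_mul, hα, hβ] <;>
        field_simp <;> rw [hΔ] <;> ring
    refine ⟨1 / (α + β), by positivity, fun t ht0 ht => ?_⟩
    rw [hz, smul_add, smul_smul, smul_smul]
    refine hK.convex.smul_add_smul_mem h0 hp hq (by positivity) (by positivity) ?_
    rw [← mul_add]
    rwa [le_div_iff₀ (by positivity)] at ht
  -- a scalene triangle cut off from the tangent cone
  obtain ⟨a, ha, hs1, hs2, hs3⟩ := exists_scalene r l
  set A : Plane := !₂[a * r, a] with hA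
  set B : Plane := !₂[l, 1] with hB
  have hA0 : A 0 = a * r := by simp [hA]
  have hA1 : A 1 = a := by simp [hA]
  have hB0 : B 0 = l := by simp [hB]
  have hB1 : B 1 = 1 := by simp [hB]
  have hcross : Plane.cross (A - 0) (B - 0) ≠ 0 := by
    simp only [Plane.cross, sub_zero, hA0, hA1, hB0, hB1]
    have : 0 < a * (r - l) := by positivity
    intro h; linarith
  have hnot : ¬ AdmitsNontrivialCongruence (convexHull ℝ {0, A, B}) := by
    refine not_admitsNontrivialCongruence_triangle hcross ?_ ?_ ?_ <;> intro h <;>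
      have h' := congrArg (· ^ 2) h <;>
      simp only [Plane.dist_sq_eq, hA0, hA1, hB0, hB1, PiLp.zero_apply] at h'
    · apply hs1; linear_combination h'
    · apply hs2; linear_combination -h'
    · apply hs3
      have : a * (a * (r ^ 2 + 1) - 2 * (r * l + 1)) = 0 := by linear_combination -h'
      rcases mul_eq_zero.1 this with h | h
      · exact absurd h ha.ne'
      · linarith
  apply hnot
  -- The linear form that equals `1` on the line through `A` and `B`; it describes the third side of
  -- the triangle.
  set w : Plane := !₂[(1 / a - 1) / (r - l), (r - l / a) / (r - l)] with hw
  have hwA : inner ℝ w A = 1 := by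
    rw [Plane.inner_eq, hA0, hA1]; simp [hw]; field_simp; ring
  have hwB : inner ℝ w B = 1 := by
    rw [Plane.inner_eq, hB0, hB1]; simp [hw]; field_simp; ring
  have hw0 : w ≠ 0 := by intro h; rw [h, inner_zero_left] at hwA; norm_num at hwA
  have hwn : 0 < ‖w‖ := norm_pos_iff.2 hw0
  have hcoord : ∀ z : Plane, z = ((z 0 - l * z 1) / (a * (r - l))) • A + ((r * z 1 - z 0) / (r - l)) • B := by
    intro z
    apply Plane.ext <;> simp only [PiLp.add_apply, PiLp.smul_apply, smul_eq_mul, hA0, hA1, hB0, hB1] <;>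
      field_simp <;> ring
  have hinner : ∀ z : Plane, inner ℝ w z = (z 0 - l * z 1) / (a * (r - l)) + (r * z 1 - z 0) / (r - l) := by
    intro z
    conv_lhs => rw [hcoord z]
    rw [inner_add_right, real_inner_smul_right, real_inner_smul_right, hwA, hwB, mul_one, mul_one]
  obtain ⟨y, hyL, u, hu, huniq⟩ := hL.exists_smooth_point
  obtain ⟨φ, hφ, hφy, hφu⟩ := exists_rigid_normalize y hu.1
    (v := -(‖w‖⁻¹ • w)) (by rw [norm_neg, norm_smul]; simp [hwn.ne'])
  set L' := φ '' L with hL'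
  have hL'p : IsProperClosedConvex L' := hL.image φ
  have hL'0 : (0 : Plane) ∈ L' := ⟨y, hyL, hφy⟩
  have hL'n : IsInnerNormal L' 0 (-(‖w‖⁻¹ • w)) := by
    have := hu.image φ
    rwa [hφy, hφu] at this
  have hL'u : ∀ v, IsInnerNormal L' 0 v → v = -(‖w‖⁻¹ • w) := by
    intro v hv
    have h1 := hv.image φ.symm
    have h2 : φ.symm '' L' = L := by rw [hL']; ext; simp
    rw [h2, ← hφy, φ.symm_apply_apply] at h1
    rw [← hφu, ← huniq _ h1]
    exact (φ.linearIsometryEquiv.apply_symm_apply v).symm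
  -- The foot of the perpendicular from `0` to the line `AB`. The smooth point of `L` is placed at
  -- `ε • e`, where `ε = 1 / (n + 1)`.
  set e : Plane := (‖w‖ ^ 2)⁻¹ • w with he
  have hwe : inner ℝ w e = 1 := by
    rw [he, real_inner_smul_right, real_inner_self_eq_norm_sq]; field_simp
  set N : ℕ → Set Plane := fun n => {z | (1 / ((n : ℝ) + 1)) • z ∈ K ∧ (1 / ((n : ℝ) + 1)) • (z - e) ∈ L'}
    with hN
  set D : Set Plane := {z | l * z 1 < z 0 ∧ z 0 < r * z 1 ∧ inner ℝ w z < 1} with hD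
  have hpos : ∀ n : ℕ, 0 < 1 / ((n : ℝ) + 1) := fun n => by positivity
  -- Each point of the open triangle `D` lies in all sufficiently magnified intersections: by `hin`
  -- for `K`, by smoothness at `0` for `L'`.
  have hDN : ∀ z ∈ D, ∀ᶠ n in atTop, z ∈ N n := by
    rintro z ⟨h1, h2, h3⟩
    obtain ⟨ε, hε, hε'⟩ := hin z h1 h2
    obtain ⟨δ, hδ, hδ'⟩ := eventually_smul_mem_of_unique_normal hL'p hL'0 hL'u (z := z - e) (by
      rw [inner_neg_left, real_inner_smul_left, inner_sub_right, hwe]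
      have : 0 < ‖w‖⁻¹ * (1 - inner ℝ w z) := mul_pos (by positivity) (by linarith)
      linarith)
    have ht := tendsto_one_div_add_atTop_nhds_zero_nat (𝕜 := ℝ)
    filter_upwards [ht.eventually (ge_mem_nhds hε), ht.eventually (ge_mem_nhds hδ)] with n e1 e2
    exact ⟨hε' _ (hpos n).le e1, hδ' _ (hpos n).le e2⟩
  have hDo : IsOpen D := by
    have c0 := Plane.continuous_coord 0
    have c1 := Plane.continuous_coord 1
    have c2 : IsOpen {z : Plane | inner ℝ w z < 1} := isOpen_lt (by fun_prop) continuous_const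
    exact (isOpen_lt (continuous_const.mul c1) c0).inter ((isOpen_lt c0 (continuous_const.mul c1)).inter
      c2)
  have hDst : ∀ s t : ℝ, 0 < s → 0 < t → s + t < 1 → s • A + t • B ∈ D := by
    intro s t hs ht hst
    refine ⟨?_, ?_, ?_⟩
    · simp only [PiLp.add_apply, PiLp.smul_apply, smul_eq_mul, hA0, hA1, hB0, hB1]
      nlinarith [mul_pos (mul_pos hs ha) hd]
    · simp only [PiLp.add_apply, PiLp.smul_apply, smul_eq_mul, hA0, hA1, hB0, hB1]
      nlinarith [mul_pos ht hd]
    · rwa [inner_add_right, real_inner_smul_right, real_inner_smul_right, hwA, hwB, mul_one, mul_one]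
  set d : Plane := (1 / 3 : ℝ) • A + (1 / 3 : ℝ) • B
  have hdD : d ∈ D := hDst _ _ (by norm_num) (by norm_num) (by norm_num)
  refine admitsNontrivialCongruence_of_approx (D := D) (N := N) ?_ ?_ ⟨d, hdD⟩ ?_ hDN ?_
  · have hfin : ({0, A, B} : Set Plane).Finite := by simp
    exact hfin.isCompact_convexHull (𝕜 := ℝ)
  · intro z hz
    obtain ⟨s, t, hs, ht, hst, rfl⟩ := triangle_coords hz
    have h1 : Tendsto (fun ε : ℝ => (s + ε * (1 / 3 - s)) • A + (t + ε * (1 / 3 - t)) • B) (𝓝[>] 0)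
        (𝓝 (s • A + t • B)) := by
      have : Continuous fun ε : ℝ => (s + ε * (1 / 3 - s)) • A + (t + ε * (1 / 3 - t)) • B := by fun_prop
      have := this.tendsto 0
      simp only [zero_mul, add_zero] at this
      exact this.mono_left nhdsWithin_le_nhds
    refine mem_closure_of_tendsto h1 ?_
    filter_upwards [Ioo_mem_nhdsGT (zero_lt_one' ℝ)] with ε hε
    apply hDst <;> nlinarith [hε.1, hε.2]
  · rintro n z ⟨h1, h2⟩
    have hsz := hsub _ h1
    simp only [PiLp.smul_apply, smul_eq_mul] at hsz
    have e1 : l * z 1 ≤ z 0 := le_of_mul_le_mul_left (by linarith [hsz.1]) (hpos n)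
    have e2 : z 0 ≤ r * z 1 := le_of_mul_le_mul_left (by linarith [hsz.2]) (hpos n)
    have e3 : inner ℝ w z ≤ 1 := by
      have := hL'n.2 _ h2
      rw [sub_zero, inner_neg_left, real_inner_smul_left, real_inner_smul_right, inner_sub_right, hwe] at this
      have h3 : 0 ≤ ‖w‖⁻¹ * (1 / ((n : ℝ) + 1)) * (1 - inner ℝ w z) := by linarith
      have := nonneg_of_mul_nonneg_right h3 (mul_pos (by positivity) (hpos n))
      linarith
    rw [hcoord z]
    refine (convex_convexHull ℝ _).smul_add_smul_mem (subset_convexHull _ _ (by simp))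
      (subset_convexHull _ _ (by simp)) (subset_convexHull _ _ (by simp))
      (div_nonneg (by linarith) (by positivity)) (div_nonneg (by linarith) hd.le) ?_
    rw [← hinner]; exact e3
  · have hη' : ∃ η > 0, d + !₂[η, 0] ∈ D ∧ d + !₂[0, η] ∈ D := by
      have h1 : Tendsto (fun t : ℝ => d + t • !₂[(1 : ℝ), 0]) (𝓝[>] 0) (𝓝 d) := by
        have : Continuous fun t : ℝ => d + t • !₂[(1 : ℝ), 0] := by fun_prop
        have := this.tendsto 0
        simp only [zero_smul, add_zero] at this
        exact this.mono_left nhdsWithin_le_nhds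
      have h2 : Tendsto (fun t : ℝ => d + t • !₂[(0 : ℝ), 1]) (𝓝[>] 0) (𝓝 d) := by
        have : Continuous fun t : ℝ => d + t • !₂[(0 : ℝ), 1] := by fun_prop
        have := this.tendsto 0
        simp only [zero_smul, add_zero] at this
        exact this.mono_left nhdsWithin_le_nhds
      obtain ⟨t, ⟨ht1, ht2⟩, ht0⟩ := (((h1.eventually (hDo.mem_nhds hdD)).and
        (h2.eventually (hDo.mem_nhds hdD))).and self_mem_nhdsWithin).exists
      refine ⟨t, ht0, ?_, ?_⟩
      · have e1 : !₂[t, 0] = t • (!₂[(1 : ℝ), 0] : Plane) := by apply Plane.ext <;> simp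
        rw [e1]; exact ht1
      · have e1 : !₂[0, t] = t • (!₂[(0 : ℝ), 1] : Plane) := by apply Plane.ext <;> simp
        rw [e1]; exact ht2
    obtain ⟨η, hη0, hη1, hη2⟩ := hη'
    filter_upwards [hDN d hdD, hDN _ hη1, hDN _ hη2] with n g0 g1 g2
    set ε := 1 / ((n : ℝ) + 1) with hε
    obtain ⟨ψ, hψ, hψz⟩ := exists_rigid_translation (ε • e)
    have hmem : ∀ z, ε • (z - e) ∈ L' ↔ ε • z ∈ ψ '' L' := by
      intro z
      rw [ψ.mem_image_iff]
      have : ψ.symm (ε • z) = ε • (z - e) := by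
        rw [AffineIsometryEquiv.symm_apply_eq, hψz, smul_sub, sub_add_cancel]
      rw [this]
    have hNn : N n = {z | ε • z ∈ K ∩ ψ '' L'} := by
      ext z
      exact and_congr Iff.rfl (hmem z)
    rw [hNn] at g0 g1 g2 ⊢
    refine AdmitsNontrivialCongruence.smul_preimage ?_ (hpos n).ne'
    have H' := (H.image OrientationPreserving.refl (hφ.trans hψ))
    rw [AffineIsometryEquiv.coe_refl, image_id, AffineIsometryEquiv.coe_trans, image_comp] at H'
    apply H'.inter
    have hp := hpos n
    refine (hK.convex.inter (ψ.convex_image hL'p.convex)).interior_nonempty_of_corner (d := ε • d)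
      (η := ε * η) (by positivity) g0 ?_ ?_
    · have e1 : ε • d + !₂[ε * η, 0] = ε • (d + !₂[η, 0]) := by
        rw [smul_add ε d, Plane.smul_mk ε η 0, mul_zero]
      rw [e1]; exact g1
    · have e1 : ε • d + !₂[0, ε * η] = ε • (d + !₂[0, η]) := by
        rw [smul_add ε d, Plane.smul_mk ε 0 η, mul_zero]
      rw [e1]; exact g2

/-- Under the hypothesis of the theorem, the sets have no corners. -/
lemma AllIntersections.isSmoothSet {K L : Set Plane} (H : AllIntersections AdmitsNontrivialCongruence K L)
    (hK : IsProperClosedConvex K) (hL : IsProperClosedConvex L) : IsSmoothSet K := by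
  intro x hx u v hu hv
  by_contra huv
  have huv0 : u + v ≠ 0 := by
    intro h
    have hv' : v = -u := (neg_eq_of_add_eq_zero_right h).symm
    obtain ⟨c, hc⟩ := hK.interior_nonempty
    have h1 := hu.2 c (interior_subset hc)
    have h2 := hv.2 c (interior_subset hc)
    rw [hv', inner_neg_left] at h2
    have h3 : inner ℝ u (c - x) = 0 := by linarith
    apply IsInnerNormal.notMem_interior (K := K) (x := c) (u := u) ⟨hu.1, fun z hz => ?_⟩ hc
    have := hu.2 z hz
    have e : z - c = (z - x) - (c - x) := by abel
    rw [e, inner_sub_right, h3]; linarith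
  have hn : 0 < ‖u + v‖ := norm_pos_iff.2 huv0
  -- Turning the bisector of the two normals upright makes them mirror images `(±u' 0, u' 1)` with
  -- `u' 1 > 0`. Their two half-planes meet in an upright cone.
  obtain ⟨φ, hφ, hφx, hφw⟩ := exists_rigid_normalize x (u := ‖u + v‖⁻¹ • (u + v)) (v := !₂[0, 1])
    (by rw [norm_smul]; simp [hn.ne']) (by rw [Plane.norm_eq_one_iff]; simp)
  have hu' := hu.image φ
  have hv' := hv.image φ
  rw [hφx] at hu' hv'
  set u' := φ.linearIsometryEquiv u with hu'd
  set v' := φ.linearIsometryEquiv v with hv'd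
  have hne : u' ≠ v' := fun h => huv (φ.linearIsometryEquiv.injective h)
  have hsum : u' + v' = ‖u + v‖ • !₂[0, 1] := by
    rw [← hφw, map_smul, smul_smul, mul_inv_cancel₀ hn.ne', one_smul, map_add]
  have s0 := congrArg (fun z : Plane => z 0) hsum
  have s1 := congrArg (fun z : Plane => z 1) hsum
  simp only [PiLp.add_apply, PiLp.smul_apply, smul_eq_mul, Matrix.cons_val_zero,
    Matrix.cons_val_one, mul_zero, mul_one] at s0 s1
  have n1 := (Plane.norm_eq_one_iff _).1 hu'.1
  have n2 := (Plane.norm_eq_one_iff _).1 hv'.1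
  have hv0 : v' 0 = -u' 0 := by linarith
  have hv1 : v' 1 = u' 1 := by
    rw [hv0] at n2
    have : (v' 1 - u' 1) * (v' 1 + u' 1) = 0 := by linear_combination n2 - n1
    rcases mul_eq_zero.1 this with h | h <;> linarith
  have hu1 : 0 < u' 1 := by linarith
  have hu0 : u' 0 ≠ 0 := by
    intro h
    apply hne
    apply Plane.ext
    · rw [hv0, h, neg_zero]
    · exact hv1.symm
  refine not_allIntersections_of_cone (hK.image φ) hL ⟨x, hx, hφx⟩ (m := u' 1 / |u' 0|) (by positivity) ?_
    (by simpa using H.image hφ OrientationPreserving.refl)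
  intro z hz
  have g1 := hu'.2 z hz
  have g2 := hv'.2 z hz
  rw [sub_zero, Plane.inner_eq] at g1 g2
  rw [hv0, hv1] at g2
  rw [div_mul_eq_mul_div, le_div_iff₀ (abs_pos.2 hu0), ← abs_mul]
  exact abs_le.2 ⟨by nlinarith, by nlinarith⟩

/-! ### Lenses -/

/-- `K` is placed so that the segment from `0` to `(c, 0)` is a chord cutting off a flat cap below. -/
structure IsNormalCap (c : ℝ) (K : Set Plane) : Prop where
  left_mem : (0 : Plane) ∈ K
  right_mem : !₂[c, 0] ∈ K
  top_mem : !₂[c / 2, c / 2] ∈ K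
  flat : (∀ z ∈ K, 0 ≤ z 1) ∨ ∀ z ∈ K, z 1 ≤ 0 → -z 1 ≤ z 0 / 2 ∧ -z 1 ≤ (c - z 0) / 2

/-- The part of `K` below the segment from `0` to `(c, 0)`. -/
def lowerCap (c : ℝ) (K : Set Plane) : Set Plane := {z | z ∈ K ∧ z 1 ≤ 0 ∧ 0 ≤ z 0 ∧ z 0 ≤ c}

/-- Reflection in the perpendicular bisector of the segment from `0` to `(c, 0)`. -/
noncomputable def Plane.flip (c : ℝ) (z : Plane) : Plane := !₂[c - z 0, z 1]

/-- Reflection in the midpoint of the segment from `0` to `(c, 0)`. -/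
noncomputable def Plane.turn (c : ℝ) (z : Plane) : Plane := !₂[c - z 0, -z 1]

@[simp] lemma Plane.flip_zero (c : ℝ) (z : Plane) : Plane.flip c z 0 = c - z 0 := by simp [Plane.flip]
@[simp] lemma Plane.flip_one (c : ℝ) (z : Plane) : Plane.flip c z 1 = z 1 := by simp [Plane.flip]
@[simp] lemma Plane.turn_zero (c : ℝ) (z : Plane) : Plane.turn c z 0 = c - z 0 := by simp [Plane.turn]
@[simp] lemma Plane.turn_one (c : ℝ) (z : Plane) : Plane.turn c z 1 = -z 1 := by simp [Plane.turn]
@[simp] lemma Plane.flip_flip (c : ℝ) (z : Plane) : Plane.flip c (Plane.flip c z) = z := by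
  apply Plane.ext <;> simp
@[simp] lemma Plane.turn_turn (c : ℝ) (z : Plane) : Plane.turn c (Plane.turn c z) = z := by
  apply Plane.ext <;> simp

lemma IsNormalCap.bound {c : ℝ} {K : Set Plane} (hK : IsNormalCap c K) {z : Plane}
    (hz : z ∈ lowerCap c K) : -z 1 ≤ z 0 / 2 ∧ -z 1 ≤ (c - z 0) / 2 := by
  obtain ⟨h1, h2, h3, h4⟩ := hz
  rcases hK.flat with h | h
  · have := h z h1
    constructor <;> linarith
  · exact h z h1 h2

lemma IsNormalCap.triangle_subset {c : ℝ} {K : Set Plane} (hK : IsNormalCap c K) (hc : 0 < c)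
    (hconv : Convex ℝ K) {z : Plane} (h0 : 0 ≤ z 1) (h1 : z 1 ≤ z 0) (h2 : z 1 ≤ c - z 0) : z ∈ K := by
  have := hconv.smul_add_smul_mem hK.left_mem hK.right_mem hK.top_mem (s := (z 0 - z 1) / c)
    (t := 2 * z 1 / c) (div_nonneg (by linarith) hc.le) (div_nonneg (by linarith) hc.le)
    (by rw [← add_div, div_le_one hc]; linarith)
  convert this using 1
  rw [Plane.smul_mk, Plane.smul_mk]
  apply Plane.ext
  · simp; field_simp; ring
  · simp; field_simp

lemma isometry_fix_axis {χ : Plane → Plane} (hχ : Isometry χ) {c : ℝ} (hc : 0 < c) (h0 : χ 0 = 0)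
    (h1 : χ !₂[c, 0] = !₂[c, 0]) : ∃ y : ℝ, y ^ 2 = 1 ∧ ∀ z, χ z = !₂[z 0, y * z 1] := by
  have d0 : ∀ z, χ z 0 ^ 2 + χ z 1 ^ 2 = z 0 ^ 2 + z 1 ^ 2 := fun z => by
    have := congrArg (· ^ 2) (hχ.dist_eq z 0)
    simpa only [Plane.dist_sq_eq, h0, PiLp.zero_apply, sub_zero] using this
  have d1 : ∀ z, (χ z 0 - c) ^ 2 + χ z 1 ^ 2 = (z 0 - c) ^ 2 + z 1 ^ 2 := fun z => by
    have := congrArg (· ^ 2) (hχ.dist_eq z !₂[c, 0])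
    simpa [Plane.dist_sq_eq, h1] using this
  have e0 : ∀ z, χ z 0 = z 0 := fun z => by
    have : c * (χ z 0 - z 0) = 0 := by linear_combination (d0 z - d1 z) / 2
    rcases mul_eq_zero.1 this with h | h <;> linarith
  set y := χ !₂[0, 1] 1 with hy
  have hy2 : y ^ 2 = 1 := by
    have := d0 !₂[0, 1]
    rw [e0, ← hy] at this
    simpa using this
  refine ⟨y, hy2, fun z => ?_⟩
  have d2 := congrArg (· ^ 2) (hχ.dist_eq z !₂[0, 1])
  simp only [Plane.dist_sq_eq, e0, ← hy] at d2
  simp only [Matrix.cons_val_zero, Matrix.cons_val_one] at d2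
  have d3 := d0 z
  rw [e0] at d3
  have d4 : χ z 1 * y = z 1 := by linear_combination (d3 - d2 + hy2) / 2
  apply Plane.ext
  · simpa using e0 z
  · simp only [Matrix.cons_val_one]
    calc χ z 1 = y * (χ z 1 * y) := by linear_combination -(χ z 1) * hy2
      _ = _ := by rw [d4]; simp

lemma isometry_swap_axis {χ : Plane → Plane} (hχ : Isometry χ) {c : ℝ} (hc : 0 < c) (h0 : χ 0 = !₂[c, 0])
    (h1 : χ !₂[c, 0] = 0) : ∃ y : ℝ, y ^ 2 = 1 ∧ ∀ z, χ z = !₂[c - z 0, y * z 1] := by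
  have hflip : Isometry (Plane.flip c) := Isometry.of_dist_eq fun z w => by
    rw [← sq_eq_sq₀ dist_nonneg dist_nonneg, Plane.dist_sq_eq, Plane.dist_sq_eq]
    simp; ring
  obtain ⟨y, hy, h⟩ := isometry_fix_axis (hflip.comp hχ) hc
    (by simp only [Function.comp_apply, h0]; apply Plane.ext <;> simp)
    (by simp only [Function.comp_apply, h1]; apply Plane.ext <;> simp)
  refine ⟨y, hy, fun z => ?_⟩
  rw [← Plane.flip_flip c (χ z)]
  have := h z
  rw [Function.comp_apply] at this
  rw [this]
  apply Plane.ext <;> simp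

/-- In the rhombus of slope `1 / 2` over the chord, loss of horizontal distance allows a vertical
distance of only half the loss, so the distance `c` is attained by the two ends alone. -/
lemma unique_diametral_pair {c : ℝ} (hc : 0 < c) {z w : Plane} (hz : |z 1| ≤ z 0 / 2)
    (hz' : |z 1| ≤ (c - z 0) / 2) (hw : |w 1| ≤ w 0 / 2) (hw' : |w 1| ≤ (c - w 0) / 2)
    (hle : z 0 ≤ w 0) (h : dist z w = c) : z = 0 ∧ w = !₂[c, 0] := by
  have h2 : (z 0 - w 0) ^ 2 + (z 1 - w 1) ^ 2 = c ^ 2 := by rw [← Plane.dist_sq_eq, h]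
  have hz0 := abs_nonneg (z 1)
  have hw0 := abs_nonneg (w 1)
  have h3 : |z 1 - w 1| ≤ (c - (w 0 - z 0)) / 2 := by
    have := abs_sub (z 1) (w 1)
    linarith
  have h4 : (z 1 - w 1) ^ 2 ≤ ((c - (w 0 - z 0)) / 2) ^ 2 := sq_le_sq' (by linarith [abs_le.1 h3]) (abs_le.1 h3).2
  have h5 : c - (w 0 - z 0) = 0 := by
    by_contra hne
    have hpos : 0 < c - (w 0 - z 0) := lt_of_le_of_ne (by linarith [abs_nonneg (z 1 - w 1)]) (Ne.symm hne)
    nlinarith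
  have e1 : z 0 = 0 := by linarith
  have e2 : w 0 = c := by linarith
  have e3 : z 1 = 0 := by
    rw [e1] at hz
    exact abs_nonpos_iff.1 (by linarith)
  have e4 : w 1 = 0 := by
    rw [e2] at hw'
    exact abs_nonpos_iff.1 (by linarith)
  exact ⟨Plane.ext (by simpa) (by simpa), Plane.ext (by simpa) (by simpa)⟩

/-- The lens is `K` intersected with `L` after a half-turn about the midpoint of the chord. Slope `1
/ 2` keeps each cap inside the triangle of slope `1` contained in the other set, so the lens
consists exactly of the two caps. The chord is its only diameter, and the three non-identical
isometries preserving the chord give the three alternatives. -/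
lemma lens_symmetry_aux {c : ℝ} (hc : 0 < c) {K L : Set Plane} (hK : IsProperClosedConvex K)
    (hL : IsProperClosedConvex L) (hcK : IsNormalCap c K) (hcL : IsNormalCap c L)
    (H : AllIntersections AdmitsNontrivialCongruence K L) (hnf : ∃ z ∈ K, z 1 < 0) :
    lowerCap c L = lowerCap c K ∨ (∀ z, z ∈ lowerCap c L ↔ Plane.flip c z ∈ lowerCap c K) ∨
      ((∀ z, z ∈ lowerCap c K ↔ Plane.flip c z ∈ lowerCap c K) ∧
        ∀ z, z ∈ lowerCap c L ↔ Plane.flip c z ∈ lowerCap c L) := by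
  obtain ⟨ρ, hρ, hρz⟩ := exists_rigid (-1) 0 (by norm_num) !₂[c, 0]
  have hρz' : ∀ z, ρ z = Plane.turn c z := fun z => by
    rw [hρz]; apply Plane.ext
    · simp; ring
    · simp
  set M := K ∩ ρ '' L with hM
  have hmem : ∀ z, z ∈ M ↔ z ∈ K ∧ Plane.turn c z ∈ L := by
    intro z
    have h1 : ρ.symm z = Plane.turn c z := by
      rw [AffineIsometryEquiv.symm_apply_eq, hρz', Plane.turn_turn]
    rw [hM, mem_inter_iff, ρ.mem_image_iff, h1]
  have hKb : ∀ z ∈ K, z 1 ≤ 0 → -z 1 ≤ z 0 / 2 ∧ -z 1 ≤ (c - z 0) / 2 := by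
    rcases hcK.flat with h | h
    · obtain ⟨z, hz, h1⟩ := hnf
      exact absurd (h z hz) (not_le.2 h1)
    · exact h
  have hKc : ∀ z ∈ K, z 1 ≤ 0 → z ∈ lowerCap c K := by
    intro z hz h1
    obtain ⟨h2, h3⟩ := hKb z hz h1
    exact ⟨hz, h1, by linarith, by linarith⟩
  have hKM : ∀ z ∈ lowerCap c K, z ∈ M := by
    intro z hz
    obtain ⟨h1, h2⟩ := hcK.bound hz
    obtain ⟨g1, g2, g3, g4⟩ := hz
    rw [hmem]
    exact ⟨g1, hcL.triangle_subset hc hL.convex (by simpa using g2) (by simp; linarith) (by simp; linarith)⟩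
  have hMK : ∀ z ∈ M, z 1 ≤ 0 → z ∈ lowerCap c K := fun z hz h1 => hKc z ((hmem z).1 hz).1 h1
  have hLM : ∀ z ∈ lowerCap c L, Plane.turn c z ∈ M := by
    intro z hz
    obtain ⟨h1, h2⟩ := hcL.bound hz
    obtain ⟨g1, g2, g3, g4⟩ := hz
    rw [hmem, Plane.turn_turn]
    exact ⟨hcK.triangle_subset hc hK.convex (by simpa using g2) (by simp; linarith) (by simp; linarith), g1⟩
  have hML : ∀ z, Plane.turn c z ∈ M → z 1 ≤ 0 → z ∈ lowerCap c L := by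
    intro z hz h1
    rw [hmem, Plane.turn_turn] at hz
    rcases hcL.flat with h | h
    · have h2 : z 1 = 0 := le_antisymm h1 (h z hz.2)
      obtain ⟨-, -, g1, g2⟩ := hKc _ hz.1 (by simp [h2])
      simp only [Plane.turn_zero] at g1 g2
      exact ⟨hz.2, h1, by linarith, by linarith⟩
    · obtain ⟨g1, g2⟩ := h z hz.2 h1
      exact ⟨hz.2, h1, by linarith, by linarith⟩
  have hMb : ∀ z ∈ M, |z 1| ≤ z 0 / 2 ∧ |z 1| ≤ (c - z 0) / 2 := by
    intro z hz
    rcases le_total (z 1) 0 with h | h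
    · rw [abs_of_nonpos h]
      exact hcK.bound (hMK z hz h)
    · have h1 := hcL.bound (hML (Plane.turn c z) (by rwa [Plane.turn_turn]) (by simpa))
      rw [abs_of_nonneg h]
      simp only [Plane.turn_zero, Plane.turn_one] at h1
      constructor <;> linarith [h1.1, h1.2]
  -- A point of `K` strictly below the chord is interior to the turned `L` and a limit of interior
  -- points of `K`.
  have hint : (interior M).Nonempty := by
    obtain ⟨z, hz, hz1⟩ := hnf
    obtain ⟨b1, b2⟩ := hKb z hz hz1.le
    have hU : IsOpen {w : Plane | 0 < w 1 ∧ w 1 < w 0 ∧ w 1 < c - w 0} := by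
      have c0 := Plane.continuous_coord 0
      have c1 := Plane.continuous_coord 1
      exact (isOpen_lt continuous_const c1).inter ((isOpen_lt c1 c0).inter
        (isOpen_lt c1 (continuous_const.sub c0)))
    have hUL : {w : Plane | 0 < w 1 ∧ w 1 < w 0 ∧ w 1 < c - w 0} ⊆ interior L :=
      interior_maximal (fun w hw => hcL.triangle_subset hc hL.convex hw.1.le hw.2.1.le hw.2.2.le) hU
    have hzL : z ∈ interior (ρ '' L) := by
      have : interior (ρ '' L) = ρ '' interior L := (ρ.toHomeomorph.image_interior L).symm
      rw [this]
      refine ⟨Plane.turn c z, hUL ⟨by simpa, ?_, ?_⟩, by rw [hρz', Plane.turn_turn]⟩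
      · simp; linarith
      · simp; linarith
    have hzK : z ∈ closure (interior K) := by
      rw [hK.convex.closure_interior_eq_closure_of_nonempty_interior hK.interior_nonempty]
      exact subset_closure hz
    obtain ⟨w, hw1, hw2⟩ := mem_closure_iff.1 hzK _ isOpen_interior hzL
    exact ⟨w, by rw [hM, interior_inter]; exact ⟨hw2, hw1⟩⟩
  obtain ⟨χ, hχ, hχM⟩ : AdmitsNontrivialCongruence M := by
    have H' := H.image OrientationPreserving.refl hρ
    rw [AffineIsometryEquiv.coe_refl, image_id] at H'
    exact H'.inter hint
  rw [AffineIsometryEquiv.image_eq_self_iff] at hχM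
  have h0M : (0 : Plane) ∈ M := hKM 0 ⟨hcK.left_mem, by simp, by simp, by simpa using hc.le⟩
  have hcM : !₂[c, 0] ∈ M := hKM _ ⟨hcK.right_mem, by simp, by simpa using hc.le, by simp⟩
  have hd : dist (χ 0) (χ !₂[c, 0]) = c := by
    rw [χ.dist_map, ← sq_eq_sq₀ dist_nonneg hc.le, Plane.dist_sq_eq]; simp
  obtain ⟨b1, b2⟩ := hMb _ ((hχM _).2 h0M)
  obtain ⟨b3, b4⟩ := hMb _ ((hχM _).2 hcM)
  rcases le_total ((χ 0) 0) ((χ !₂[c, 0]) 0) with hle | hle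
  · obtain ⟨e1, e2⟩ := unique_diametral_pair hc b1 b2 b3 b4 hle hd
    obtain ⟨y, hy, hform⟩ := isometry_fix_axis χ.isometry hc e1 e2
    rcases sq_eq_one_iff.1 hy with rfl | rfl
    · exfalso; apply hχ
      ext1 z
      rw [hform]; apply Plane.ext <;> simp
    -- Reflection in the line of the chord exchanges the cap of `K` with the turned cap of `L`;
    -- combined with the half-turn this is `Plane.flip`.
    · right; left
      intro z
      constructor
      · intro hz
        have h1 := (hχM _).2 (hLM z hz)
        have h2 : χ (Plane.turn c z) = Plane.flip c z := by rw [hform]; apply Plane.ext <;> simp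
        rw [h2] at h1
        exact hMK _ h1 (by simpa using hz.2.1)
      · intro hz
        have h1 := (hχM _).2 (hKM _ hz)
        have h2 : χ (Plane.flip c z) = Plane.turn c z := by rw [hform]; apply Plane.ext <;> simp
        rw [h2] at h1
        exact hML _ h1 (by simpa using hz.2.1)
  · obtain ⟨e2, e1⟩ := unique_diametral_pair hc b3 b4 b1 b2 hle (by rw [dist_comm]; exact hd)
    obtain ⟨y, hy, hform⟩ := isometry_swap_axis χ.isometry hc e1 e2
    rcases sq_eq_one_iff.1 hy with rfl | rfl
    · right; right
      have hfl : ∀ z, χ z = Plane.flip c z := fun z => by rw [hform]; apply Plane.ext <;> simp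
      have hK' : ∀ z ∈ lowerCap c K, Plane.flip c z ∈ lowerCap c K := fun z hz => by
        have h1 := (hχM _).2 (hKM _ hz)
        rw [hfl] at h1
        exact hMK _ h1 (by simpa using hz.2.1)
      have hL' : ∀ z ∈ lowerCap c L, Plane.flip c z ∈ lowerCap c L := fun z hz => by
        have h1 := (hχM _).2 (hLM _ hz)
        have h2 : χ (Plane.turn c z) = Plane.turn c (Plane.flip c z) := by
          rw [hfl]; apply Plane.ext <;> simp
        rw [h2] at h1
        exact hML _ h1 (by simpa using hz.2.1)
      exact ⟨fun z => ⟨hK' z, fun h => by simpa using hK' _ h⟩,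
        fun z => ⟨hL' z, fun h => by simpa using hL' _ h⟩⟩
    · left
      have htu : ∀ z, χ z = Plane.turn c z := fun z => by rw [hform]; apply Plane.ext <;> simp
      ext z
      constructor
      · intro hz
        have h1 := (hχM _).2 (hLM z hz)
        rw [htu, Plane.turn_turn] at h1
        exact hMK _ h1 hz.2.1
      · intro hz
        have h1 := (hχM _).2 (hKM z hz)
        rw [htu] at h1
        exact hML _ h1 hz.2.1

/-- The symmetries of the lens glued from two caps with the same chord. -/
lemma lens_symmetry {c : ℝ} (hc : 0 < c) {K L : Set Plane} (hK : IsProperClosedConvex K)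
    (hL : IsProperClosedConvex L) (hcK : IsNormalCap c K) (hcL : IsNormalCap c L)
    (H : AllIntersections AdmitsNontrivialCongruence K L) :
    lowerCap c L = lowerCap c K ∨ (∀ z, z ∈ lowerCap c L ↔ Plane.flip c z ∈ lowerCap c K) ∨
      ((∀ z, z ∈ lowerCap c K ↔ Plane.flip c z ∈ lowerCap c K) ∧
        ∀ z, z ∈ lowerCap c L ↔ Plane.flip c z ∈ lowerCap c L) := by
  by_cases hK' : ∃ z ∈ K, z 1 < 0
  · exact lens_symmetry_aux hc hK hL hcK hcL H hK'
  by_cases hL' : ∃ z ∈ L, z 1 < 0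
  · rcases lens_symmetry_aux hc hL hK hcL hcK H.swap hL' with h | h | h
    · exact Or.inl h.symm
    · exact Or.inr (Or.inl fun z => by rw [h, Plane.flip_flip])
    · exact Or.inr (Or.inr h.symm)
  · left
    -- Both caps degenerate to the chord itself, and no lens with interior is available or needed.
    push Not at hK' hL'
    have key : ∀ {K : Set Plane}, IsProperClosedConvex K → IsNormalCap c K → (∀ z ∈ K, 0 ≤ z 1) →
        lowerCap c K = {z | z 1 = 0 ∧ 0 ≤ z 0 ∧ z 0 ≤ c} := by
      intro K hK hcK h
      ext z
      constructor
      · rintro ⟨h1, h2, h3⟩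
        exact ⟨le_antisymm h2 (h z h1), h3⟩
      · rintro ⟨h1, h2, h3⟩
        exact ⟨hcK.triangle_subset hc hK.convex h1.ge (by linarith) (by linarith), h1.le, h2, h3⟩
    rw [key hK hcK hK', key hL hcL hL']

/-! ### The boundary as a graph -/

/-- A monotone function can only jump, and a derivative has no jumps by Darboux's theorem. -/
lemma MonotoneOn.continuousAt_of_hasDerivAt {f f' : ℝ → ℝ} {s : Set ℝ} {a : ℝ} (hs : s ∈ 𝓝 a)
    (hsc : OrdConnected s) (hmono : MonotoneOn f' s) (hf : ∀ x ∈ s, HasDerivAt f (f' x) x) :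
    ContinuousAt f' a := by
  have ha : a ∈ s := mem_of_mem_nhds hs
  have him := hsc.image_hasDerivWithinAt fun x hx => (hf x hx).hasDerivWithinAt (s := s)
  obtain ⟨l, r, hlr, hsub⟩ := mem_nhds_iff_exists_Ioo_subset.1 hs
  refine tendsto_order.2 ⟨fun b hb => ?_, fun b hb => ?_⟩
  · have : ∃ c ∈ s, c < a ∧ b < f' c := by
      obtain ⟨d, hd1, hd2⟩ := exists_between hlr.1
      have hd : d ∈ s := hsub ⟨hd1, hd2.trans hlr.2⟩
      rcases lt_or_ge b (f' d) with h | h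
      · exact ⟨d, hd, hd2, h⟩
      · obtain ⟨m, hm1, hm2⟩ := exists_between hb
        obtain ⟨c, hc, rfl⟩ := him.out (mem_image_of_mem _ hd) (mem_image_of_mem _ ha) ⟨h.trans hm1.le, hm2.le⟩
        exact ⟨c, hc, not_le.1 fun hac => absurd (hmono ha hc hac) (not_le.2 hm2), hm1⟩
    obtain ⟨c, hc, hca, hbc⟩ := this
    filter_upwards [hs, Ioi_mem_nhds hca] with x hx hxc
    exact hbc.trans_le (hmono hc hx (le_of_lt hxc))
  · have : ∃ c ∈ s, a < c ∧ f' c < b := by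
      obtain ⟨d, hd1, hd2⟩ := exists_between hlr.2
      have hd : d ∈ s := hsub ⟨hlr.1.trans hd1, hd2⟩
      rcases lt_or_ge (f' d) b with h | h
      · exact ⟨d, hd, hd1, h⟩
      · obtain ⟨m, hm1, hm2⟩ := exists_between hb
        obtain ⟨c, hc, rfl⟩ := him.out (mem_image_of_mem _ ha) (mem_image_of_mem _ hd) ⟨hm1.le, hm2.le.trans h⟩
        exact ⟨c, hc, not_le.1 fun hac => absurd (hmono hc ha hac) (not_le.2 hm1), hm2⟩
    obtain ⟨c, hc, hca, hbc⟩ := this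
    filter_upwards [hs, Iio_mem_nhds hca] with x hx hxc
    exact (hmono hx hc (le_of_lt hxc)).trans_lt hbc

/-- Near the origin `K` is the epigraph of the `C¹` function `f` with small slopes. -/
structure IsLocalGraph (K : Set Plane) (δ : ℝ) (f f' : ℝ → ℝ) : Prop where
  pos : 0 < δ
  mem_iff : ∀ x y, |x| < δ → y ≤ 4 * δ → (!₂[x, y] ∈ K ↔ f x ≤ y)
  zero : f 0 = 0
  deriv_zero : f' 0 = 0
  hasDerivAt : ∀ x, |x| < δ → HasDerivAt f (f' x) x
  continuousAt : ∀ x, |x| < δ → ContinuousAt f' x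
  support : ∀ x, |x| < δ → ∀ z ∈ K, f x + f' x * (z 0 - x) ≤ z 1
  slope_le : ∀ x, |x| < δ → |f' x| ≤ 1 / 5

lemma isInnerNormal_of_slope {K : Set Plane} {x y m : ℝ} (h : ∀ z ∈ K, y + m * (z 0 - x) ≤ z 1) :
    IsInnerNormal K !₂[x, y] !₂[-m / √(1 + m ^ 2), 1 / √(1 + m ^ 2)] := by
  have hpos : 0 < 1 + m ^ 2 := by positivity
  have hs := Real.sq_sqrt hpos.le
  have hs0 : 0 < √(1 + m ^ 2) := Real.sqrt_pos.2 hpos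
  refine ⟨?_, fun z hz => ?_⟩
  · rw [Plane.norm_eq_one_iff]
    simp only [Matrix.cons_val_zero, Matrix.cons_val_one]
    rw [div_pow, div_pow, hs]
    field_simp; ring
  · rw [Plane.inner_eq]
    simp only [Matrix.cons_val_zero, Matrix.cons_val_one, PiLp.sub_apply]
    have : -m / √(1 + m ^ 2) * (z 0 - x) + 1 / √(1 + m ^ 2) * (z 1 - y) =
      (z 1 - (y + m * (z 0 - x))) / √(1 + m ^ 2) := by ring
    rw [this]
    exact div_nonneg (by linarith [h z hz]) hs0.le

lemma exists_isLocalGraph {K : Set Plane} (hK : IsProperClosedConvex K) (hs : IsSmoothSet K)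
    (h0 : (0 : Plane) ∈ K) (hn : IsInnerNormal K 0 !₂[0, 1]) : ∃ δ f f', IsLocalGraph K δ f f' := by
  have huniq : ∀ v, IsInnerNormal K 0 v → v = !₂[0, 1] := fun v hv => hs 0 h0 v _ hv hn
  -- By smoothness at `0` the rays in the directions `(±1, 1)` start inside `K`. They bound `f`
  -- above by `|x|`, and their hull supplies the points above the graph.
  obtain ⟨ε₁, hε₁, hray₁⟩ := eventually_smul_mem_of_unique_normal hK h0 huniq (z := !₂[1, 1])
    (by rw [Plane.inner_eq]; simp)
  obtain ⟨ε₂, hε₂, hray₂⟩ := eventually_smul_mem_of_unique_normal hK h0 huniq (z := !₂[-1, 1])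
    (by rw [Plane.inner_eq]; simp)
  obtain ⟨d, hd, hd1, hd2⟩ : ∃ d > 0, d ≤ ε₁ ∧ d ≤ ε₂ :=
    ⟨min ε₁ ε₂, lt_min hε₁ hε₂, min_le_left _ _, min_le_right _ _⟩
  have hpos : ∀ z ∈ K, 0 ≤ z 1 := fun z hz => by
    have := hn.2 z hz
    rw [Plane.inner_eq] at this
    simpa using this
  have hV : ∀ x : ℝ, |x| ≤ d → !₂[x, |x|] ∈ K := by
    intro x hx
    rcases le_total 0 x with h | h
    · have := hray₁ x h (by rw [abs_of_nonneg h] at hx; linarith)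
      rw [Plane.smul_mk, mul_one] at this
      rwa [abs_of_nonneg h]
    · have := hray₂ (-x) (by linarith) (by rw [abs_of_nonpos h] at hx; linarith)
      rw [Plane.smul_mk, mul_one] at this
      rw [abs_of_nonpos h]
      simpa using this
  have hseg : ∀ {x y x' y' : ℝ} (a b : ℝ), !₂[x, y] ∈ K → !₂[x', y'] ∈ K → 0 ≤ a → 0 ≤ b → a + b = 1 →
      !₂[a * x + b * x', a * y + b * y'] ∈ K := by
    intro x y x' y' a b h1 h2 ha hb hab
    have := hK.convex h1 h2 ha hb hab
    convert this using 1
    rw [Plane.smul_mk, Plane.smul_mk]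
    apply Plane.ext <;> simp
  have htop : ∀ x : ℝ, |x| ≤ d → !₂[x, d] ∈ K := by
    intro x hx
    have h1 := hV d (by rw [abs_of_pos hd])
    have h2 := hV (-d) (by rw [abs_neg, abs_of_pos hd])
    rw [abs_neg] at h2
    rw [abs_of_pos hd] at h1 h2
    have := hseg ((d + x) / (2 * d)) ((d - x) / (2 * d)) h1 h2 (div_nonneg (by linarith [(abs_le.1 hx).1]) (by linarith))
      (div_nonneg (by linarith [(abs_le.1 hx).2]) (by linarith)) (by field_simp; ring)
    convert this using 3
    · field_simp; ring
    · congr 1; field_simp; ring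
  set S : ℝ → Set ℝ := fun x => {y | !₂[x, y] ∈ K} with hS
  set f : ℝ → ℝ := fun x => sInf (S x) with hf
  have hbdd : ∀ x, BddBelow (S x) := fun x => ⟨0, fun y hy => by simpa using hpos _ hy⟩
  have hfle : ∀ x y, !₂[x, y] ∈ K → f x ≤ y := fun x y h => csInf_le (hbdd x) h
  have hfmem : ∀ x, |x| ≤ d → !₂[x, f x] ∈ K := by
    intro x hx
    have hcl : IsClosed (S x) := by
      have : Continuous fun y : ℝ => (!₂[x, y] : Plane) := by fun_prop
      exact hK.isClosed.preimage this
    exact hcl.csInf_mem ⟨_, hV x hx⟩ (hbdd x)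
  have hf0 : ∀ x, |x| ≤ d → 0 ≤ f x := fun x hx => by simpa using hpos _ (hfmem x hx)
  have hfabs : ∀ x, |x| ≤ d → f x ≤ |x| := fun x hx => hfle _ _ (hV x hx)
  have hmem : ∀ x y, |x| ≤ d → y ≤ d → (!₂[x, y] ∈ K ↔ f x ≤ y) := by
    intro x y hx hy
    refine ⟨hfle x y, fun h => ?_⟩
    rcases h.eq_or_lt with rfl | h
    · exact hfmem x hx
    · have hlt : 0 < d - f x := by linarith
      have := hseg ((d - y) / (d - f x)) ((y - f x) / (d - f x)) (hfmem x hx) (htop x hx)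
        (div_nonneg (by linarith) hlt.le) (div_nonneg (by linarith) hlt.le) (by field_simp; ring)
      convert this using 3
      · field_simp; ring
      · congr 1; field_simp; ring
  have hfz : f 0 = 0 := le_antisymm (by simpa using hfabs 0 (by simpa using hd.le)) (hf0 0 (by simpa using hd.le))
  have hconv : ConvexOn ℝ (Icc (-d) d) f := by
    refine ⟨convex_Icc _ _, fun x hx y hy a b ha hb hab => ?_⟩
    simp only [smul_eq_mul]
    exact hfle _ _ (hseg a b (hfmem x (abs_le.2 hx)) (hfmem y (abs_le.2 hy)) ha hb hab)
  -- A line supporting the graph near `x` supports all of `K`: the segment from `(x, f x)` to a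
  -- point of `K` below the line would start below it.
  have hsupp : ∀ x m, |x| < d → (∀ x', |x'| ≤ d → f x + m * (x' - x) ≤ f x') →
      ∀ z ∈ K, f x + m * (z 0 - x) ≤ z 1 := by
    intro x m hx hm z hz
    have h1 : Tendsto (fun t : ℝ => |(1 - t) * x + t * z 0|) (𝓝[>] 0) (𝓝 |x|) := by
      have : Continuous fun t : ℝ => |(1 - t) * x + t * z 0| := by fun_prop
      have := this.tendsto 0
      simp only [sub_zero, one_mul, zero_mul, add_zero] at this
      exact this.mono_left nhdsWithin_le_nhds
    obtain ⟨t, ht1, ht2, ht3⟩ := ((h1.eventually (gt_mem_nhds hx)).and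
      (Ioo_mem_nhdsGT (zero_lt_one' ℝ))).exists
    have hz' : !₂[z 0, z 1] ∈ K := by
      convert hz using 1
      apply Plane.ext <;> simp
    have h2 := hfle _ _ (hseg (1 - t) t (hfmem x hx.le) hz' (by linarith) ht2.le (by ring))
    have h3 := hm _ ht1.le
    have h4 : 0 ≤ t * (z 1 - (f x + m * (z 0 - x))) := by nlinarith
    have := nonneg_of_mul_nonneg_right h4 ht2
    linarith
  have hint : ∀ x, |x| < d → x ∈ interior (Icc (-d) d) := fun x hx => by
    rw [interior_Icc]; exact abs_lt.1 hx
  have hsub : ∀ x m, |x| < d → derivWithin f (Iio x) x ≤ m → m ≤ derivWithin f (Ioi x) x →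
      ∀ x', |x'| ≤ d → f x + m * (x' - x) ≤ f x' := by
    intro x m hx hm1 hm2 x' hx'
    rcases lt_trichotomy x x' with h | rfl | h
    · have := hconv.rightDeriv_le_slope_of_mem_interior (hint x hx) (abs_le.1 hx') h
      rw [slope_def_field] at this
      have := hm2.trans this
      rw [le_div_iff₀ (by linarith)] at this
      linarith
    · simp
    · have := hconv.slope_le_leftDeriv_of_mem_interior (abs_le.1 hx') (hint x hx) h
      rw [slope_def_field] at this
      have := this.trans hm1
      rw [div_le_iff₀ (by linarith)] at this
      linarith
  -- Both one-sided derivatives are slopes of supporting lines at `(x, f x)`. Uniqueness of the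
  -- normal makes them equal.
  have hderiv : ∀ x, |x| < d → HasDerivAt f (derivWithin f (Ioi x) x) x := by
    intro x hx
    have hle := hconv.leftDeriv_le_rightDeriv_of_mem_interior (hint x hx)
    have e := hs _ (hfmem x hx.le) _ _
      (isInnerNormal_of_slope (hsupp x _ hx (hsub x _ hx le_rfl hle)))
      (isInnerNormal_of_slope (hsupp x _ hx (hsub x _ hx hle le_rfl)))
    set p := derivWithin f (Iio x) x with hp
    set q := derivWithin f (Ioi x) x with hq
    have e0 := congrArg (fun z : Plane => z 0) e
    have e1 := congrArg (fun z : Plane => z 1) e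
    simp only [Matrix.cons_val_zero, Matrix.cons_val_one] at e0 e1
    have hpq : p = q := by
      have s1 : 0 < √(1 + p ^ 2) := Real.sqrt_pos.2 (by positivity)
      have s2 : 0 < √(1 + q ^ 2) := Real.sqrt_pos.2 (by positivity)
      have h3 : p * (1 / √(1 + p ^ 2)) = q * (1 / √(1 + q ^ 2)) := by linear_combination -e0
      rw [e1] at h3
      exact mul_right_cancel₀ (by positivity) h3
    have hL := hconv.hasDerivWithinAt_leftDeriv_of_mem_interior (hint x hx)
    have hR := hconv.hasDerivWithinAt_rightDeriv_of_mem_interior (hint x hx)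
    rw [← hp, hpq] at hL
    rw [← hq] at hR
    have := hL.Iic_of_Iio.union hR.Ici_of_Ioi
    rwa [Iic_union_Ici, hasDerivWithinAt_univ] at this
  have hmono : MonotoneOn (fun x => derivWithin f (Ioi x) x) (Ioo (-d) d) := by
    have := hconv.monotoneOn_rightDeriv
    rwa [interior_Icc] at this
  have hcont : ∀ x, |x| < d → ContinuousAt (fun x => derivWithin f (Ioi x) x) x := fun x hx =>
    hmono.continuousAt_of_hasDerivAt (Ioo_mem_nhds (abs_lt.1 hx).1 (abs_lt.1 hx).2) ordConnected_Ioo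
      fun y hy => hderiv y (abs_lt.2 hy)
  have hd0 : derivWithin f (Ioi 0) 0 = 0 := by
    refine IsLocalMin.hasDerivAt_eq_zero (f := f) (a := 0) ?_ (hderiv 0 (by simpa using hd))
    filter_upwards [Ioo_mem_nhds (neg_lt_zero.2 hd) hd] with x hx
    rw [hfz]; exact hf0 x (abs_lt.2 hx).le
  have hsmall : ∀ᶠ x in 𝓝 (0 : ℝ), |derivWithin f (Ioi x) x| < 1 / 5 := by
    have := (hcont 0 (by simpa using hd)).abs
    refine this.eventually (gt_mem_nhds ?_)
    beta_reduce
    rw [hd0, abs_zero]; norm_num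
  obtain ⟨η, hη, hηs⟩ := Metric.eventually_nhds_iff.1 hsmall
  -- Height `4 * δ` is ample: the points tested over chords of the graph stay below `f s + (t - s) <
  -- 3 * δ`.
  obtain ⟨δ, hδ, hδ1, hδ2⟩ : ∃ δ > 0, 4 * δ ≤ d ∧ δ ≤ η :=
    ⟨min (d / 4) η, lt_min (by linarith) hη, by linarith [min_le_left (d / 4) η], min_le_right _ _⟩
  refine ⟨δ, f, fun x => derivWithin f (Ioi x) x, hδ, ?_, hfz, hd0, ?_, ?_, ?_, ?_⟩
  · intro x y hx hy
    exact hmem x y (by linarith) (by linarith)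
  · exact fun x hx => hderiv x (by linarith)
  · exact fun x hx => hcont x (by linarith)
  · intro x hx
    have hx' : |x| < d := by linarith
    exact hsupp x _ hx' (hsub x _ hx' (hconv.leftDeriv_le_rightDeriv_of_mem_interior (hint x hx')) le_rfl)
  · intro x hx
    refine (hηs ?_).le
    rw [Real.dist_eq, sub_zero]; linarith

/-! ### Chords of the graph -/

namespace IsLocalGraph

variable {K : Set Plane} {δ : ℝ} {f f' : ℝ → ℝ}

lemma nonneg (G : IsLocalGraph K δ f f') {x : ℝ} (hx : |x| < δ) : 0 ≤ f x := by
  by_contra! h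
  have h1 : !₂[x, f x] ∈ K := (G.mem_iff x (f x) hx (by linarith [G.pos])).2 le_rfl
  have := G.support 0 (by simpa using G.pos) _ h1
  simp [G.zero, G.deriv_zero] at this
  linarith

lemma le_abs (G : IsLocalGraph K δ f f') {x : ℝ} (hx : |x| < δ) : f x ≤ |x| / 5 := by
  have h0 : !₂[(0 : ℝ), 0] ∈ K :=
    (G.mem_iff 0 0 (by simpa using G.pos) (by linarith [G.pos])).2 G.zero.le
  have h1 := G.support x hx _ h0
  simp only [Matrix.cons_val_zero, Matrix.cons_val_one] at h1
  have h2 := abs_le.1 (abs_mul (f' x) x).le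
  have h3 := mul_le_mul_of_nonneg_right (G.slope_le x hx) (abs_nonneg x)
  linarith [h2.2]

lemma mem (G : IsLocalGraph K δ f f') {x : ℝ} (hx : |x| < δ) : !₂[x, f x] ∈ K :=
  (G.mem_iff x (f x) hx (by linarith [G.le_abs hx, G.pos, abs_nonneg x])).2 le_rfl

lemma mono (G : IsLocalGraph K δ f f') {η : ℝ} (hη : 0 < η) (h : η ≤ δ) : IsLocalGraph K η f f' where
  pos := hη
  mem_iff x y hx hy := G.mem_iff x y (by linarith) (by linarith)
  zero := G.zero
  deriv_zero := G.deriv_zero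
  hasDerivAt x hx := G.hasDerivAt x (by linarith)
  continuousAt x hx := G.continuousAt x (by linarith)
  support x hx := G.support x (by linarith)
  slope_le x hx := G.slope_le x (by linarith)

lemma support_graph (G : IsLocalGraph K δ f f') {x y : ℝ} (hx : |x| < δ) (hy : |y| < δ) :
    f x + f' x * (y - x) ≤ f y := by
  simpa using G.support x hx _ (G.mem hy)

lemma left_slope_le (G : IsLocalGraph K δ f f') {s t : ℝ} (hs : |s| < δ) (ht : |t| < δ) :
    f' s * (t - s) ≤ f t - f s := by linarith [G.support_graph hs ht]

lemma le_right_slope (G : IsLocalGraph K δ f f') {s t : ℝ} (hs : |s| < δ) (ht : |t| < δ) :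
    f t - f s ≤ f' t * (t - s) := by linarith [G.support_graph ht hs]

lemma abs_rise_le (G : IsLocalGraph K δ f f') {s t : ℝ} (hs : |s| < δ) (ht : |t| < δ) (hst : s < t) :
    |f t - f s| ≤ (t - s) / 5 := by
  have h1 := G.left_slope_le hs ht
  have h2 := G.le_right_slope hs ht
  have h3 := abs_le.1 (G.slope_le s hs)
  have h4 := abs_le.1 (G.slope_le t ht)
  rw [abs_le]
  constructor <;> nlinarith

lemma le_chord (G : IsLocalGraph K δ f f') {s t x : ℝ} (hs : |s| < δ) (ht : |t| < δ) (hsx : s ≤ x)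
    (hxt : x ≤ t) : (t - s) * (f x - f s) ≤ (f t - f s) * (x - s) := by
  have hx : |x| < δ := abs_lt.2 ⟨by linarith [(abs_lt.1 hs).1], by linarith [(abs_lt.1 ht).2]⟩
  have h1 := G.support_graph hx hs
  have h2 := G.support_graph hx ht
  nlinarith [mul_nonneg (sub_nonneg.2 h1) (sub_nonneg.2 hxt), mul_nonneg (sub_nonneg.2 h2) (sub_nonneg.2 hsx)]

end IsLocalGraph

/-- The length of the chord of the graph of `f` over `[s, t]`. -/
noncomputable def chordLength (f : ℝ → ℝ) (s t : ℝ) : ℝ := √((t - s) ^ 2 + (f t - f s) ^ 2)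

lemma chordLength_pos (f : ℝ → ℝ) {s t : ℝ} (h : s < t) : 0 < chordLength f s t := by
  have : 0 < t - s := sub_pos.2 h
  exact Real.sqrt_pos.2 (by positivity)

lemma chordLength_sq (f : ℝ → ℝ) (s t : ℝ) :
    chordLength f s t ^ 2 = (t - s) ^ 2 + (f t - f s) ^ 2 := Real.sq_sqrt (by positivity)

/-- `φ` moves the chord of the graph of `f` over `[s, t]` to the segment from `0` to `(c, 0)`. -/
def IsChordMotion (f : ℝ → ℝ) (s t : ℝ) (φ : Plane ≃ᵃⁱ[ℝ] Plane) : Prop :=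
  ∀ z, chordLength f s t * φ z 0 = (t - s) * (z 0 - s) + (f t - f s) * (z 1 - f s) ∧
    chordLength f s t * φ z 1 = (t - s) * (z 1 - f s) - (f t - f s) * (z 0 - s)

lemma exists_isChordMotion (f : ℝ → ℝ) {s t : ℝ} (h : s < t) :
    ∃ φ, OrientationPreserving φ ∧ IsChordMotion f s t φ := by
  set c := chordLength f s t with hc
  have hc0 : 0 < c := chordLength_pos f h
  have hc2 := chordLength_sq f s t
  rw [← hc] at hc2
  obtain ⟨φ, h1, h2⟩ := exists_rigid ((t - s) / c) (-(f t - f s) / c) (by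
    field_simp; linarith)
    !₂[-((t - s) * s + (f t - f s) * f s) / c, (-(t - s) * f s + (f t - f s) * s) / c]
  refine ⟨φ, h1, fun z => ?_⟩
  rw [h2, ← hc]
  simp only [Matrix.cons_val_zero, Matrix.cons_val_one]
  constructor
  · field_simp; ring
  · field_simp; ring

namespace IsLocalGraph

variable {K : Set Plane} {δ : ℝ} {f f' : ℝ → ℝ}

/-- The tangent at `s` in chord coordinates. The quotient of `(f t - f s) - f' s * (t - s)` by `(t -
s) + (f t - f s) * f' s` is the tangent of the base angle at the left end. -/
lemma support_left (G : IsLocalGraph K δ f f') {s t : ℝ} (hs : |s| < δ) (hst : s < t)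
    {φ : Plane ≃ᵃⁱ[ℝ] Plane} (hφ : IsChordMotion f s t φ) {z : Plane} (hz : z ∈ K) :
    0 ≤ φ z 1 * ((t - s) + (f t - f s) * f' s) + ((f t - f s) - f' s * (t - s)) * φ z 0 := by
  have hc := chordLength_pos f hst
  obtain ⟨h0, h1⟩ := hφ z
  have h2 := G.support s hs z hz
  refine nonneg_of_mul_nonneg_right (b := φ z 1 * ((t - s) + (f t - f s) * f' s) +
    ((f t - f s) - f' s * (t - s)) * φ z 0) ?_ hc
  have : chordLength f s t * (φ z 1 * ((t - s) + (f t - f s) * f' s) +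
    ((f t - f s) - f' s * (t - s)) * φ z 0) =
    ((t - s) ^ 2 + (f t - f s) ^ 2) * (z 1 - (f s + f' s * (z 0 - s))) := by
    linear_combination ((t - s) + (f t - f s) * f' s) * h1 + ((f t - f s) - f' s * (t - s)) * h0
  rw [this]
  exact mul_nonneg (by positivity) (by linarith)

lemma support_right (G : IsLocalGraph K δ f f') {s t : ℝ} (ht : |t| < δ) (hst : s < t)
    {φ : Plane ≃ᵃⁱ[ℝ] Plane} (hφ : IsChordMotion f s t φ) {z : Plane} (hz : z ∈ K) :
    0 ≤ φ z 1 * ((t - s) + (f t - f s) * f' t) +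
      (f' t * (t - s) - (f t - f s)) * (chordLength f s t - φ z 0) := by
  have hc := chordLength_pos f hst
  have hc2 := chordLength_sq f s t
  obtain ⟨h0, h1⟩ := hφ z
  have h2 := G.support t ht z hz
  refine nonneg_of_mul_nonneg_right (b := φ z 1 * ((t - s) + (f t - f s) * f' t) +
      (f' t * (t - s) - (f t - f s)) * (chordLength f s t - φ z 0)) ?_ hc
  have : chordLength f s t * (φ z 1 * ((t - s) + (f t - f s) * f' t) +
      (f' t * (t - s) - (f t - f s)) * (chordLength f s t - φ z 0)) =
    ((t - s) ^ 2 + (f t - f s) ^ 2) * (z 1 - (f t + f' t * (z 0 - t))) := by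
    linear_combination ((t - s) + (f t - f s) * f' t) * h1 - (f' t * (t - s) - (f t - f s)) * h0 +
      (f' t * (t - s) - (f t - f s)) * hc2
  rw [this]
  exact mul_nonneg (by positivity) (by linarith)

lemma le_denom (G : IsLocalGraph K δ f f') {s t x : ℝ} (hs : |s| < δ) (ht : |t| < δ) (hx : |x| < δ)
    (hst : s < t) : 24 / 25 * (t - s) ≤ (t - s) + (f t - f s) * f' x := by
  have h1 := G.abs_rise_le hs ht hst
  have h2 := G.slope_le x hx
  have h3 : |(f t - f s) * f' x| ≤ (t - s) / 5 * (1 / 5) := by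
    rw [abs_mul]
    exact mul_le_mul h1 h2 (abs_nonneg _) (by linarith)
  have := (abs_le.1 h3).1
  linarith

lemma denom_pos (G : IsLocalGraph K δ f f') {s t x : ℝ} (hs : |s| < δ) (ht : |t| < δ) (hx : |x| < δ)
    (hst : s < t) : 0 < (t - s) + (f t - f s) * f' x := by
  linarith [G.le_denom hs ht hx hst]

/-- Tangent slopes of at most `1 / 5` make the base angles of the cap small, so the cap lies in the
triangle of slope `1 / 2`, while the right isosceles triangle on the other side of the chord lies in
`K`. -/
lemma isNormalCap (G : IsLocalGraph K δ f f') {s t : ℝ} (hs : |s| < δ) (ht : |t| < δ) (hst : s < t)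
    {φ : Plane ≃ᵃⁱ[ℝ] Plane} (hφ : IsChordMotion f s t φ) :
    IsNormalCap (chordLength f s t) (φ '' K) := by
  have hc := chordLength_pos f hst
  have hc2 := chordLength_sq f s t
  have hrise := abs_le.1 (G.abs_rise_le hs ht hst)
  have hΔ : 0 < t - s := sub_pos.2 hst
  have hp := G.left_slope_le hs ht
  have hq := G.le_right_slope hs ht
  have hp5 := abs_le.1 (G.slope_le s hs)
  have hq5 := abs_le.1 (G.slope_le t ht)
  set c := chordLength f s t with hcdef
  have hs' := abs_lt.1 hs
  have ht' := abs_lt.1 ht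
  refine ⟨⟨_, G.mem hs, ?_⟩, ⟨_, G.mem ht, ?_⟩,
    -- The midpoint of the chord plus half the chord vector turned by a right angle.
    ⟨!₂[(s + t) / 2 - (f t - f s) / 2, (f s + f t) / 2 + (t - s) / 2], ?_, ?_⟩, ?_⟩
  · obtain ⟨h0, h1⟩ := hφ !₂[s, f s]
    rw [← hcdef] at h0 h1
    apply Plane.ext
    · refine mul_left_cancel₀ hc.ne' (h0.trans ?_); simp
    · refine mul_left_cancel₀ hc.ne' (h1.trans ?_); simp
  · obtain ⟨h0, h1⟩ := hφ !₂[t, f t]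
    rw [← hcdef] at h0 h1
    apply Plane.ext
    · refine mul_left_cancel₀ hc.ne' (h0.trans ?_); simp; linarith
    · refine mul_left_cancel₀ hc.ne' (h1.trans ?_); simp; ring
  · have hx : |(s + t) / 2 - (f t - f s) / 2| < δ := abs_lt.2 ⟨by linarith, by linarith⟩
    have f1 := G.le_abs hs
    have f2 := G.le_abs ht
    refine (G.mem_iff _ _ hx (by linarith)).2 ?_
    set x := (s + t) / 2 - (f t - f s) / 2
    have g1 := G.support_graph hx hs
    have g2 := G.support_graph hx ht
    rcases le_total 0 (f' x) with h | h
    · have : 0 ≤ f' x * (t - x) := mul_nonneg h (by simp only [x]; linarith)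
      linarith
    · have : 0 ≤ f' x * (s - x) := mul_nonneg_of_nonpos_of_nonpos h (by simp only [x]; linarith)
      linarith
  · obtain ⟨h0, h1⟩ := hφ !₂[(s + t) / 2 - (f t - f s) / 2, (f s + f t) / 2 + (t - s) / 2]
    rw [← hcdef] at h0 h1
    apply Plane.ext
    · refine mul_left_cancel₀ hc.ne' (h0.trans ?_); simp; linear_combination -hc2 / 2
    · refine mul_left_cancel₀ hc.ne' (h1.trans ?_); simp; linear_combination -hc2 / 2
  · by_cases hnf : f' s * (t - s) < f t - f s ∧ f t - f s < f' t * (t - s)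
    · right
      rintro _ ⟨z, hz, rfl⟩ hz1
      have hL := G.support_left hs hst hφ hz
      have hR := G.support_right ht hst hφ hz
      have dL := G.denom_pos hs ht hs hst
      have dR := G.denom_pos hs ht ht hst
      rw [← hcdef] at hR
      constructor
      · have h0 : 0 ≤ φ z 0 := by
          have := mul_nonpos_of_nonpos_of_nonneg hz1 dL.le
          have : 0 ≤ (f t - f s - f' s * (t - s)) * φ z 0 := by linarith
          exact nonneg_of_mul_nonneg_right this (by linarith)
        -- The left side is at most `2 / 5 * (t - s)`, and half the denominator is at least `12 / 25
        -- * (t - s)`.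
        have hk : (f t - f s) - f' s * (t - s) ≤ ((t - s) + (f t - f s) * f' s) / 2 := by
          have := mul_le_mul_of_nonneg_right hp5.1 hΔ.le
          linarith [G.le_denom hs ht hs hst]
        have h6 := mul_nonneg (sub_nonneg.2 hk) h0
        have : 0 ≤ ((t - s) + (f t - f s) * f' s) * (φ z 0 / 2 + φ z 1) := by linarith
        have := nonneg_of_mul_nonneg_right this dL
        linarith
      · have h0 : 0 ≤ c - φ z 0 := by
          have := mul_nonpos_of_nonpos_of_nonneg hz1 dR.le
          have : 0 ≤ (f' t * (t - s) - (f t - f s)) * (c - φ z 0) := by linarith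
          exact nonneg_of_mul_nonneg_right this (by linarith)
        have hk : f' t * (t - s) - (f t - f s) ≤ ((t - s) + (f t - f s) * f' t) / 2 := by
          have := mul_le_mul_of_nonneg_right hq5.2 hΔ.le
          linarith [G.le_denom hs ht ht hst]
        have h6 := mul_nonneg (sub_nonneg.2 hk) h0
        have : 0 ≤ ((t - s) + (f t - f s) * f' t) * ((c - φ z 0) / 2 + φ z 1) := by linarith
        have := nonneg_of_mul_nonneg_right this dR
        linarith
    · left
      rintro _ ⟨z, hz, rfl⟩
      rw [not_and_or, not_lt, not_lt] at hnf
      rcases hnf with h | h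
      · have hL := G.support_left hs hst hφ hz
        have dL := G.denom_pos hs ht hs hst
        have e : f t - f s - f' s * (t - s) = 0 := by linarith
        rw [e, zero_mul, add_zero, mul_comm] at hL
        exact nonneg_of_mul_nonneg_right hL dL
      · have hR := G.support_right ht hst hφ hz
        have dR := G.denom_pos hs ht ht hst
        have e : f' t * (t - s) - (f t - f s) = 0 := by linarith
        rw [e, zero_mul, add_zero, mul_comm] at hR
        exact nonneg_of_mul_nonneg_right hR dR

/-- The part of the plane between the graph of `f` over `[s, t]` and its chord. -/
def _root_.graphCap (f : ℝ → ℝ) (s t : ℝ) : Set Plane :=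
  {z | s ≤ z 0 ∧ z 0 ≤ t ∧ f (z 0) ≤ z 1 ∧ (t - s) * (z 1 - f s) ≤ (f t - f s) * (z 0 - s)}

/-- `lowerCap` is bounded by perpendiculars to the chord, `graphCap` by vertical lines. A point
below the chord and above the tangent at `s`, but left of `s`, could exist only if tangent and chord
coincide; it then lies on the chord line beyond its end. The same holds at `t`. -/
lemma lowerCap_eq (G : IsLocalGraph K δ f f') {s t : ℝ} (hs : |s| < δ) (ht : |t| < δ) (hst : s < t)
    {φ : Plane ≃ᵃⁱ[ℝ] Plane} (hφ : IsChordMotion f s t φ) :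
    lowerCap (chordLength f s t) (φ '' K) = φ '' graphCap f s t := by
  have hc := chordLength_pos f hst
  have hc2 := chordLength_sq f s t
  have hrise := abs_le.1 (G.abs_rise_le hs ht hst)
  have hΔ : 0 < t - s := sub_pos.2 hst
  have hs' := abs_lt.1 hs
  have ht' := abs_lt.1 ht
  set c := chordLength f s t with hcdef
  ext w
  constructor
  · rintro ⟨⟨z, hz, rfl⟩, h1, h2, h3⟩
    obtain ⟨e0, e1⟩ := hφ z
    rw [← hcdef] at e0 e1
    have hp := G.support s hs z hz
    have hq := G.support t ht z hz
    have hlow : (t - s) * (z 1 - f s) ≤ (f t - f s) * (z 0 - s) := by nlinarith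
    have hU : 0 ≤ (t - s) * (z 0 - s) + (f t - f s) * (z 1 - f s) := by rw [← e0]; positivity
    have hU' : (t - s) * (z 0 - s) + (f t - f s) * (z 1 - f s) ≤ (t - s) ^ 2 + (f t - f s) ^ 2 := by
      rw [← e0, ← hc2, pow_two]; exact mul_le_mul_of_nonneg_left h3 hc.le
    have hL := G.left_slope_le hs ht
    have hR := G.le_right_slope hs ht
    have h4 : s ≤ z 0 := by
      by_contra! hlt
      have h5 : (t - s) * (f' s * (z 0 - s)) ≤ (t - s) * (z 1 - f s) :=
        mul_le_mul_of_nonneg_left (by linarith) hΔ.le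
      have h6 : f t - f s = f' s * (t - s) := by
        refine le_antisymm ?_ hL
        by_contra! h7
        nlinarith
      have h8 : z 1 - f s = f' s * (z 0 - s) := by
        have : (t - s) * (z 1 - f s) ≤ (t - s) * (f' s * (z 0 - s)) := by rw [h6] at hlow; linarith
        linarith [le_of_mul_le_mul_left this hΔ]
      rw [h8, h6] at hU
      have : 0 ≤ (t - s) * (1 + f' s ^ 2) * (z 0 - s) := by linarith
      have := nonneg_of_mul_nonneg_right this (by positivity)
      linarith
    have h4' : z 0 ≤ t := by
      by_contra! hlt
      have h5 : (t - s) * (f' t * (z 0 - t)) ≤ (t - s) * (z 1 - f t) :=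
        mul_le_mul_of_nonneg_left (by linarith) hΔ.le
      have h6 : f t - f s = f' t * (t - s) := by
        refine le_antisymm hR ?_
        by_contra! h7
        nlinarith
      have h8 : z 1 - f t = f' t * (z 0 - t) := by
        have : (t - s) * (z 1 - f t) ≤ (t - s) * (f' t * (z 0 - t)) := by
          rw [h6] at hlow
          have : f s = f t - f' t * (t - s) := by linarith
          rw [this] at hlow
          linarith
        linarith [le_of_mul_le_mul_left this hΔ]
      have h9 : z 1 - f s = f' t * (z 0 - s) := by linarith
      rw [h9, h6] at hU'
      have : 0 ≤ (t - s) * (1 + f' t ^ 2) * (t - z 0) := by linarith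
      have := nonneg_of_mul_nonneg_right this (by positivity)
      linarith
    refine ⟨z, ⟨h4, h4', ?_, hlow⟩, rfl⟩
    have hx : |z 0| < δ := abs_lt.2 ⟨by linarith, by linarith⟩
    have := G.support (z 0) hx z hz
    simpa using this
  · rintro ⟨z, ⟨h1, h2, h3, h4⟩, rfl⟩
    obtain ⟨e0, e1⟩ := hφ z
    rw [← hcdef] at e0 e1
    have hx : |z 0| < δ := abs_lt.2 ⟨by linarith, by linarith⟩
    have f1 := G.le_abs hs
    have f2 := G.le_abs ht
    have hb : |z 1 - f s| ≤ t - s := by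
      have := G.support_graph hs hx
      have h5 := abs_le.1 (G.slope_le s hs)
      rw [abs_le]
      constructor
      · nlinarith
      · have : (t - s) * (z 1 - f s) ≤ (t - s) * (t - s) := by nlinarith
        exact le_of_mul_le_mul_left this hΔ
    have hb' := abs_le.1 hb
    have hzK : z ∈ K := by
      have : !₂[z 0, z 1] ∈ K := (G.mem_iff _ _ hx (by linarith)).2 h3
      convert this using 1
      apply Plane.ext <;> simp
    refine ⟨⟨z, hzK, rfl⟩, ?_, ?_, ?_⟩
    · have : c * φ z 1 ≤ 0 := by rw [e1]; linarith
      exact nonpos_of_mul_nonpos_right this hc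
    · refine nonneg_of_mul_nonneg_right (a := c) ?_ hc
      rw [e0]
      have h5 := G.support_graph hs hx
      have h6 := mul_le_mul_of_nonneg_right (abs_le.1 (G.slope_le s hs)).1 (sub_nonneg.2 h1)
      have h7 : |z 1 - f s| ≤ (z 0 - s) / 5 := abs_le.2 ⟨by linarith, by
        have := mul_le_mul_of_nonneg_right hrise.2 (sub_nonneg.2 h1)
        exact le_of_mul_le_mul_left (a := t - s) (by linarith) hΔ⟩
      have h8 : |(f t - f s) * (z 1 - f s)| ≤ (t - s) / 5 * ((z 0 - s) / 5) := by
        rw [abs_mul]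
        exact mul_le_mul (abs_le.2 hrise) h7 (abs_nonneg _) (by linarith)
      have := mul_nonneg hΔ.le (sub_nonneg.2 h1)
      linarith [(abs_le.1 h8).1]
    · refine le_of_mul_le_mul_left (a := c) ?_ hc
      rw [e0, ← pow_two, hc2]
      have h5 := G.support_graph ht hx
      have h6 := mul_le_mul_of_nonneg_right (abs_le.1 (G.slope_le t ht)).2 (sub_nonneg.2 h2)
      have h7 : |z 1 - f t| ≤ (t - z 0) / 5 := abs_le.2 ⟨by linarith, by
        have := mul_le_mul_of_nonneg_right hrise.1 (sub_nonneg.2 h2)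
        exact le_of_mul_le_mul_left (a := t - s) (by linarith) hΔ⟩
      have h8 : |(f t - f s) * (z 1 - f t)| ≤ (t - s) / 5 * ((t - z 0) / 5) := by
        rw [abs_mul]
        exact mul_le_mul (abs_le.2 hrise) h7 (abs_nonneg _) (by linarith)
      have := mul_nonneg hΔ.le (sub_nonneg.2 h2)
      linarith [(abs_le.1 h8).2]

end IsLocalGraph

/-! ### Areas of caps -/

lemma isClosed_region_between_Icc {g h : ℝ → ℝ} (hg : Continuous g) (hh : Continuous h) (s t : ℝ) :
    IsClosed {p : ℝ × ℝ | s ≤ p.1 ∧ p.1 ≤ t ∧ g p.1 ≤ p.2 ∧ p.2 ≤ h p.1} := by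
  have h1 : IsClosed {p : ℝ × ℝ | s ≤ p.1} := isClosed_le continuous_const continuous_fst
  have h2 : IsClosed {p : ℝ × ℝ | p.1 ≤ t} := isClosed_le continuous_fst continuous_const
  have h3 : IsClosed {p : ℝ × ℝ | g p.1 ≤ p.2} := isClosed_le (by fun_prop) continuous_snd
  have h4 : IsClosed {p : ℝ × ℝ | p.2 ≤ h p.1} := isClosed_le continuous_snd (by fun_prop)
  exact h1.inter (h2.inter (h3.inter h4))

open MeasureTheory in
lemma volume_region_between_Icc {g h : ℝ → ℝ} (hg : Continuous g) (hh : Continuous h) {s t : ℝ}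
    (hst : s ≤ t) (hgh : ∀ x ∈ Icc s t, g x ≤ h x) :
    volume {p : ℝ × ℝ | s ≤ p.1 ∧ p.1 ≤ t ∧ g p.1 ≤ p.2 ∧ p.2 ≤ h p.1} =
      ENNReal.ofReal (∫ x in s..t, (h x - g x)) := by
  have hm := (isClosed_region_between_Icc hg hh s t).measurableSet
  rw [Measure.volume_eq_prod, Measure.prod_apply hm, intervalIntegral.integral_of_le hst,
    ← integral_Icc_eq_integral_Ioc, ofReal_integral_eq_lintegral_ofReal,
    ← lintegral_indicator measurableSet_Icc]
  · refine lintegral_congr fun x => ?_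
    by_cases hx : x ∈ Icc s t
    · rw [indicator_of_mem hx, ← Real.volume_Icc]
      congr 1
      ext y
      simp [hx.1, hx.2]
    · rw [indicator_of_notMem hx]
      convert measure_empty (μ := (volume : Measure ℝ)) using 2
      rw [eq_empty_iff_forall_notMem]
      exact fun y hy => hx ⟨hy.1, hy.2.1⟩
  · exact (hh.sub hg).continuousOn.integrableOn_Icc
  · filter_upwards [ae_restrict_mem measurableSet_Icc] with x hx
    exact sub_nonneg.2 (hgh x hx)

/-- The area between the graph of `f` over `[s, t]` and its chord. -/
noncomputable def capArea (f : ℝ → ℝ) (s t : ℝ) : ℝ :=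
  (t - s) * (f s + f t) / 2 - ∫ x in s..t, f x

open MeasureTheory in
lemma volume_graphCap {f : ℝ → ℝ} {s t : ℝ} (hst : s < t) (hf : ContinuousOn f (Icc s t))
    (hc : ∀ x ∈ Icc s t, (t - s) * (f x - f s) ≤ (f t - f s) * (x - s)) :
    volume (graphCap f s t) = ENNReal.ofReal (capArea f s t) ∧ 0 ≤ capArea f s t := by
  have hΔ : 0 < t - s := sub_pos.2 hst
  -- The area formula is for globally continuous functions, so `f` is extended by constants beyond
  -- `[s, t]`.
  set g : ℝ → ℝ := IccExtend hst.le ((Icc s t).domRestrict f) with hg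
  have hgc : Continuous g := (continuousOn_iff_continuous_domRestrict.1 hf).Icc_extend'
  have hgf : ∀ x ∈ Icc s t, g x = f x := fun x hx => by rw [hg, IccExtend_of_mem _ _ hx]; rfl
  set h : ℝ → ℝ := fun x => f s + (f t - f s) / (t - s) * (x - s) with hh
  have hhc : Continuous h := by fun_prop
  have hgh : ∀ x ∈ Icc s t, g x ≤ h x := fun x hx => by
    rw [hgf x hx, hh]
    have : f x - f s ≤ (f t - f s) / (t - s) * (x - s) := by
      rw [div_mul_eq_mul_div, le_div_iff₀ hΔ]; linarith [hc x hx]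
    simp only; linarith
  have hI : ∫ x in s..t, (h x - g x) = capArea f s t := by
    rw [intervalIntegral.integral_sub (hhc.intervalIntegrable _ _) (hgc.intervalIntegrable _ _)]
    have e1 : ∫ x in s..t, g x = ∫ x in s..t, f x :=
      intervalIntegral.integral_congr (fun x hx => hgf x (by rwa [uIcc_of_le hst.le] at hx))
    have e2 : ∫ x in s..t, h x = (t - s) * (f s + f t) / 2 := by
      have : ∀ x ∈ uIcc s t, HasDerivAt (fun x => f s * x + (f t - f s) / (t - s) * ((x - s) ^ 2 / 2)) (h x) x := by
        intro x _
        have h1 := ((hasDerivAt_id x).const_mul (f s)).add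
          (((((hasDerivAt_id x).sub_const s).pow 2).div_const 2).const_mul ((f t - f s) / (t - s)))
        exact h1.congr_deriv (by simp only [hh, id]; push_cast; ring)
      rw [intervalIntegral.integral_eq_sub_of_hasDerivAt this (hhc.intervalIntegrable _ _)]
      field_simp
      ring
    rw [e1, e2, capArea]
  refine ⟨?_, ?_⟩
  · have hmp : MeasurePreserving (fun z : Plane => (z 0, z 1)) volume volume :=
      (volume_preserving_finTwoArrow ℝ).comp (PiLp.volume_preserving_ofLp (Fin 2))
    rw [← hI, ← volume_region_between_Icc hgc hhc hst.le hgh, ← hmp.measure_preimage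
      (isClosed_region_between_Icc hgc hhc s t).measurableSet.nullMeasurableSet]
    congr 1
    ext z
    refine and_congr_right fun h1 => and_congr_right fun h2 => ?_
    rw [hgf _ ⟨h1, h2⟩, hh, ← sub_le_iff_le_add', div_mul_eq_mul_div, le_div_iff₀ hΔ, mul_comm (t - s)]
  · rw [← hI]
    exact intervalIntegral.integral_nonneg hst.le fun x hx => sub_nonneg.2 (hgh x hx)

open MeasureTheory in
lemma AffineIsometryEquiv.volume_image (φ : Plane ≃ᵃⁱ[ℝ] Plane) (S : Set Plane) :
    volume (φ '' S) = volume S := by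
  have h : φ '' S = (fun z => z + φ 0) '' (φ.linearIsometryEquiv '' S) := by
    rw [image_image]
    exact image_congr fun z _ => φ.apply_eq z
  rw [h, image_add_right, measure_preimage_add_right]
  exact (φ.linearIsometryEquiv.symm.measurePreserving.measure_preimage_equiv
    (f := φ.linearIsometryEquiv.symm.toHomeomorph.toMeasurableEquiv) S ▸ by
      rw [φ.linearIsometryEquiv.image_eq_preimage_symm]; rfl)

lemma volume_flip_preimage (c : ℝ) (S : Set Plane) :
    MeasureTheory.volume {z | Plane.flip c z ∈ S} = MeasureTheory.volume S := by
  have h : {z | Plane.flip c z ∈ S} =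
      AffineIsometryEquiv.ofParts (Plane.orthogonal (-1) 0 (-1) (by norm_num) (by norm_num)) !₂[c, 0] '' S := by
    have : ∀ z, AffineIsometryEquiv.ofParts
        (Plane.orthogonal (-1) 0 (-1) (by norm_num) (by norm_num)) !₂[c, 0] z = Plane.flip c z := by
      intro z
      rw [AffineIsometryEquiv.ofParts_apply, Plane.orthogonal_apply]
      apply Plane.ext
      · simp; ring
      · simp
    ext z
    constructor
    · intro hz
      exact ⟨_, hz, by rw [this, Plane.flip_flip]⟩
    · rintro ⟨w, hw, rfl⟩
      rw [this]
      simpa using hw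
  rw [h, AffineIsometryEquiv.volume_image]

/-! ### Balanced chords from symmetric caps. -/

lemma HasDerivAt.nonneg_of_nonneg_right {g : ℝ → ℝ} {g' a b : ℝ} (h : HasDerivAt g g' a) (hab : a < b)
    (h0 : g a = 0) (hg : ∀ x, a < x → x < b → 0 ≤ g x) : 0 ≤ g' := by
  refine ge_of_tendsto h.tendsto_slope_zero_right ?_
  filter_upwards [Ioo_mem_nhdsGT (sub_pos.2 hab)] with x hx
  rw [h0, sub_zero, smul_eq_mul]
  exact mul_nonneg (inv_nonneg.2 hx.1.le) (hg _ (by linarith [hx.1]) (by linarith [hx.2]))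

lemma HasDerivAt.nonpos_of_nonneg_left {g : ℝ → ℝ} {g' a b : ℝ} (h : HasDerivAt g g' b) (hab : a < b)
    (h0 : g b = 0) (hg : ∀ x, a < x → x < b → 0 ≤ g x) : g' ≤ 0 := by
  have h1 : HasDerivAt (fun x => g (-x)) (-g') (-b) := by
    have h2 := h.scomp_of_eq (-b) (hasDerivAt_neg (-b)) (by simp)
    simpa [Function.comp_def] using h2
  have := h1.nonneg_of_nonneg_right (b := -a) (by linarith) (by simpa using h0)
    fun x hx hx' => hg _ (by linarith) (by linarith)
  linarith

/-- The chord of the graph of `f` over `[s, t]` makes equal angles with the tangents at its ends. -/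
def IsBalanced (f f' : ℝ → ℝ) (s t : ℝ) : Prop :=
  ((f t - f s) - f' s * (t - s)) * ((t - s) + (f t - f s) * f' t) =
    (f' t * (t - s) - (f t - f s)) * ((t - s) + (f t - f s) * f' s)

namespace IsLocalGraph

variable {K L : Set Plane} {δ ε : ℝ} {f f' g g' : ℝ → ℝ}

lemma abs_lt_of_mem (_G : IsLocalGraph K δ f f') {s t x : ℝ} (hs : |s| < δ) (ht : |t| < δ) (hsx : s ≤ x)
    (hxt : x ≤ t) : |x| < δ :=
  abs_lt.2 ⟨by linarith [(abs_lt.1 hs).1], by linarith [(abs_lt.1 ht).2]⟩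

lemma continuousOn_Icc (G : IsLocalGraph K δ f f') {s t : ℝ} (hs : |s| < δ) (ht : |t| < δ) :
    ContinuousOn f (Icc s t) := fun x hx =>
  (G.hasDerivAt x (G.abs_lt_of_mem hs ht hx.1 hx.2)).continuousAt.continuousWithinAt

lemma volume_lowerCap (G : IsLocalGraph K δ f f') {s t : ℝ} (hs : |s| < δ) (ht : |t| < δ) (hst : s < t)
    {φ : Plane ≃ᵃⁱ[ℝ] Plane} (hφ : IsChordMotion f s t φ) :
    MeasureTheory.volume (lowerCap (chordLength f s t) (φ '' K)) = ENNReal.ofReal (capArea f s t) ∧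
      0 ≤ capArea f s t := by
  rw [G.lowerCap_eq hs ht hst hφ, AffineIsometryEquiv.volume_image]
  exact volume_graphCap hst (G.continuousOn_Icc hs ht) fun x hx => G.le_chord hs ht hx.1 hx.2

/-- The mirror images of boundary points near one end lie in `K`, hence above the tangent at the
other end. The resulting inequality is an equality at the end itself, so differentiating there
compares the two base angles. Doing this at both ends gives equality. -/
lemma isBalanced_of_flip (G : IsLocalGraph K δ f f') {s t : ℝ} (hs : |s| < δ) (ht : |t| < δ)
    (hst : s < t) {φ : Plane ≃ᵃⁱ[ℝ] Plane} (hφ : IsChordMotion f s t φ)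
    (h : ∀ z ∈ lowerCap (chordLength f s t) (φ '' K),
      Plane.flip (chordLength f s t) z ∈ lowerCap (chordLength f s t) (φ '' K)) :
    IsBalanced f f' s t := by
  have hc := chordLength_pos f hst
  have hc2 := chordLength_sq f s t
  set c := chordLength f s t with hcdef
  have key : ∀ x, s < x → x < t → ∃ z ∈ K, c * φ z 1 = (t - s) * (f x - f s) - (f t - f s) * (x - s) ∧
      c * φ z 0 = c ^ 2 - ((t - s) * (x - s) + (f t - f s) * (f x - f s)) := by
    intro x hsx hxt
    have h1 : φ !₂[x, f x] ∈ lowerCap c (φ '' K) := by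
      rw [G.lowerCap_eq hs ht hst hφ]
      refine ⟨_, ⟨?_, ?_, ?_, ?_⟩, rfl⟩
      · simpa using hsx.le
      · simpa using hxt.le
      · simp
      · simpa using G.le_chord hs ht hsx.le hxt.le
    obtain ⟨⟨z, hz, hzw⟩, -⟩ := h _ h1
    obtain ⟨e0, e1⟩ := hφ !₂[x, f x]
    rw [← hcdef] at e0 e1
    refine ⟨z, hz, ?_, ?_⟩
    · rw [hzw, Plane.flip_one, e1]; simp
    · rw [hzw, Plane.flip_zero, mul_sub, e0]; simp; ring
  have dfs := G.hasDerivAt s hs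
  have dft := G.hasDerivAt t ht
  have h1 : 0 ≤ ((t - s) * f' s - (f t - f s)) * ((t - s) + (f t - f s) * f' t) +
      (f' t * (t - s) - (f t - f s)) * ((t - s) + (f t - f s) * f' s) := by
    refine HasDerivAt.nonneg_of_nonneg_right (a := s) (b := t) (g := fun x =>
      ((t - s) * (f x - f s) - (f t - f s) * (x - s)) * ((t - s) + (f t - f s) * f' t) +
      (f' t * (t - s) - (f t - f s)) * ((t - s) * (x - s) + (f t - f s) * (f x - f s))) ?_ hst
      (by simp) ?_
    · have := (((((dfs.sub_const (f s)).const_mul (t - s)).sub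
        (((hasDerivAt_id s).sub_const s).const_mul (f t - f s))).mul_const
          ((t - s) + (f t - f s) * f' t))).add
        (((((hasDerivAt_id s).sub_const s).const_mul (t - s)).add
          ((dfs.sub_const (f s)).const_mul (f t - f s))).const_mul (f' t * (t - s) - (f t - f s)))
      exact this.congr_deriv (by ring)
    · intro x hsx hxt
      obtain ⟨z, hz, e1, e0⟩ := key x hsx hxt
      have h2 := mul_nonneg hc.le (G.support_right ht hst hφ hz)
      rw [← hcdef] at h2
      have e : ((t - s) * (f x - f s) - (f t - f s) * (x - s)) * ((t - s) + (f t - f s) * f' t) +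
        (f' t * (t - s) - (f t - f s)) * ((t - s) * (x - s) + (f t - f s) * (f x - f s)) =
        c * (φ z 1 * ((t - s) + (f t - f s) * f' t) +
          (f' t * (t - s) - (f t - f s)) * (c - φ z 0)) := by
        linear_combination -((t - s) + (f t - f s) * f' t) * e1 + (f' t * (t - s) - (f t - f s)) * e0
      rwa [e]
  have h2 : ((t - s) * f' t - (f t - f s)) * ((t - s) + (f t - f s) * f' s) +
      ((f t - f s) - f' s * (t - s)) * (0 - ((t - s) + (f t - f s) * f' t)) ≤ 0 := by
    refine HasDerivAt.nonpos_of_nonneg_left (a := s) (b := t) (g := fun x =>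
      ((t - s) * (f x - f s) - (f t - f s) * (x - s)) * ((t - s) + (f t - f s) * f' s) +
      ((f t - f s) - f' s * (t - s)) *
        (c ^ 2 - ((t - s) * (x - s) + (f t - f s) * (f x - f s)))) ?_ hst
      (by rw [hc2]; ring) ?_
    · have := (((((dft.sub_const (f s)).const_mul (t - s)).sub
        (((hasDerivAt_id t).sub_const s).const_mul (f t - f s))).mul_const
          ((t - s) + (f t - f s) * f' s))).add
        ((((((hasDerivAt_id t).sub_const s).const_mul (t - s)).add
          ((dft.sub_const (f s)).const_mul (f t - f s))).const_sub (c ^ 2)).const_mul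
            ((f t - f s) - f' s * (t - s)))
      exact this.congr_deriv (by ring)
    · intro x hsx hxt
      obtain ⟨z, hz, e1, e0⟩ := key x hsx hxt
      have h2 := mul_nonneg hc.le (G.support_left hs hst hφ hz)
      have e : ((t - s) * (f x - f s) - (f t - f s) * (x - s)) * ((t - s) + (f t - f s) * f' s) +
        ((f t - f s) - f' s * (t - s)) *
        (c ^ 2 - ((t - s) * (x - s) + (f t - f s) * (f x - f s))) =
        c * (φ z 1 * ((t - s) + (f t - f s) * f' s) + ((f t - f s) - f' s * (t - s)) * φ z 0) := by
        linear_combination -((t - s) + (f t - f s) * f' s) * e1 - ((f t - f s) - f' s * (t - s)) * e0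
      rwa [e]
  rw [IsBalanced]
  linarith

/-- By the intermediate value theorem: the chord over `[0, 0]` has length `0`, the one over `[0, c]`
at least `c`. -/
lemma exists_chordLength_eq (G : IsLocalGraph L ε g g') {c : ℝ} (hc : 0 < c) (hcε : c < ε) :
    ∃ t, 0 < t ∧ t < ε ∧ chordLength g 0 t = c := by
  have hcont : ContinuousOn (fun t => chordLength g 0 t) (Icc 0 c) := by
    have := G.continuousOn_Icc (s := 0) (t := c) (by simpa using G.pos) (by rwa [abs_of_pos hc])
    unfold chordLength
    fun_prop
  have h0 : chordLength g 0 0 = 0 := by simp [chordLength]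
  have h1 : c ≤ chordLength g 0 c := by
    refine Real.le_sqrt_of_sq_le ?_
    nlinarith [sq_nonneg (g c - g 0)]
  obtain ⟨t, ht, htc⟩ := intermediate_value_Icc hc.le hcont ⟨h0.le.trans hc.le, h1⟩
  refine ⟨t, lt_of_le_of_ne ht.1 ?_, ht.2.trans_lt hcε, htc⟩
  rintro rfl
  simp only [h0] at htc
  exact hc.ne htc

lemma hasStrictDerivAt (G : IsLocalGraph K δ f f') {x : ℝ} (hx : |x| < δ) :
    HasStrictDerivAt f (f' x) x := by
  refine hasStrictDerivAt_of_hasDerivAt_of_continuousAt ?_ (G.continuousAt x hx)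
  filter_upwards [(continuous_abs.tendsto x).eventually (gt_mem_nhds hx)] with y hy
  exact G.hasDerivAt y hy

end IsLocalGraph

/-! ### Balanced chords from caps of constant area. -/

namespace IsLocalGraph

variable {K L : Set Plane} {δ ε : ℝ} {f f' g g' : ℝ → ℝ}

lemma hasStrictDerivAt_integral (G : IsLocalGraph K δ f f') {x : ℝ} (hx : |x| < δ) :
    HasStrictDerivAt (fun u => ∫ y in (0 : ℝ)..u, f y) (f x) x := by
  have hc : ∀ y, |y| < δ → ContinuousAt f y := fun y hy => (G.hasDerivAt y hy).continuousAt
  have ho : IsOpen {y : ℝ | |y| < δ} := isOpen_lt continuous_abs continuous_const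
  refine intervalIntegral.integral_hasStrictDerivAt_right ?_ ?_ (hc x hx)
  · refine ContinuousOn.intervalIntegrable fun y hy => (hc y ?_).continuousWithinAt
    have := abs_lt.1 hx
    rcases le_total 0 x with h | h
    · rw [uIcc_of_le h] at hy
      exact abs_lt.2 ⟨by linarith [hy.1, G.pos], by linarith [hy.2]⟩
    · rw [uIcc_of_ge h] at hy
      exact abs_lt.2 ⟨by linarith [hy.1], by linarith [hy.2, G.pos]⟩
  · exact ContinuousOn.stronglyMeasurableAtFilter ho
      (fun y hy => (hc y hy).continuousWithinAt) x hx

lemma integral_eq_sub (G : IsLocalGraph K δ f f') {s t : ℝ} (hs : |s| < δ) (ht : |t| < δ) :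
    ∫ x in s..t, f x = (∫ x in (0 : ℝ)..t, f x) - ∫ x in (0 : ℝ)..s, f x := by
  have hc : ∀ y, |y| < δ → ContinuousAt f y := fun y hy => (G.hasDerivAt y hy).continuousAt
  have hi : ∀ x, |x| < δ → IntervalIntegrable f MeasureTheory.volume 0 x := fun x hx => by
    refine ContinuousOn.intervalIntegrable fun y hy => (hc y ?_).continuousWithinAt
    have := abs_lt.1 hx
    rcases le_total 0 x with h | h
    · rw [uIcc_of_le h] at hy
      exact abs_lt.2 ⟨by linarith [hy.1, G.pos], by linarith [hy.2]⟩
    · rw [uIcc_of_ge h] at hy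
      exact abs_lt.2 ⟨by linarith [hy.1], by linarith [hy.2, G.pos]⟩
  exact (intervalIntegral.integral_interval_sub_left (hi t ht) (hi s hs)).symm

/-- If all chords of a given length cut off the same area, they are balanced. -/
lemma isBalanced_of_capArea (G : IsLocalGraph K δ f f') {s t : ℝ} (hs : |s| < δ) (ht : |t| < δ)
    (hst : s < t) (h : ∀ s' t', |s'| < δ → |t'| < δ → s' < t' →
      chordLength f s' t' = chordLength f s t → capArea f s' t' = capArea f s t) :
    IsBalanced f f' s t := by
  set Φ : ℝ → ℝ := fun u => ∫ y in (0 : ℝ)..u, f y with hΦ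
  set P : ℝ × ℝ := (s, t) with hP
  have d1 : HasStrictFDerivAt (fun p : ℝ × ℝ => p.1) (ContinuousLinearMap.fst ℝ ℝ ℝ) P :=
    hasStrictFDerivAt_fst
  have d2 : HasStrictFDerivAt (fun p : ℝ × ℝ => p.2) (ContinuousLinearMap.snd ℝ ℝ ℝ) P :=
    hasStrictFDerivAt_snd
  have df1 : HasStrictFDerivAt (fun p : ℝ × ℝ => f p.1) (f' s • ContinuousLinearMap.fst ℝ ℝ ℝ) P :=
    HasStrictDerivAt.comp_hasStrictFDerivAt (h₂ := f) P (G.hasStrictDerivAt hs) d1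
  have df2 : HasStrictFDerivAt (fun p : ℝ × ℝ => f p.2) (f' t • ContinuousLinearMap.snd ℝ ℝ ℝ) P :=
    HasStrictDerivAt.comp_hasStrictFDerivAt (h₂ := f) P (G.hasStrictDerivAt ht) d2
  have dΦ1 : HasStrictFDerivAt (fun p : ℝ × ℝ => Φ p.1) (f s • ContinuousLinearMap.fst ℝ ℝ ℝ) P :=
    HasStrictDerivAt.comp_hasStrictFDerivAt (h₂ := Φ) P (G.hasStrictDerivAt_integral hs) d1
  have dΦ2 : HasStrictFDerivAt (fun p : ℝ × ℝ => Φ p.2) (f t • ContinuousLinearMap.snd ℝ ℝ ℝ) P :=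
    HasStrictDerivAt.comp_hasStrictFDerivAt (h₂ := Φ) P (G.hasStrictDerivAt_integral ht) d2
  have dH := ((d2.sub d1).mul (d2.sub d1)).add ((df2.sub df1).mul (df2.sub df1))
  have dA := (((d2.sub d1).mul (df1.add df2)).mul_const (1 / 2)).sub (dΦ2.sub dΦ1)
  have harea : ∀ a b, |a| < δ → |b| < δ →
      capArea f a b = (b - a) * (f a + f b) * (1 / 2) - (Φ b - Φ a) := fun a b ha hb => by
    rw [capArea, G.integral_eq_sub ha hb]; ring
  have hext : IsLocalExtrOn
      (fun p : ℝ × ℝ => (p.2 - p.1) * (f p.1 + f p.2) * (1 / 2) - (Φ p.2 - Φ p.1))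
      {p | (p.2 - p.1) * (p.2 - p.1) + (f p.2 - f p.1) * (f p.2 - f p.1) =
        (P.2 - P.1) * (P.2 - P.1) + (f P.2 - f P.1) * (f P.2 - f P.1)} P := by
    -- The area is constant on the level set of the chord length, so every point of it is a
    -- constrained extremum.
    left
    have ho : IsOpen {p : ℝ × ℝ | |p.1| < δ ∧ |p.2| < δ ∧ p.1 < p.2} := by
      have o1 : IsOpen {p : ℝ × ℝ | |p.1| < δ} := isOpen_lt (by fun_prop) continuous_const
      have o2 : IsOpen {p : ℝ × ℝ | |p.2| < δ} := isOpen_lt (by fun_prop) continuous_const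
      have o3 : IsOpen {p : ℝ × ℝ | p.1 < p.2} := isOpen_lt continuous_fst continuous_snd
      exact o1.inter (o2.inter o3)
    filter_upwards [mem_nhdsWithin_of_mem_nhds (ho.mem_nhds (show P ∈ _ from ⟨hs, ht, hst⟩)),
      self_mem_nhdsWithin] with p hp hpP
    have h1 : chordLength f p.1 p.2 = chordLength f s t := by
      rw [chordLength, chordLength]
      congr 1
      simp only [pow_two]
      exact hpP
    have h2 := h p.1 p.2 hp.1 hp.2.1 hp.2.2 h1
    rw [harea _ _ hp.1 hp.2.1, harea _ _ hs ht] at h2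
    exact h2.ge
  obtain ⟨α, β, hαβ, h0⟩ := hext.exists_multipliers_of_hasStrictFDerivAt_1d dH dA
  have e1 := congrArg (fun ℓ : StrongDual ℝ (ℝ × ℝ) => ℓ (1, 0)) h0
  have e2 := congrArg (fun ℓ : StrongDual ℝ (ℝ × ℝ) => ℓ (0, 1)) h0
  simp [P] at e1 e2
  -- Dependence of the two gradients means that their determinant vanishes, and this determinant is,
  -- up to a factor, the difference of the two sides of the balance condition.
  have key : (t - s + (f t - f s) * f' s) * (f' t * (t - s) - (f t - f s)) +
      (t - s + (f t - f s) * f' t) * (f' s * (t - s) - (f t - f s)) = 0 := by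
    by_contra hne
    refine hαβ (Prod.ext ((mul_eq_zero_iff_right hne).1 ?_) ((mul_eq_zero_iff_right hne).1 ?_))
    · linear_combination -(f' t * (t - s) - (f t - f s)) / 2 * e1 +
        (f' s * (t - s) - (f t - f s)) / 2 * e2
    · linear_combination 2 * (t - s + (f t - f s) * f' t) * e1 + 2 * (t - s + (f t - f s) * f' s) * e2
  rw [IsBalanced]
  linarith

/-- The balanced chord property of the boundary of `K`. -/
lemma isBalanced (G : IsLocalGraph K δ f f') (G' : IsLocalGraph L ε g g')
    (hK : IsProperClosedConvex K) (hL : IsProperClosedConvex L)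
    (H : AllIntersections AdmitsNontrivialCongruence K L) {s t : ℝ} (hs : |s| < δ) (ht : |t| < δ)
    (hst : s < t) (hε : chordLength f s t < ε) : IsBalanced f f' s t := by
  have hc := chordLength_pos f hst
  obtain ⟨φ, hφ, hφc⟩ := exists_isChordMotion f hst
  obtain ⟨t₀, ht₀, ht₀ε, hct⟩ := G'.exists_chordLength_eq hc hε
  obtain ⟨ψ, hψ, hψc⟩ := exists_isChordMotion g ht₀
  have h0ε : |(0 : ℝ)| < ε := by simpa using G'.pos
  have ht₀ε' : |t₀| < ε := by rwa [abs_of_pos ht₀]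
  have capL := G'.isNormalCap h0ε ht₀ε' ht₀ hψc
  have volL := G'.volume_lowerCap h0ε ht₀ε' ht₀ hψc
  rw [hct] at capL volL
  have lens := lens_symmetry hc (hK.image φ) (hL.image ψ) (G.isNormalCap hs ht hst hφc) capL
    (H.image hφ hψ)
  set c := chordLength f s t with hcdef
  by_cases hflip : ∀ z, z ∈ lowerCap c (φ '' K) ↔ Plane.flip c z ∈ lowerCap c (φ '' K)
  · exact G.isBalanced_of_flip hs ht hst hφc fun z hz => (hflip z).1 hz
  -- An asymmetric cap of `K` forces the cap of `L` to be asymmetric, since either the caps are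
  -- congruent or both are symmetric.
  have hflipL : ¬ ∀ z, z ∈ lowerCap c (ψ '' L) ↔ Plane.flip c z ∈ lowerCap c (ψ '' L) := by
    intro hL'
    refine hflip fun z => ?_
    rcases lens with h | h | h
    · rw [← h]; exact hL' z
    · have h' := h (Plane.flip c z)
      rw [Plane.flip_flip] at h'
      rw [← h', ← h z]
      exact (hL' z).symm
    · exact h.1 z
  -- The one fixed cap of `L` is compared with every cap of `K` of the same chord length. As it is
  -- asymmetric, only the two alternatives with congruent caps remain, and these preserve area.
  have harea : ∀ s' t', |s'| < δ → |t'| < δ → s' < t' → chordLength f s' t' = c →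
      capArea f s' t' = capArea g 0 t₀ := by
    intro s' t' hs' ht' hst' hc'
    obtain ⟨χ, hχ, hχc⟩ := exists_isChordMotion f hst'
    have capK := G.isNormalCap hs' ht' hst' hχc
    have volK := G.volume_lowerCap hs' ht' hst' hχc
    rw [hc'] at capK volK
    have hvol : MeasureTheory.volume (lowerCap c (ψ '' L)) =
        MeasureTheory.volume (lowerCap c (χ '' K)) := by
      rcases lens_symmetry hc (hK.image χ) (hL.image ψ) capK capL (H.image hχ hψ) with h | h | h
      · rw [h]
      · rw [← volume_flip_preimage c (lowerCap c (χ '' K))]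
        congr 1
        ext z
        exact h z
      · exact absurd h.2 hflipL
    rw [volK.1, volL.1, ENNReal.ofReal_eq_ofReal_iff volL.2 volK.2] at hvol
    exact hvol.symm
  exact G.isBalanced_of_capArea hs ht hst fun s' t' hs' ht' hst' hc' =>
    (harea s' t' hs' ht' hst' hc').trans (harea s t hs ht hst rfl).symm

end IsLocalGraph

/-! ### Balanced chords force constant curvature -/

namespace IsLocalGraph

variable {K : Set Plane} {δ : ℝ} {f f' : ℝ → ℝ}

/-- With `s` fixed, `N t` is proportional to the distance of `(t, f t)` from the tangent at `s`, and
`D t` is the squared chord length. The balance condition says exactly that `N / D` has derivative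
zero, and `N = k D` is the equation of a circle or line touching that tangent. -/
lemma exists_curvature (G : IsLocalGraph K δ f f')
    (hb : ∀ s t, |s| < δ → |t| < δ → s < t → IsBalanced f f' s t) :
    ∃ κ, 0 ≤ κ ∧ ∀ t, |t| < δ / 2 → κ * (t ^ 2 + f t ^ 2) = 2 * f t := by
  have hδ := G.pos
  -- The base point lies left of the origin, so that the origin is an interior point of the interval
  -- on which `N / D` is constant.
  set s := -(δ / 2) with hsdef
  have hs : |s| < δ := abs_lt.2 ⟨by linarith, by linarith⟩
  have h0 : |(0 : ℝ)| < δ := by simpa using hδ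
  have hlt : ∀ t ∈ Ioo s δ, |t| < δ := fun t ht => abs_lt.2 ⟨by linarith [ht.1], ht.2⟩
  set D : ℝ → ℝ := fun t => (t - s) ^ 2 + (f t - f s) ^ 2 with hD
  set N : ℝ → ℝ := fun t => (f t - f s) - f' s * (t - s) with hN
  have hDpos : ∀ t ∈ Ioo s δ, 0 < D t := fun t ht => by
    have : 0 < t - s := sub_pos.2 ht.1
    simp only [hD]; positivity
  have hident : ∀ t ∈ Ioo s δ, 2 * N t * ((t - s) + (f t - f s) * f' t) = (f' t - f' s) * D t := by
    intro t ht
    have := hb s t hs (hlt t ht) ht.1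
    rw [IsBalanced] at this
    simp only [hD, hN]
    linear_combination this
  have hder : ∀ t ∈ Ioo s δ, HasDerivAt (fun t => N t / D t) 0 t := by
    intro t ht
    have df := G.hasDerivAt t (hlt t ht)
    have dN : HasDerivAt N (f' t - f' s * 1) t :=
      (df.sub_const (f s)).sub (((hasDerivAt_id t).sub_const s).const_mul (f' s))
    have dD := (((hasDerivAt_id t).sub_const s).pow 2).add ((df.sub_const (f s)).pow 2)
    refine (dN.div dD (hDpos t ht).ne').congr_deriv ?_
    rw [div_eq_zero_iff]
    left
    have := hident t ht
    simp only [hD, Pi.add_apply, Pi.pow_apply, id] at this ⊢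
    push_cast
    linear_combination -this
  obtain ⟨k, hk⟩ : ∃ k, ∀ t ∈ Ioo s δ, N t / D t = k := by
    refine ⟨N 0 / D 0, fun t ht => ?_⟩
    exact isOpen_Ioo.is_const_of_deriv_eq_zero isPreconnected_Ioo
      (fun x hx => (hder x hx).differentiableAt.differentiableWithinAt)
      (fun x hx => (hder x hx).deriv) ht ⟨by linarith, hδ⟩
  have hND : ∀ t ∈ Ioo s δ, N t = k * D t := fun t ht => by
    rw [← hk t ht, div_mul_cancel₀ _ (hDpos t ht).ne']
  have m0 : (0 : ℝ) ∈ Ioo s δ := ⟨by linarith, hδ⟩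
  have hk0 : 0 ≤ k := by
    rw [← hk 0 m0]
    refine div_nonneg ?_ (hDpos 0 m0).le
    have := G.left_slope_le hs h0
    simp only [hN]; linarith
  have hp : -f' s = 2 * k * (0 - s) := by
    have h1 := hident 0 m0
    rw [hND 0 m0, G.zero, G.deriv_zero] at h1
    have h2 : D 0 * (2 * k * (0 - s)) = D 0 * -f' s := by linear_combination h1
    exact (mul_left_cancel₀ (hDpos 0 m0).ne' h2).symm
  have hfs := G.nonneg hs
  have hden : 0 < 1 + 2 * k * f s := by positivity
  -- In `N t = k * D t` the coefficient of `f t` is `1 + 2 * k * f s`. The constant term cancels by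
  -- the equation at `t = 0`, and the term linear in `t` by `hp`, because the tangent at the origin
  -- is horizontal.
  refine ⟨2 * k / (1 + 2 * k * f s), by positivity, fun t ht => ?_⟩
  have ht' := abs_lt.1 ht
  have e1 := hND t ⟨by linarith, by linarith⟩
  have e0 := hND 0 m0
  simp only [hN, hD, G.zero] at e1 e0
  rw [div_mul_eq_mul_div, div_eq_iff hden.ne']
  linear_combination (-2) * e1 + 2 * e0 + 2 * t * hp

lemma eventually_mem_iff (G : IsLocalGraph K δ f f') {κ : ℝ} (hκ : 0 ≤ κ)
    (h : ∀ t, |t| < δ / 2 → κ * (t ^ 2 + f t ^ 2) = 2 * f t) :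
    ∀ᶠ w in 𝓝 (0 : Plane), w ∈ K ↔ κ * ‖w‖ ^ 2 ≤ 2 * w 1 := by
  have hδ := G.pos
  have hr : 0 < 1 / (κ + 1) := by positivity
  have o0 : ∀ r : ℝ, 0 < r → ∀ᶠ w in 𝓝 (0 : Plane), |w 0| < r := fun r hr' =>
    (isOpen_lt (f := fun w : Plane => |w 0|) (by fun_prop) continuous_const).mem_nhds (by simpa)
  have o1 : ∀ r : ℝ, 0 < r → ∀ᶠ w in 𝓝 (0 : Plane), |w 1| < r := fun r hr' =>
    (isOpen_lt (f := fun w : Plane => |w 1|) (by fun_prop) continuous_const).mem_nhds (by simpa)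
  filter_upwards [o0 _ (half_pos hδ), o0 _ hr, o1 _ hδ, o1 _ hr] with w h1 h2 h3 h4
  have hw0 : |w 0| < δ := by linarith
  have hw : w = !₂[w 0, w 1] := by apply Plane.ext <;> simp
  have e := h (w 0) h1
  have hf := G.le_abs hw0
  have hlt : κ * (w 1 + f (w 0)) < 2 := by
    have : w 1 + f (w 0) ≤ 2 * (1 / (κ + 1)) := by
      linarith [(abs_lt.1 h4).2, abs_nonneg (w 0)]
    calc κ * (w 1 + f (w 0)) ≤ κ * (2 * (1 / (κ + 1))) := mul_le_mul_of_nonneg_left this hκ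
      _ = 2 * κ / (κ + 1) := by ring
      _ < 2 := by rw [div_lt_iff₀ (by positivity)]; linarith
  have hmem : w ∈ K ↔ f (w 0) ≤ w 1 := by
    conv_lhs => rw [hw]
    exact G.mem_iff _ _ hw0 (by linarith [(abs_lt.1 h3).2])
  rw [hmem, Plane.norm_sq_eq]
  -- For fixed abscissa the equation of the circle is quadratic in the ordinate with `f (w 0)` as a
  -- root; the cofactor is positive near the origin, so the sign is decided by `w 1 - f (w 0)`.
  have key : κ * (w 0 ^ 2 + w 1 ^ 2) - 2 * w 1 = -((w 1 - f (w 0)) * (2 - κ * (w 1 + f (w 0)))) := by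
    linear_combination e
  have hpos : 0 < 2 - κ * (w 1 + f (w 0)) := by linarith
  constructor
  · intro hle
    have := mul_nonneg (sub_nonneg.2 hle) hpos.le
    linarith
  · intro hle
    have : 0 ≤ (w 1 - f (w 0)) * (2 - κ * (w 1 + f (w 0))) := by linarith
    linarith [nonneg_of_mul_nonneg_left this hpos]

end IsLocalGraph

/-- Near `x`, the set `K` is a disk of curvature `κ` (a half-plane if `κ = 0`) with inner unit
normal `u` at `x`. -/
def HasCurvatureAt (K : Set Plane) (x u : Plane) (κ : ℝ) : Prop :=
  ∀ᶠ w in 𝓝 x, w ∈ K ↔ κ * ‖w - x‖ ^ 2 ≤ 2 * inner ℝ u (w - x)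

lemma AllIntersections.exists_hasCurvatureAt {K L : Set Plane}
    (H : AllIntersections AdmitsNontrivialCongruence K L) (hK : IsProperClosedConvex K)
    (hL : IsProperClosedConvex L) {x u : Plane} (hx : x ∈ K) (hu : IsInnerNormal K x u) :
    ∃ κ, 0 ≤ κ ∧ HasCurvatureAt K x u κ := by
  have hv : ‖(!₂[0, 1] : Plane)‖ = 1 := by rw [Plane.norm_eq_one_iff]; simp
  obtain ⟨y, hy, v, hvn, -⟩ := hL.exists_smooth_point
  obtain ⟨φ, hφ, hφx, hφu⟩ := exists_rigid_normalize x hu.1 hv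
  obtain ⟨ψ, hψ, hψy, hψv⟩ := exists_rigid_normalize y hvn.1 hv
  have hsK := (H.isSmoothSet hK hL).image φ
  have hsL := (H.swap.isSmoothSet hL hK).image ψ
  have nK := hu.image φ
  have nL := hvn.image ψ
  rw [hφx, hφu] at nK
  rw [hψy, hψv] at nL
  obtain ⟨δ, f, f', G⟩ := exists_isLocalGraph (hK.image φ) hsK ⟨x, hx, hφx⟩ nK
  obtain ⟨ε, g, g', G'⟩ := exists_isLocalGraph (hL.image ψ) hsL ⟨y, hy, hψy⟩ nL
  -- Abscissas below `ε / 4` give `t - s < ε / 2`, hence chords shorter than `ε`, for which `L` has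
  -- a partner chord.
  have hη : 0 < min δ (ε / 4) := lt_min G.pos (by linarith [G'.pos])
  have G₁ := G.mono hη (min_le_left _ _)
  obtain ⟨κ, hκ, hfκ⟩ := G₁.exists_curvature fun s t hs ht hst => by
    refine G₁.isBalanced G' (hK.image φ) (hL.image ψ) (H.image hφ hψ) hs ht hst ?_
    have hr := G₁.abs_rise_le hs ht hst
    have h1 : t - s < ε / 2 := by
      have := min_le_right δ (ε / 4)
      linarith [(abs_lt.1 hs).1, (abs_lt.1 ht).2]
    have h2 : 0 < t - s := sub_pos.2 hst
    have h3 : chordLength f s t ≤ 2 * (t - s) := by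
      refine Real.sqrt_le_iff.2 ⟨by linarith, ?_⟩
      have := sq_le_sq' (by linarith [(abs_le.1 hr).1]) (abs_le.1 hr).2
      nlinarith
    linarith
  refine ⟨κ, hκ, ?_⟩
  have h := G₁.eventually_mem_iff hκ hfκ
  have hcont : Tendsto φ (𝓝 x) (𝓝 0) := by
    rw [← hφx]; exact φ.continuous.tendsto x
  filter_upwards [hcont.eventually h] with w hw
  have e1 : ‖φ w‖ = ‖w - x‖ := by
    have := φ.dist_map w x
    rwa [hφx, dist_zero_right, dist_eq_norm] at this
  have e2 : φ w 1 = inner ℝ u (w - x) := by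
    rw [← φ.inner_linear_sub u w x, hφu, hφx, Plane.inner_eq]; simp
  rw [φ.injective.mem_set_image, e1, e2] at hw
  exact hw

/-! ### From local to global -/

lemma HasCurvatureAt.unique {K : Set Plane} {x u v : Plane} {κ l : ℝ} (hu : ‖u‖ = 1) (hv : ‖v‖ = 1)
    (h1 : HasCurvatureAt K x u κ) (h2 : HasCurvatureAt K x v l) : u = v ∧ κ = l := by
  have huv : u = v := by
    -- Along `u - v` the points just after `x` lie inside the disk with normal `u` and outside the
    -- one with normal `v`.
    by_contra hne
    have hlt : inner ℝ u v < (1 : ℝ) := (inner_lt_one_iff_real_of_norm_eq_one hu hv).2 hne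
    have hcont : Tendsto (fun ε : ℝ => x + ε • (u - v)) (𝓝[>] 0) (𝓝 x) := by
      have : Continuous (fun ε : ℝ => x + ε • (u - v)) := by fun_prop
      exact (this.tendsto' 0 x (by simp)).mono_left nhdsWithin_le_nhds
    have hsmall : ∀ᶠ ε : ℝ in 𝓝[>] 0, κ * ε * ‖u - v‖ ^ 2 < 2 * (1 - inner ℝ u v) := by
      have : Continuous (fun ε : ℝ => κ * ε * ‖u - v‖ ^ 2) := by fun_prop
      refine ((this.tendsto' 0 0 (by simp)).mono_left nhdsWithin_le_nhds).eventually
        (gt_mem_nhds ?_)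
      linarith
    have hsmall' : ∀ᶠ ε : ℝ in 𝓝[>] 0, -(l * ε * ‖u - v‖ ^ 2) < 2 * (1 - inner ℝ u v) := by
      have : Continuous (fun ε : ℝ => -(l * ε * ‖u - v‖ ^ 2)) := by fun_prop
      refine ((this.tendsto' 0 0 (by simp)).mono_left nhdsWithin_le_nhds).eventually
        (gt_mem_nhds ?_)
      linarith
    obtain ⟨ε, e1, e2, e3, e4, hε⟩ := ((hcont.eventually h1).and ((hcont.eventually h2).and
      (hsmall.and (hsmall'.and self_mem_nhdsWithin)))).exists
    have hε' : 0 < ε := hε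
    have iu : inner ℝ u (u - v) = 1 - inner ℝ u v := by
      rw [inner_sub_right, real_inner_self_eq_norm_sq, hu]; norm_num
    have iv : inner ℝ v (u - v) = -(1 - inner ℝ u v) := by
      rw [inner_sub_right, real_inner_self_eq_norm_sq, hv, real_inner_comm]; norm_num
    simp only [add_sub_cancel_left, norm_smul, inner_smul_right, iu, iv, mul_pow,
      Real.norm_eq_abs, sq_abs] at e1 e2
    have m := e2.1 (e1.2 (by nlinarith))
    nlinarith
  refine ⟨huv, ?_⟩
  subst huv
  clear hv
  have main : ∀ κ l : ℝ, HasCurvatureAt K x u κ → HasCurvatureAt K x u l → l ≤ κ := by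
    intro κ l h1 h2
    by_contra! hlt
    set p : Plane := !₂[-u 1, u 0] with hp
    rw [Plane.norm_eq_one_iff] at hu
    -- The two circles rise like `κ / 2 * ε ^ 2` and `l / 2 * ε ^ 2` over their common tangent. The
    -- mean coefficient gives points separating them.
    set m : ℝ := (κ + l) / 4 with hm
    have hcont : Tendsto (fun ε : ℝ => x + ε • (p + (m * ε) • u)) (𝓝[>] 0) (𝓝 x) := by
      have : Continuous (fun ε : ℝ => x + ε • (p + (m * ε) • u)) := by fun_prop
      exact (this.tendsto' 0 x (by simp)).mono_left nhdsWithin_le_nhds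
    have hsmall : ∀ᶠ ε : ℝ in 𝓝[>] 0, κ * (1 + m ^ 2 * ε ^ 2) < (κ + l) / 2 := by
      have : Continuous (fun ε : ℝ => κ * (1 + m ^ 2 * ε ^ 2)) := by fun_prop
      refine ((this.tendsto' 0 κ (by simp)).mono_left nhdsWithin_le_nhds).eventually
        (gt_mem_nhds ?_)
      linarith
    have hsmall' : ∀ᶠ ε : ℝ in 𝓝[>] 0, (κ + l) / 2 < l * (1 + m ^ 2 * ε ^ 2) := by
      have : Continuous (fun ε : ℝ => l * (1 + m ^ 2 * ε ^ 2)) := by fun_prop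
      refine ((this.tendsto' 0 l (by simp)).mono_left nhdsWithin_le_nhds).eventually
        (lt_mem_nhds ?_)
      linarith
    obtain ⟨ε, e1, e2, e3, e4, hε⟩ := ((hcont.eventually h1).and ((hcont.eventually h2).and
      (hsmall.and (hsmall'.and self_mem_nhdsWithin)))).exists
    have hε' : 0 < ε := hε
    have hε2 : 0 < ε ^ 2 := by positivity
    have n : ‖ε • (p + (m * ε) • u)‖ ^ 2 = ε ^ 2 * (1 + m ^ 2 * ε ^ 2) := by
      rw [Plane.norm_sq_eq]
      simp only [hp, PiLp.smul_apply, PiLp.add_apply, smul_eq_mul, Matrix.cons_val_zero,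
        Matrix.cons_val_one]
      linear_combination (ε ^ 2 * (1 + m ^ 2 * ε ^ 2)) * hu
    have i : inner ℝ u (ε • (p + (m * ε) • u)) = ε ^ 2 * m := by
      rw [Plane.inner_eq]
      simp only [hp, PiLp.smul_apply, PiLp.add_apply, smul_eq_mul, Matrix.cons_val_zero,
        Matrix.cons_val_one]
      linear_combination (ε ^ 2 * m) * hu
    simp only [add_sub_cancel_left] at e1 e2
    have hm2 : 2 * (ε ^ 2 * m) = ε ^ 2 * ((κ + l) / 2) := by rw [hm]; ring
    rw [n, i, hm2] at e1 e2
    have hmm := e2.1 (e1.2 (by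
      have := mul_le_mul_of_nonneg_left e3.le hε2.le
      linarith))
    have := mul_lt_mul_of_pos_left e4 hε2
    linarith
  exact le_antisymm (main _ _ h2 h1) (main _ _ h1 h2)

/-- The equation of a disk or half-plane, centred at another point of its boundary. -/
lemma recenter {κ : ℝ} {x u z : Plane} (hu : ‖u‖ = 1) (hz : κ * ‖z - x‖ ^ 2 = 2 * inner ℝ u (z - x)) :
    ‖u - κ • (z - x)‖ = 1 ∧ ∀ w, κ * ‖w - z‖ ^ 2 - 2 * inner ℝ (u - κ • (z - x)) (w - z) =
      κ * ‖w - x‖ ^ 2 - 2 * inner ℝ u (w - x) := by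
  rw [Plane.norm_eq_one_iff] at hu ⊢
  rw [Plane.norm_sq_eq, Plane.inner_eq] at hz
  simp only [Plane.norm_sq_eq, Plane.inner_eq, PiLp.sub_apply, PiLp.smul_apply, smul_eq_mul] at *
  constructor
  · linear_combination hu + κ * hz
  · intro w
    linear_combination -hz

lemma HasCurvatureAt.mem {K : Set Plane} {x u : Plane} {κ : ℝ} (h : HasCurvatureAt K x u κ) : x ∈ K := by
  simpa using h.self_of_nhds

lemma HasCurvatureAt.notMem_interior {K : Set Plane} {x u : Plane} {κ : ℝ} (hκ : 0 ≤ κ) (hu : ‖u‖ = 1)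
    (h : HasCurvatureAt K x u κ) : x ∉ interior K := by
  intro hx
  have hcont : Tendsto (fun ε : ℝ => x - ε • u) (𝓝[>] 0) (𝓝 x) := by
    have : Continuous (fun ε : ℝ => x - ε • u) := by fun_prop
    exact (this.tendsto' 0 x (by simp)).mono_left nhdsWithin_le_nhds
  obtain ⟨ε, e1, e2, hε⟩ := ((hcont.eventually h).and ((hcont.eventually
    (mem_interior_iff_mem_nhds.1 hx)).and self_mem_nhdsWithin)).exists
  have hε' : 0 < ε := hε
  have := e1.1 e2
  have e : x - ε • u - x = -(ε • u) := by abel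
  rw [e, inner_neg_right, inner_smul_right, real_inner_self_eq_norm_sq, hu, norm_neg, norm_smul, hu] at this
  have := mul_nonneg hκ (sq_nonneg (‖ε‖ * 1))
  linarith

/-- The local description of `K` at a boundary point propagates along the circle or line. -/
lemma eventually_mem_iff_of_isPreconnected {K : Set Plane} (hK : IsProperClosedConvex K)
    (hloc : ∀ x ∈ K, ∀ u, IsInnerNormal K x u → ∃ κ, 0 ≤ κ ∧ HasCurvatureAt K x u κ)
    {x u : Plane} {κ : ℝ} (hκ : 0 ≤ κ) (hu : ‖u‖ = 1) (h : HasCurvatureAt K x u κ)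
    (hconn : IsPreconnected {z | κ * ‖z - x‖ ^ 2 = 2 * inner ℝ u (z - x)}) :
    ∀ z, κ * ‖z - x‖ ^ 2 = 2 * inner ℝ u (z - x) →
      ∀ᶠ w in 𝓝 z, w ∈ K ↔ κ * ‖w - x‖ ^ 2 ≤ 2 * inner ℝ u (w - x) := by
  set Γ : Set Plane := {z | κ * ‖z - x‖ ^ 2 = 2 * inner ℝ u (z - x)} with hΓ
  have hrec : ∀ z ∈ Γ, (HasCurvatureAt K z (u - κ • (z - x)) κ ↔
      ∀ᶠ w in 𝓝 z, w ∈ K ↔ κ * ‖w - x‖ ^ 2 ≤ 2 * inner ℝ u (w - x)) := by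
    intro z hz
    refine eventually_congr (Eventually.of_forall fun w => iff_congr Iff.rfl ?_)
    have := (recenter hu hz).2 w
    constructor <;> intro <;> linarith
  set S : Set Γ := {z | ∀ᶠ w in 𝓝 (z : Plane), w ∈ K ↔ κ * ‖w - x‖ ^ 2 ≤ 2 * inner ℝ u (w - x)} with hS
  have hSo : IsOpen S := by
    refine isOpen_iff_mem_nhds.2 fun z hz => ?_
    exact (continuous_subtype_val.tendsto z).eventually (eventually_eventually_nhds.2 hz)
  -- A limit `z` is again a boundary point of `K`, so it has some osculating circle or line of its
  -- own. This one also describes `K` near points `w` of `S` close to `z`, where it must agree with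
  -- `Γ` by uniqueness of normal and curvature.
  have hSc : IsClosed S := by
    refine isClosed_iff_frequently.2 fun z hz => ?_
    have hz' : ∃ᶠ w in 𝓝 (z : Plane), w ∈ Γ ∧ ∀ᶠ w' in 𝓝 w, w' ∈ K ↔
        κ * ‖w' - x‖ ^ 2 ≤ 2 * inner ℝ u (w' - x) := by
      have := (continuous_subtype_val.tendsto z).frequently (p := fun w => w ∈ Γ ∧ ∀ᶠ w' in 𝓝 w, w' ∈ K ↔
        κ * ‖w' - x‖ ^ 2 ≤ 2 * inner ℝ u (w' - x)) (hz.mono fun w hw => ⟨w.2, hw⟩)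
      exact this
    have hzK : (z : Plane) ∈ K := by
      refine isClosed_iff_frequently.1 hK.isClosed z (hz'.mono fun w hw => ?_)
      exact ((hrec w hw.1).2 hw.2).mem
    have hzf : (z : Plane) ∉ interior K := by
      intro hint
      obtain ⟨w, hw, hwi⟩ := (hz'.and_eventually (isOpen_interior.mem_nhds hint)).exists
      exact ((hrec w hw.1).2 hw.2).notMem_interior hκ (recenter hu hw.1).1 hwi
    obtain ⟨v, hv⟩ := hK.exists_isInnerNormal ⟨subset_closure hzK, hzf⟩
    obtain ⟨l, hl, hcl⟩ := hloc _ hzK v hv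
    obtain ⟨w, hw, hwl⟩ := (hz'.and_eventually (eventually_eventually_nhds.2 hcl)).exists
    have hw1 := (hrec w hw.1).2 hw.2
    have hwe : l * ‖w - z‖ ^ 2 = 2 * inner ℝ v (w - z) := by
      refine le_antisymm (hwl.self_of_nhds.1 hw1.mem) ?_
      by_contra! hlt
      refine hw1.notMem_interior hκ (recenter hu hw.1).1 (mem_interior_iff_mem_nhds.2 ?_)
      have ho : IsOpen {y : Plane | l * ‖y - z‖ ^ 2 < 2 * inner ℝ v (y - z)} :=
        isOpen_lt (by fun_prop) (by fun_prop)
      filter_upwards [hwl, ho.mem_nhds hlt] with y hy hy'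
      exact hy.2 (le_of_lt hy')
    have hw2 : HasCurvatureAt K w (v - l • (w - z)) l := by
      filter_upwards [hwl] with y hy
      rw [hy]
      have := (recenter hv.1 hwe).2 y
      constructor <;> intro <;> linarith
    obtain ⟨e1, e2⟩ := hw1.unique (recenter hu hw.1).1 (recenter hv.1 hwe).1 hw2
    subst e2
    have e3 : v = u - κ • ((z : Plane) - x) := by
      have : v = u - κ • (w - x) + κ • (w - z) := by rw [e1]; abel
      rw [this]; module
    subst e3
    exact (hrec z z.2).1 hcl
  have : PreconnectedSpace Γ := isPreconnected_iff_preconnectedSpace.1 hconn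
  have hx : x ∈ Γ := by simp [hΓ]
  have hS1 : S = univ := IsClopen.eq_univ ⟨hSc, hSo⟩ ⟨⟨x, hx⟩, h⟩
  intro z hz
  exact (hS1 ▸ mem_univ _ : (⟨z, hz⟩ : Γ) ∈ S)

/-- The whole circle lies in `K`, so by convexity the disk does. A point of `K` outside would,
joined to the nearest point of the circle, produce points of `K` just outside the circle, against
the local description there. -/
lemma isCircle_of_hasCurvatureAt {K : Set Plane} (hK : IsProperClosedConvex K)
    (hloc : ∀ x ∈ K, ∀ u, IsInnerNormal K x u → ∃ κ, 0 ≤ κ ∧ HasCurvatureAt K x u κ)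
    {x u : Plane} {κ : ℝ} (hκ : 0 < κ) (hu : ‖u‖ = 1) (h : HasCurvatureAt K x u κ) : IsCircle K := by
  set c : Plane := x + κ⁻¹ • u with hc
  have hq : ∀ w, κ * ‖w - x‖ ^ 2 - 2 * inner ℝ u (w - x) = κ * (‖w - c‖ ^ 2 - (κ⁻¹) ^ 2) := by
    intro w
    have : w - c = (w - x) - κ⁻¹ • u := by rw [hc]; abel
    rw [this, norm_sub_sq_real (w - x), inner_smul_right, norm_smul, hu, Real.norm_of_nonneg (by positivity),
      real_inner_comm u (w - x)]
    field_simp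
    ring
  have hr : 0 < κ⁻¹ := by positivity
  have hΓ : ∀ w, κ * ‖w - x‖ ^ 2 = 2 * inner ℝ u (w - x) ↔ ‖w - c‖ = κ⁻¹ := by
    intro w
    rw [← sub_eq_zero, hq, mul_eq_zero_iff_left hκ.ne', sub_eq_zero,
      sq_eq_sq₀ (norm_nonneg _) hr.le]
  have hle : ∀ w, κ * ‖w - x‖ ^ 2 ≤ 2 * inner ℝ u (w - x) ↔ ‖w - c‖ ≤ κ⁻¹ := by
    intro w
    rw [← sub_nonpos, hq, ← sq_le_sq₀ (norm_nonneg _) hr.le, ← sub_nonpos (a := ‖w - c‖ ^ 2)]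
    constructor
    · intro h'; by_contra! h''; exact absurd (mul_pos hκ h'') (not_lt.2 h')
    · exact fun h' => mul_nonpos_of_nonneg_of_nonpos hκ.le h'
  have hconn : IsPreconnected {z | κ * ‖z - x‖ ^ 2 = 2 * inner ℝ u (z - x)} := by
    have : {z | κ * ‖z - x‖ ^ 2 = 2 * inner ℝ u (z - x)} = Metric.sphere c κ⁻¹ := by
      ext w; rw [mem_sphere_iff_norm]; exact hΓ w
    rw [this]
    refine isPreconnected_sphere ?_ c κ⁻¹
    rw [← Module.finrank_eq_rank]
    simp
  have hnear := eventually_mem_iff_of_isPreconnected hK hloc hκ.le hu h hconn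
  have hsph : ∀ e : Plane, ‖e‖ = 1 → c + κ⁻¹ • e ∈ K := by
    intro e he
    have e1 : ‖c + κ⁻¹ • e - c‖ = κ⁻¹ := by
      rw [add_sub_cancel_left, norm_smul, he, Real.norm_of_nonneg hr.le, mul_one]
    exact (hnear _ ((hΓ _).2 e1)).self_of_nhds.2 ((hle _).2 e1.le)
  refine ⟨c, κ⁻¹, hr, ?_⟩
  have hdir : ∀ y : Plane, ∃ e : Plane, ‖e‖ = 1 ∧ y = c + ‖y - c‖ • e := by
    intro y
    by_cases hy : y - c = 0
    · exact ⟨u, hu, by rw [hy, norm_zero, zero_smul, add_zero]; exact sub_eq_zero.1 hy⟩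
    · have hn : ‖y - c‖ ≠ 0 := norm_ne_zero_iff.2 hy
      refine ⟨‖y - c‖⁻¹ • (y - c), ?_, ?_⟩
      · rw [norm_smul, norm_inv, norm_norm, inv_mul_cancel₀ hn]
      · rw [smul_smul, mul_inv_cancel₀ hn, one_smul]; abel
  ext y
  rw [mem_closedBall_iff_norm]
  obtain ⟨e, he, hye⟩ := hdir y
  set ρ := ‖y - c‖ with hρ
  have hρ0 : 0 ≤ ρ := norm_nonneg _
  constructor
  · intro hy
    by_contra! hlt
    have e1 : ‖c + κ⁻¹ • e - c‖ = κ⁻¹ := by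
      rw [add_sub_cancel_left, norm_smul, he, Real.norm_of_nonneg hr.le, mul_one]
    have hev := hnear _ ((hΓ _).2 e1)
    have hcont : Tendsto (fun ε : ℝ => (c + κ⁻¹ • e) + ε • (y - (c + κ⁻¹ • e))) (𝓝[>] 0)
        (𝓝 (c + κ⁻¹ • e)) := by
      have : Continuous (fun ε : ℝ => (c + κ⁻¹ • e) + ε • (y - (c + κ⁻¹ • e))) := by fun_prop
      exact (this.tendsto' 0 _ (by simp)).mono_left nhdsWithin_le_nhds
    obtain ⟨ε, h1, h2⟩ := ((hcont.eventually hev).and (Ioo_mem_nhdsGT one_pos)).exists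
    have hm := hK.convex.add_smul_sub_mem (hsph e he) hy ⟨h2.1.le, h2.2.le⟩
    have h3 := (hle _).1 (h1.1 hm)
    have h4 : (c + κ⁻¹ • e) + ε • (y - (c + κ⁻¹ • e)) - c = (κ⁻¹ + ε * (ρ - κ⁻¹)) • e := by
      nth_rewrite 1 [hye]; module
    have h5 := mul_pos h2.1 (sub_pos.2 hlt)
    rw [h4, norm_smul, he, mul_one, Real.norm_of_nonneg (by positivity)] at h3
    linarith
  · intro hle'
    have h1 := hsph e he
    have h2 := hsph (-e) (by rwa [norm_neg])
    have : y = ((1 + ρ * κ) / 2) • (c + κ⁻¹ • e) + ((1 - ρ * κ) / 2) • (c + κ⁻¹ • -e) := by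
      rw [hye]
      have : ρ = ((1 + ρ * κ) / 2) * κ⁻¹ - ((1 - ρ * κ) / 2) * κ⁻¹ := by field_simp; ring
      nth_rewrite 1 [this]
      module
    rw [this]
    have h3 : ρ * κ ≤ 1 := by
      have := mul_le_mul_of_nonneg_right hle' hκ.le
      rwa [inv_mul_cancel₀ hκ.ne'] at this
    have h4 : 0 ≤ ρ * κ := by positivity
    exact hK.convex h1 h2 (by linarith) (by linarith) (by ring)

/-- With a boundary line and a point `w`, convexity gives `K` every point strictly between the line
and its parallel through `w`. Only the supremum of the heights matters: finite gives a strip,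
infinite a half-plane. -/
lemma isParallelStrip_or_isHalfPlane_of_line_subset {K : Set Plane} (hK : IsProperClosedConvex K)
    {x u : Plane} (hu : IsInnerNormal K x u) (hline : ∀ z, inner ℝ u (z - x) = 0 → z ∈ K) :
    IsParallelStrip K ∨ IsHalfPlane K := by
  have huu : inner ℝ u u = (1 : ℝ) := by rw [real_inner_self_eq_norm_sq, hu.1]; norm_num
  have hdown : ∀ w ∈ K, ∀ y, 0 ≤ inner ℝ u (y - x) → inner ℝ u (y - x) < inner ℝ u (w - x) → y ∈ K := by
    intro w hw y hy0 hyw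
    set a : ℝ := inner ℝ u (y - x)
    set b : ℝ := inner ℝ u (w - x) with hb
    have hb0 : 0 < b := hy0.trans_lt hyw
    have hba : 0 < b - a := sub_pos.2 hyw
    -- The point where the line from `w` through `y` meets the boundary line.
    have hl : (b / (b - a)) • (y - (a / b) • w) ∈ K := by
      refine hline _ ?_
      have e : (b / (b - a)) • (y - (a / b) • w) - x = (b / (b - a)) • ((y - x) - (a / b) • (w - x)) := by
        have : x = (b / (b - a)) • (x - (a / b) • x) := by
          have h1 : (b / (b - a)) * (1 - a / b) = 1 := by field_simp
          have h2 : x - (a / b) • x = (1 - a / b) • x := by module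
          rw [h2, smul_smul, h1, one_smul]
        nth_rewrite 1 [this]
        module
      rw [e, inner_smul_right, inner_sub_right, inner_smul_right, ← hb, div_mul_cancel₀ _ hb0.ne',
        sub_self, mul_zero]
    have e : y = (a / b) • w + ((b - a) / b) • ((b / (b - a)) • (y - (a / b) • w)) := by
      rw [smul_smul, div_mul_div_cancel₀ hb0.ne', div_self hba.ne', one_smul]; abel
    rw [e]
    exact hK.convex hw hl (by positivity) (by positivity) (by field_simp; ring)
  have hval : ∀ z : Plane, inner ℝ u (z - x) = inner ℝ u z - inner ℝ u x := fun z => inner_sub_right _ _ _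
  by_cases hbd : BddAbove ((fun w => inner ℝ u (w - x)) '' K)
  · left
    set b : ℝ := sSup ((fun w => inner ℝ u (w - x)) '' K) with hb
    have hle : ∀ w ∈ K, inner ℝ u (w - x) ≤ b := fun w hw => le_csSup hbd ⟨w, hw, rfl⟩
    have hne : ((fun w => inner ℝ u (w - x)) '' K).Nonempty := (hK.interior_nonempty.mono interior_subset).image _
    have hlt : ∀ y, 0 ≤ inner ℝ u (y - x) → inner ℝ u (y - x) < b → y ∈ K := by
      intro y h0 hy
      obtain ⟨_, ⟨w, hw, rfl⟩, hyw⟩ := exists_lt_of_lt_csSup hne hy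
      exact hdown w hw y h0 hyw
    have hb0 : 0 < b := by
      obtain ⟨z, hz⟩ := hK.interior_nonempty
      refine lt_of_lt_of_le (lt_of_le_of_ne (hu.2 z (interior_subset hz)) fun h0 => ?_)
        (hle z (interior_subset hz))
      refine IsInnerNormal.notMem_interior (x := z) ⟨hu.1, fun w hw => ?_⟩ hz
      have h1 := hu.2 w hw
      rw [hval] at h0 h1
      rw [inner_sub_right]
      linarith
    refine ⟨u, inner ℝ u x, inner ℝ u x + b, hu.1, by linarith, ?_⟩
    ext y
    simp only [mem_ofPred_eq]
    constructor
    · intro hy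
      have h1 := hu.2 y hy
      have h2 := hle y hy
      rw [hval] at h1 h2
      constructor <;> linarith
    · rintro ⟨h1, h2⟩
      rcases lt_or_eq_of_le h2 with h2 | h2
      · exact hlt y (by rw [hval]; linarith) (by rw [hval]; linarith)
      · have hcont : Tendsto (fun ε : ℝ => y - ε • u) (𝓝[>] 0) (𝓝 y) := by
          have : Continuous (fun ε : ℝ => y - ε • u) := by fun_prop
          exact (this.tendsto' 0 _ (by simp)).mono_left nhdsWithin_le_nhds
        refine hK.isClosed.mem_of_tendsto hcont ?_
        filter_upwards [Ioo_mem_nhdsGT hb0] with ε hε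
        have e : inner ℝ u (y - ε • u - x) = b - ε := by
          rw [hval, inner_sub_right, inner_smul_right, huu]; linarith
        exact hlt _ (by rw [e]; linarith [hε.2]) (by rw [e]; linarith [hε.1])
  · right
    refine ⟨u, inner ℝ u x, hu.1, ?_⟩
    ext y
    simp only [mem_ofPred_eq]
    constructor
    · intro hy
      have h1 := hu.2 y hy
      rw [hval] at h1
      linarith
    · intro h1
      rw [not_bddAbove_iff] at hbd
      obtain ⟨_, ⟨w, hw, rfl⟩, hyw⟩ := hbd (inner ℝ u (y - x))
      exact hdown w hw y (by rw [hval]; linarith) hyw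

/-- The curvature at a single boundary point decides: a positive one gives a disk, zero gives a
boundary line. -/
lemma AllIntersections.classification {K L : Set Plane}
    (H : AllIntersections AdmitsNontrivialCongruence K L) (hK : IsProperClosedConvex K)
    (hL : IsProperClosedConvex L) : IsCircle K ∨ IsParallelStrip K ∨ IsHalfPlane K := by
  have hloc : ∀ x ∈ K, ∀ u, IsInnerNormal K x u → ∃ κ, 0 ≤ κ ∧ HasCurvatureAt K x u κ :=
    fun x hx u hu => H.exists_hasCurvatureAt hK hL hx hu
  obtain ⟨x, hx, u, hu, -⟩ := hK.exists_smooth_point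
  obtain ⟨κ, hκ, h⟩ := hloc x hx u hu
  rcases hκ.eq_or_lt with rfl | hκ
  · right
    have hΓ : ∀ z, (0 : ℝ) * ‖z - x‖ ^ 2 = 2 * inner ℝ u (z - x) ↔ inner ℝ u z = inner ℝ u x := by
      intro z
      rw [inner_sub_right]
      constructor <;> intro <;> linarith
    have hconn : IsPreconnected {z | (0 : ℝ) * ‖z - x‖ ^ 2 = 2 * inner ℝ u (z - x)} := by
      simp only [hΓ]
      exact (convex_hyperplane (innerₛₗ ℝ u).isLinear _).isPreconnected
    have hnear := eventually_mem_iff_of_isPreconnected hK hloc hκ hu.1 h hconn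
    refine isParallelStrip_or_isHalfPlane_of_line_subset hK hu fun z hz => ?_
    have hz' : (0 : ℝ) * ‖z - x‖ ^ 2 = 2 * inner ℝ u (z - x) := by rw [hz]; ring
    exact (hnear z hz').self_of_nhds.2 hz'.le
  · exact Or.inl (isCircle_of_hasCurvatureAt hK hloc hκ hu.1 h)

/-! ### Reflections -/

/-- The reflection in the line through `o` with unit direction `e`. -/
noncomputable def Plane.mirror (o e z : Plane) : Plane := o + (2 * inner ℝ e (z - o)) • e - (z - o)

lemma reflection_eq_mirror (l : AffineSubspace ℝ Plane) [Nonempty l] {o e : Plane} (ho : o ∈ l)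
    (he : ‖e‖ = 1) (hl : l.direction = Submodule.span ℝ {e}) (z : Plane) :
    EuclideanGeometry.reflection l z = Plane.mirror o e z := by
  rw [EuclideanGeometry.reflection_apply_of_mem l z ho]
  have h : l.direction.reflection (z - o) = (Submodule.span ℝ {e}).reflection (z - o) := by
    simp only [Submodule.reflection_apply, hl]
  rw [vsub_eq_sub, h, Submodule.reflection_singleton_apply, he, vadd_eq_add, Plane.mirror]
  simp only [RCLike.ofReal_real_eq_id, id, one_pow, div_one]
  module

lemma Plane.mirror_mirror {o e : Plane} (he : ‖e‖ = 1) (z : Plane) :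
    Plane.mirror o e (Plane.mirror o e z) = z := by
  have hee : inner ℝ e e = (1 : ℝ) := by rw [real_inner_self_eq_norm_sq, he]; norm_num
  have h : inner ℝ e (Plane.mirror o e z - o) = inner ℝ e (z - o) := by
    have : Plane.mirror o e z - o = (2 * inner ℝ e (z - o)) • e - (z - o) := by
      rw [Plane.mirror]; abel
    rw [this, inner_sub_right, inner_smul_right, hee]; ring
  rw [Plane.mirror, h, Plane.mirror]
  abel

lemma isAxiallySymmetric_of_mirror {M : Set Plane} {o e : Plane} (he : ‖e‖ = 1)
    (h : ∀ z ∈ M, Plane.mirror o e z ∈ M) : IsAxiallySymmetric M := by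
  have he0 : e ≠ 0 := by rintro rfl; simp at he
  have hd : (AffineSubspace.mk' o (Submodule.span ℝ {e})).direction = Submodule.span ℝ {e} :=
    AffineSubspace.direction_mk' _ _
  have ho : o ∈ AffineSubspace.mk' o (Submodule.span ℝ {e}) := AffineSubspace.self_mem_mk' _ _
  refine ⟨AffineSubspace.mk' o (Submodule.span ℝ {e}), ⟨⟨o, ho⟩⟩, ?_, ?_⟩
  · rw [hd]; exact finrank_span_singleton he0
  · have : Nonempty (AffineSubspace.mk' o (Submodule.span ℝ {e})) := ⟨⟨o, ho⟩⟩
    have hr := reflection_eq_mirror _ ho he hd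
    apply Subset.antisymm
    · rintro _ ⟨z, hz, rfl⟩
      rw [hr]
      exact h z hz
    · intro z hz
      exact ⟨_, h z hz, by rw [hr, Plane.mirror_mirror he]⟩

lemma IsAxiallySymmetric.exists_mirror {M : Set Plane} (h : IsAxiallySymmetric M) :
    ∃ o e : Plane, ‖e‖ = 1 ∧ ∀ z ∈ M, Plane.mirror o e z ∈ M := by
  obtain ⟨l, hne, hd, hM⟩ := h
  obtain ⟨⟨v, hv⟩, hv0, hspan⟩ := finrank_eq_one_iff'.1 hd
  obtain ⟨⟨o, ho⟩⟩ := id hne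
  have hv0' : v ≠ 0 := fun h => hv0 (Subtype.ext h)
  have hn : ‖v‖ ≠ 0 := norm_ne_zero_iff.2 hv0'
  have he : ‖(‖v‖⁻¹ • v)‖ = 1 := by rw [norm_smul, norm_inv, norm_norm, inv_mul_cancel₀ hn]
  refine ⟨o, ‖v‖⁻¹ • v, he, fun z hz => ?_⟩
  have hdir : l.direction = Submodule.span ℝ {‖v‖⁻¹ • v} := by
    apply le_antisymm
    · intro w hw
      obtain ⟨c, hc⟩ := hspan ⟨w, hw⟩
      have hc' : c • v = w := congrArg Subtype.val hc
      refine Submodule.mem_span_singleton.2 ⟨c * ‖v‖, ?_⟩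
      rw [smul_smul, mul_assoc, mul_inv_cancel₀ hn, mul_one, hc']
    · rw [Submodule.span_singleton_le_iff_mem]
      exact l.direction.smul_mem _ hv
  rw [← reflection_eq_mirror l ho he hdir, ← hM]
  exact mem_image_of_mem _ (by exact hz)

lemma IsAxiallySymmetric.admitsNontrivialCongruence {M : Set Plane} (h : IsAxiallySymmetric M) :
    AdmitsNontrivialCongruence M := by
  obtain ⟨l, hne, hd, hM⟩ := h
  refine ⟨EuclideanGeometry.reflection l, fun hr => ?_, hM⟩
  have htop : l = ⊤ := by
    refine SetLike.coe_injective (eq_univ_of_forall fun z => ?_)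
    exact (EuclideanGeometry.reflection_eq_self_iff z).1 (by rw [hr]; rfl)
  rw [htop, AffineSubspace.direction_top, finrank_top] at hd
  simp at hd

lemma IsCentrallySymmetric.admitsNontrivialCongruence {M : Set Plane} (h : IsCentrallySymmetric M) :
    AdmitsNontrivialCongruence M := by
  obtain ⟨c, hM⟩ := h
  refine ⟨_, fun hr => ?_, hM⟩
  have h1 : AffineIsometryEquiv.pointReflection ℝ c (c + !₂[1, 0]) = c + !₂[1, 0] := by rw [hr]; rfl
  rw [AffineIsometryEquiv.pointReflection_apply] at h1
  have h2 := congrArg (fun w : Plane => w 0) h1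
  simp at h2
  linarith

lemma isCentrallySymmetric_iff {M : Set Plane} :
    IsCentrallySymmetric M ↔ ∃ c : Plane, ∀ z ∈ M, (2 : ℝ) • c - z ∈ M := by
  have hp : ∀ c z : Plane, AffineIsometryEquiv.pointReflection ℝ c z = (2 : ℝ) • c - z := by
    intro c z
    rw [AffineIsometryEquiv.pointReflection_apply, vsub_eq_sub, vadd_eq_add]
    module
  constructor
  · rintro ⟨c, hM⟩
    refine ⟨c, fun z hz => ?_⟩
    rw [← hp, ← hM]
    exact mem_image_of_mem _ hz
  · rintro ⟨c, h⟩
    refine ⟨c, Subset.antisymm ?_ ?_⟩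
    · rintro _ ⟨z, hz, rfl⟩
      rw [hp]
      exact h z hz
    · intro z hz
      exact ⟨_, h z hz, by rw [hp]; abel⟩

/-! ### Images of disks, strips and half-planes -/

/-- The strip `a ≤ ⟨u, x⟩ ≤ b`. -/
def strip (u : Plane) (a b : ℝ) : Set Plane := {x | a ≤ inner ℝ u x ∧ inner ℝ u x ≤ b}

/-- The half-plane `a ≤ ⟨u, x⟩`. -/
def halfPlane (u : Plane) (a : ℝ) : Set Plane := {x | a ≤ inner ℝ u x}

lemma AffineIsometryEquiv.inner_symm (φ : Plane ≃ᵃⁱ[ℝ] Plane) (u z : Plane) :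
    inner ℝ u (φ.symm z) = inner ℝ (φ.linearIsometryEquiv u) z - inner ℝ (φ.linearIsometryEquiv u) (φ 0) := by
  have := φ.inner_linear_sub u (φ.symm z) 0
  rw [AffineIsometryEquiv.apply_symm_apply, sub_zero, inner_sub_right] at this
  exact this.symm

lemma AffineIsometryEquiv.image_strip (φ : Plane ≃ᵃⁱ[ℝ] Plane) (u : Plane) (a b : ℝ) :
    ∃ d, φ '' strip u a b = strip (φ.linearIsometryEquiv u) (a + d) (b + d) := by
  refine ⟨inner ℝ (φ.linearIsometryEquiv u) (φ 0), ?_⟩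
  ext z
  rw [AffineIsometryEquiv.mem_image_iff]
  simp only [strip, mem_ofPred_eq, φ.inner_symm]
  constructor <;> rintro ⟨h1, h2⟩ <;> constructor <;> linarith

lemma AffineIsometryEquiv.image_halfPlane (φ : Plane ≃ᵃⁱ[ℝ] Plane) (u : Plane) (a : ℝ) :
    ∃ d, φ '' halfPlane u a = halfPlane (φ.linearIsometryEquiv u) (a + d) := by
  refine ⟨inner ℝ (φ.linearIsometryEquiv u) (φ 0), ?_⟩
  ext z
  rw [AffineIsometryEquiv.mem_image_iff]
  simp only [halfPlane, mem_ofPred_eq, φ.inner_symm]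
  constructor <;> intro h1 <;> linarith

lemma AffineIsometryEquiv.image_disk (φ : Plane ≃ᵃⁱ[ℝ] Plane) (c : Plane) (r : ℝ) :
    φ '' Metric.closedBall c r = Metric.closedBall (φ c) r := by
  ext z
  rw [AffineIsometryEquiv.mem_image_iff, Metric.mem_closedBall, Metric.mem_closedBall,
    ← φ.dist_map, AffineIsometryEquiv.apply_symm_apply]

lemma exists_rigid_inner {u v : Plane} (hu : ‖u‖ = 1) (hv : ‖v‖ = 1) (d : ℝ) :
    ∃ φ : Plane ≃ᵃⁱ[ℝ] Plane, OrientationPreserving φ ∧ ∀ z, inner ℝ u (φ.symm z) = inner ℝ v z + d := by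
  obtain ⟨φ, hφ, h0, hlin⟩ := exists_rigid_normalize (d • u) hu hv
  refine ⟨φ, hφ, fun z => ?_⟩
  have := φ.inner_linear_sub u (φ.symm z) (d • u)
  rw [AffineIsometryEquiv.apply_symm_apply, h0, hlin, sub_zero, inner_sub_right, inner_smul_right,
    real_inner_self_eq_norm_sq, hu] at this
  linarith

lemma exists_image_strip {u v : Plane} (hu : ‖u‖ = 1) (hv : ‖v‖ = 1) (a b s : ℝ) :
    ∃ φ : Plane ≃ᵃⁱ[ℝ] Plane, OrientationPreserving φ ∧ φ '' strip u a b = strip v s (s + (b - a)) := by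
  obtain ⟨φ, hφ, h⟩ := exists_rigid_inner hu hv (a - s)
  refine ⟨φ, hφ, ?_⟩
  ext z
  rw [AffineIsometryEquiv.mem_image_iff]
  simp only [strip, mem_ofPred_eq, h]
  constructor <;> rintro ⟨h1, h2⟩ <;> constructor <;> linarith

lemma exists_image_halfPlane {u v : Plane} (hu : ‖u‖ = 1) (hv : ‖v‖ = 1) (a s : ℝ) :
    ∃ φ : Plane ≃ᵃⁱ[ℝ] Plane, OrientationPreserving φ ∧ φ '' halfPlane u a = halfPlane v s := by
  obtain ⟨φ, hφ, h⟩ := exists_rigid_inner hu hv (a - s)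
  refine ⟨φ, hφ, ?_⟩
  ext z
  rw [AffineIsometryEquiv.mem_image_iff]
  simp only [halfPlane, mem_ofPred_eq, h]
  constructor <;> intro h1 <;> linarith

lemma exists_image_disk (c d : Plane) (r : ℝ) :
    ∃ φ : Plane ≃ᵃⁱ[ℝ] Plane, OrientationPreserving φ ∧
      φ '' Metric.closedBall c r = Metric.closedBall d r := by
  obtain ⟨φ, hφ, h⟩ := exists_rigid_translation (d - c)
  exact ⟨φ, hφ, by rw [φ.image_disk, h]; congr 1; abel⟩

/-! ### Symmetric intersections -/

lemma Plane.exists_unit_smul (y : Plane) : ∃ e : Plane, ‖e‖ = 1 ∧ y = ‖y‖ • e := by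
  by_cases hy : y = 0
  · refine ⟨!₂[1, 0], ?_, by simp [hy]⟩
    rw [Plane.norm_eq_one_iff]; simp
  · have hn : ‖y‖ ≠ 0 := norm_ne_zero_iff.2 hy
    refine ⟨‖y‖⁻¹ • y, ?_, ?_⟩
    · rw [norm_smul, norm_inv, norm_norm, inv_mul_cancel₀ hn]
    · rw [smul_smul, mul_inv_cancel₀ hn, one_smul]

lemma Plane.norm_mirror_sub {o e : Plane} (he : ‖e‖ = 1) (t : ℝ) (z : Plane) :
    ‖Plane.mirror o e z - (o + t • e)‖ = ‖z - (o + t • e)‖ := by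
  rw [Plane.norm_eq_one_iff] at he
  rw [← sq_eq_sq₀ (norm_nonneg _) (norm_nonneg _), Plane.norm_sq_eq, Plane.norm_sq_eq]
  simp only [Plane.mirror, Plane.inner_eq, PiLp.sub_apply, PiLp.add_apply, PiLp.smul_apply, smul_eq_mul]
  linear_combination (4 * (e 0 * (z 0 - o 0) + e 1 * (z 1 - o 1)) ^ 2 -
    4 * t * (e 0 * (z 0 - o 0) + e 1 * (z 1 - o 1))) * he

lemma Plane.inner_mirror (u o e z : Plane) : inner ℝ u (Plane.mirror o e z) =
    inner ℝ u o + 2 * inner ℝ e (z - o) * inner ℝ u e - inner ℝ u (z - o) := by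
  rw [Plane.mirror, inner_sub_right, inner_add_right, inner_smul_right]

lemma Plane.inner_mirror_self {o e : Plane} (he : ‖e‖ = 1) (z : Plane) :
    inner ℝ e (Plane.mirror o e z) = inner ℝ e z := by
  rw [Plane.inner_mirror, real_inner_self_eq_norm_sq, he, inner_sub_right]; ring

lemma isAxiallySymmetric_disk_inter_disk (c d : Plane) (r s : ℝ) :
    IsAxiallySymmetric (Metric.closedBall c r ∩ Metric.closedBall d s) := by
  obtain ⟨e, he, hde⟩ := Plane.exists_unit_smul (d - c)
  refine isAxiallySymmetric_of_mirror (o := c) he ?_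
  rintro z ⟨h1, h2⟩
  rw [mem_closedBall_iff_norm] at h1 h2
  have hc : c = c + (0 : ℝ) • e := by simp
  have hd : d = c + ‖d - c‖ • e := by rw [← hde]; abel
  refine ⟨mem_closedBall_iff_norm.2 ?_, mem_closedBall_iff_norm.2 ?_⟩
  · have := Plane.norm_mirror_sub (o := c) he 0 z
    rw [← hc] at this
    rwa [this]
  · have := Plane.norm_mirror_sub (o := c) he ‖d - c‖ z
    rw [← hd] at this
    rwa [this]

lemma isAxiallySymmetric_disk_inter {u : Plane} (hu : ‖u‖ = 1) (c : Plane) (r : ℝ) {S : Set Plane}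
    {T : Set ℝ} (hS : ∀ z, z ∈ S ↔ inner ℝ u z ∈ T) :
    IsAxiallySymmetric (Metric.closedBall c r ∩ S) := by
  refine isAxiallySymmetric_of_mirror (o := c) hu ?_
  rintro z ⟨h1, h2⟩
  rw [mem_closedBall_iff_norm] at h1
  refine ⟨mem_closedBall_iff_norm.2 ?_, ?_⟩
  · have := Plane.norm_mirror_sub (o := c) hu 0 z
    rw [zero_smul, add_zero] at this
    rwa [this]
  · rwa [hS, Plane.inner_mirror_self hu, ← hS]

lemma isCentrallySymmetric_disk_inter_disk (c d : Plane) (r : ℝ) :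
    IsCentrallySymmetric (Metric.closedBall c r ∩ Metric.closedBall d r) := by
  refine isCentrallySymmetric_iff.2 ⟨(1 / 2 : ℝ) • (c + d), ?_⟩
  rintro z ⟨h1, h2⟩
  rw [mem_closedBall_iff_norm] at h1 h2
  refine ⟨mem_closedBall_iff_norm.2 ?_, mem_closedBall_iff_norm.2 ?_⟩
  · have : (2 : ℝ) • (1 / 2 : ℝ) • (c + d) - z - c = -(z - d) := by module
    rwa [this, norm_neg]
  · have : (2 : ℝ) • (1 / 2 : ℝ) • (c + d) - z - d = -(z - c) := by module
    rwa [this, norm_neg]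

/-- Two linear forms of norm one differ by a sign, or are interchanged by a reflection. -/
lemma exists_mirror_swap {u v : Plane} (hu : ‖u‖ = 1) (hv : ‖v‖ = 1) (m n : ℝ) :
    (v = u ∨ v = -u) ∨ ∃ o e : Plane, ‖e‖ = 1 ∧ ∀ z,
      inner ℝ u (Plane.mirror o e z) - m = inner ℝ v z - n ∧
      inner ℝ v (Plane.mirror o e z) - n = inner ℝ u z - m := by
  by_cases h1 : v = u
  · exact Or.inl (Or.inl h1)
  by_cases h2 : v = -u
  · exact Or.inl (Or.inr h2)
  right
  have huu : inner ℝ u u = (1 : ℝ) := by rw [real_inner_self_eq_norm_sq, hu]; norm_num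
  have hvv : inner ℝ v v = (1 : ℝ) := by rw [real_inner_self_eq_norm_sq, hv]; norm_num
  have hvu : inner ℝ v u = inner ℝ u v := real_inner_comm _ _
  set p : ℝ := inner ℝ u v with hp
  have hp1 : p < 1 := (inner_lt_one_iff_real_of_norm_eq_one hu hv).2 (Ne.symm h1)
  have hp2 : 0 < 1 + p := by
    have := (inner_lt_one_iff_real_of_norm_eq_one (x := u) (y := -v) hu (by rwa [norm_neg])).2
      (fun h => h2 (by rw [h, neg_neg]))
    rw [inner_neg_right] at this
    linarith
  have hn2 : ‖u + v‖ ^ 2 = 2 * (1 + p) := by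
    rw [norm_add_sq_real, hu, hv, ← hp]; ring
  have hn : ‖u + v‖ ≠ 0 := fun h => by rw [h] at hn2; norm_num at hn2; linarith
  obtain ⟨e, he, hue⟩ := Plane.exists_unit_smul (u + v)
  set k := ‖u + v‖
  -- The axis is the bisector on which the two affine forms `⟨u, z⟩ - m` and `⟨v, z⟩ - n` agree: it
  -- has direction `u + v`, and this point of it is the one that is a multiple of `u - v`.
  refine ⟨((m - n) / (2 * (1 - p))) • (u - v), e, he, fun z => ?_⟩
  set o : Plane := ((m - n) / (2 * (1 - p))) • (u - v) with ho
  have hp0 : 1 - p ≠ 0 := by linarith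
  have io : inner ℝ u o - inner ℝ v o = m - n := by
    rw [ho, inner_smul_right, inner_smul_right, inner_sub_right, inner_sub_right, huu, hvv, hvu, ← hp]
    field_simp; ring
  have hke : ∀ w : Plane, k * inner ℝ e w = inner ℝ u w + inner ℝ v w := fun w => by
    rw [← inner_add_left, hue, inner_smul_left]; rfl
  have ku := hke u
  have kv := hke v
  rw [huu, hvu, real_inner_comm] at ku
  rw [hvv, ← hp, real_inner_comm] at kv
  have kz := hke (z - o)
  have key : ∀ a : ℝ, k * a = 1 + p → 2 * inner ℝ e (z - o) * a = inner ℝ u (z - o) + inner ℝ v (z - o) := by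
    intro a ha
    have h3 : k ^ 2 * (2 * inner ℝ e (z - o) * a) = k ^ 2 * (inner ℝ u (z - o) + inner ℝ v (z - o)) := by
      rw [hn2]
      have : k ^ 2 * (2 * inner ℝ e (z - o) * a) = 2 * (k * inner ℝ e (z - o)) * (k * a) := by ring
      rw [← hn2, this, kz, ha, hn2]; ring
    exact mul_left_cancel₀ (pow_ne_zero 2 hn) h3
  rw [Plane.inner_mirror, Plane.inner_mirror, key _ ku, key _ (by linarith), inner_sub_right, inner_sub_right]
  constructor <;> linarith

lemma isAxiallySymmetric_halfPlane_inter_halfPlane {u v : Plane} (hu : ‖u‖ = 1) (hv : ‖v‖ = 1) (a b : ℝ) :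
    IsAxiallySymmetric (halfPlane u a ∩ halfPlane v b) := by
  rcases exists_mirror_swap hu hv a b with h | ⟨o, e, he, h⟩
  · refine isAxiallySymmetric_of_mirror (o := 0) hu ?_
    rintro z ⟨h1, h2⟩
    have hz := Plane.inner_mirror_self (o := 0) hu z
    rcases h with rfl | rfl
    · simp only [halfPlane, mem_inter_iff, mem_ofPred_eq, hz] at *
      exact ⟨h1, h2⟩
    · simp only [halfPlane, mem_inter_iff, mem_ofPred_eq, inner_neg_left, hz] at *
      exact ⟨h1, h2⟩
  · refine isAxiallySymmetric_of_mirror (o := o) he ?_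
    rintro z ⟨h1, h2⟩
    have hz := h z
    simp only [halfPlane, mem_inter_iff, mem_ofPred_eq] at *
    constructor <;> linarith

lemma isAxiallySymmetric_strip_inter_strip {u v : Plane} (hu : ‖u‖ = 1) (hv : ‖v‖ = 1) (a b w : ℝ) :
    IsAxiallySymmetric (strip u a (a + w) ∩ strip v b (b + w)) := by
  rcases exists_mirror_swap hu hv a b with h | ⟨o, e, he, h⟩
  · refine isAxiallySymmetric_of_mirror (o := 0) hu ?_
    rintro z ⟨h1, h2⟩
    have hz := Plane.inner_mirror_self (o := 0) hu z
    rcases h with rfl | rfl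
    · simp only [strip, mem_inter_iff, mem_ofPred_eq, hz] at *
      exact ⟨h1, h2⟩
    · simp only [strip, mem_inter_iff, mem_ofPred_eq, inner_neg_left, hz] at *
      exact ⟨h1, h2⟩
  · refine isAxiallySymmetric_of_mirror (o := o) he ?_
    rintro z ⟨h1, h2⟩
    have hz := h z
    simp only [strip, mem_inter_iff, mem_ofPred_eq] at *
    refine ⟨⟨?_, ?_⟩, ?_, ?_⟩ <;> linarith [h1.1, h1.2, h2.1, h2.2]

/-- The centre is the intersection of the two midlines. If the strips are parallel, their
intersection is contained in a single strip bounded by `max` and `min`, and any point of its midline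
serves. -/
lemma isCentrallySymmetric_strip_inter_strip {u v : Plane} (hu : ‖u‖ = 1) (hv : ‖v‖ = 1) (a b c d : ℝ) :
    IsCentrallySymmetric (strip u a b ∩ strip v c d) := by
  rw [isCentrallySymmetric_iff]
  have huu : inner ℝ u u = (1 : ℝ) := by rw [real_inner_self_eq_norm_sq, hu]; norm_num
  by_cases h : v = u ∨ v = -u
  · obtain ⟨c', d', h'⟩ : ∃ c' d', strip v c d = strip u c' d' := by
      rcases h with rfl | rfl
      · exact ⟨c, d, rfl⟩
      · refine ⟨-d, -c, ?_⟩
        ext z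
        simp only [strip, mem_ofPred_eq, inner_neg_left]
        constructor <;> rintro ⟨h1, h2⟩ <;> constructor <;> linarith
    refine ⟨((max a c' + min b d') / 2) • u, ?_⟩
    rw [h']
    rintro z ⟨⟨h1, h2⟩, h3, h4⟩
    have h5 := max_le h1 h3
    have h6 := le_min h2 h4
    have e : inner ℝ u ((2 : ℝ) • ((max a c' + min b d') / 2) • u - z) = max a c' + min b d' - inner ℝ u z := by
      rw [inner_sub_right, inner_smul_right, inner_smul_right, huu]; ring
    simp only [strip, mem_inter_iff, mem_ofPred_eq, e]
    refine ⟨⟨?_, ?_⟩, ?_, ?_⟩ <;>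
      linarith [le_max_left a c', le_max_right a c', min_le_left b d', min_le_right b d']
  · have hdet : u 0 * v 1 - u 1 * v 0 ≠ 0 := by
      intro h0
      refine h ?_
      rw [Plane.norm_eq_one_iff] at hu hv
      set p := u 0 * v 0 + u 1 * v 1 with hp
      have hp2 : p ^ 2 = 1 := by
        linear_combination (v 0 ^ 2 + v 1 ^ 2) * hu + hv - (u 0 * v 1 - u 1 * v 0) * h0
      have e0 : v 0 = p * u 0 := by linear_combination u 1 * -h0 - v 0 * hu
      have e1 : v 1 = p * u 1 := by linear_combination u 0 * h0 - v 1 * hu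
      rcases sq_eq_one_iff.1 hp2 with h | h
      · left; apply Plane.ext
        · rw [e0, h, one_mul]
        · rw [e1, h, one_mul]
      · right; apply Plane.ext
        · rw [e0, h]; simp
        · rw [e1, h]; simp
    set o : Plane := (u 0 * v 1 - u 1 * v 0)⁻¹ • !₂[(a + b) / 2 * v 1 - u 1 * ((c + d) / 2),
      u 0 * ((c + d) / 2) - (a + b) / 2 * v 0] with ho
    have iu : inner ℝ u o = (a + b) / 2 := by
      rw [ho, inner_smul_right, Plane.inner_eq, inv_mul_eq_iff_eq_mul₀ hdet]
      simp only [Matrix.cons_val_zero, Matrix.cons_val_one]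
      ring
    have iv : inner ℝ v o = (c + d) / 2 := by
      rw [ho, inner_smul_right, Plane.inner_eq, inv_mul_eq_iff_eq_mul₀ hdet]
      simp only [Matrix.cons_val_zero, Matrix.cons_val_one]
      ring
    refine ⟨o, ?_⟩
    rintro z ⟨⟨h1, h2⟩, h3, h4⟩
    simp only [strip, mem_inter_iff, mem_ofPred_eq, inner_sub_right, inner_smul_right, iu, iv]
    refine ⟨⟨?_, ?_⟩, ?_, ?_⟩ <;> linarith

/-! ### Intersections without symmetry -/

lemma convex_strip (u : Plane) (a b : ℝ) : Convex ℝ (strip u a b) :=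
  (convex_halfSpace_ge (innerₛₗ ℝ u).isLinear a).inter (convex_halfSpace_le (innerₛₗ ℝ u).isLinear b)

lemma convex_halfPlane (u : Plane) (a : ℝ) : Convex ℝ (halfPlane u a) :=
  convex_halfSpace_ge (innerₛₗ ℝ u).isLinear a

lemma Plane.norm_e₂ : ‖(!₂[0, 1] : Plane)‖ = 1 := by rw [Plane.norm_eq_one_iff]; simp

lemma Plane.norm_diag : ‖(!₂[1 / √2, -1 / √2] : Plane)‖ = 1 := by
  rw [Plane.norm_eq_one_iff]
  have := Real.sq_sqrt (show (0 : ℝ) ≤ 2 by norm_num)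
  simp only [Matrix.cons_val_zero, Matrix.cons_val_one]
  rw [div_pow, div_pow, this]; norm_num

lemma mem_strip_e₂ {a b : ℝ} {z : Plane} : z ∈ strip !₂[0, 1] a b ↔ a ≤ z 1 ∧ z 1 ≤ b := by
  simp [strip, Plane.inner_eq]

lemma mem_halfPlane_e₂ {a : ℝ} {z : Plane} : z ∈ halfPlane !₂[0, 1] a ↔ a ≤ z 1 := by
  simp [halfPlane, Plane.inner_eq]

lemma mem_halfPlane_e₁ {a : ℝ} {z : Plane} : z ∈ halfPlane !₂[1, 0] a ↔ a ≤ z 0 := by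
  simp [halfPlane, Plane.inner_eq]

lemma inner_diag (z : Plane) : inner ℝ (!₂[1 / √2, -1 / √2] : Plane) z = (z 0 - z 1) / √2 := by
  rw [Plane.inner_eq]; simp only [Matrix.cons_val_zero, Matrix.cons_val_one]; ring

lemma mem_halfPlane_diag {z : Plane} : z ∈ halfPlane !₂[1 / √2, -1 / √2] 0 ↔ z 1 ≤ z 0 := by
  have h2 : 0 < √(2 : ℝ) := by positivity
  rw [halfPlane, mem_ofPred_eq, inner_diag, le_div_iff₀ h2]
  constructor <;> intro <;> linarith

lemma mem_strip_diag {a : ℝ} {z : Plane} :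
    z ∈ strip !₂[1 / √2, -1 / √2] 0 a ↔ z 1 ≤ z 0 ∧ z 0 - z 1 ≤ a * √2 := by
  have h2 : 0 < √(2 : ℝ) := by positivity
  rw [strip, mem_ofPred_eq, inner_diag, le_div_iff₀ h2, div_le_iff₀ h2]
  constructor <;> rintro ⟨h, h'⟩ <;> constructor <;> linarith

lemma mem_disk_iff {c z : Plane} {r : ℝ} (hr : 0 ≤ r) :
    z ∈ Metric.closedBall c r ↔ (z 0 - c 0) ^ 2 + (z 1 - c 1) ^ 2 ≤ r ^ 2 := by
  rw [mem_closedBall_iff_norm, ← sq_le_sq₀ (norm_nonneg _) hr, Plane.norm_sq_eq]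
  simp

/-- The half-strip has one direction of unbounded rays, which a symmetry must keep. What remains is
a possible reflection across the strip, and that would exchange the end corners of `45°` and `135°`.
-/
lemma not_admitsNontrivialCongruence_strip_inter_halfPlane {w : ℝ} (hw : 0 < w) {M : Set Plane}
    (hM : ∀ z, z ∈ M ↔ (0 ≤ z 1 ∧ z 1 ≤ w) ∧ z 1 ≤ z 0) : ¬ AdmitsNontrivialCongruence M := by
  rintro ⟨χ, hχ, hχM⟩
  rw [AffineIsometryEquiv.image_eq_self_iff] at hχM
  refine hχ ?_
  set A := χ.linearIsometryEquiv with hA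
  have hAz : ∀ z : Plane, χ z = z 0 • A !₂[1, 0] + z 1 • A !₂[0, 1] + χ 0 := by
    intro z
    rw [χ.apply_eq z, ← map_smul, ← map_smul, ← map_add]
    congr 2
    apply Plane.ext <;> simp
  have n1 : ‖A !₂[1, 0]‖ = 1 := by
    rw [LinearIsometryEquiv.norm_map, Plane.norm_eq_one_iff]; simp
  have n2 : ‖A !₂[0, 1]‖ = 1 := by
    rw [LinearIsometryEquiv.norm_map, Plane.norm_eq_one_iff]; simp
  have n3 : inner ℝ (A !₂[1, 0]) (A !₂[0, 1]) = (0 : ℝ) := by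
    rw [LinearIsometryEquiv.inner_map_map, Plane.inner_eq]; simp
  rw [Plane.norm_eq_one_iff] at n1 n2
  rw [Plane.inner_eq] at n3
  set p := A !₂[1, 0]
  set q := A !₂[0, 1]
  set b := χ 0 with hb
  have h : ∀ x y : ℝ, (0 ≤ y ∧ y ≤ w) ∧ y ≤ x ↔
      (0 ≤ x * p 1 + y * q 1 + b 1 ∧ x * p 1 + y * q 1 + b 1 ≤ w) ∧
        x * p 1 + y * q 1 + b 1 ≤ x * p 0 + y * q 0 + b 0 := by
    intro x y
    have := hχM !₂[x, y]
    rw [hM, hM, hAz] at this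
    simpa using this.symm
  have h00 := (h 0 0).1 ⟨⟨le_rfl, hw.le⟩, le_rfl⟩
  have hww := (h w w).1 ⟨⟨hw.le, le_rfl⟩, le_rfl⟩
  simp only [zero_mul, zero_add] at h00
  have hp1 : p 1 = 0 := by
    by_contra hne
    rcases lt_or_gt_of_ne hne with hlt | hlt
    · have h1 := ((h ((w + 1) / (-p 1)) 0).1 ⟨⟨le_rfl, hw.le⟩,
        div_nonneg (by linarith) (by linarith)⟩).1.1
      have e : (w + 1) / (-p 1) * p 1 = -(w + 1) := by field_simp
      rw [e] at h1
      linarith [h00.1.2]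
    · have h1 := ((h ((w + 1) / p 1) 0).1 ⟨⟨le_rfl, hw.le⟩,
        div_nonneg (by linarith) (by linarith)⟩).1.2
      rw [div_mul_cancel₀ _ hne] at h1
      linarith [h00.1.1]
  rw [hp1] at n1 n3 h hww
  have hp0 : p 0 = 1 := by
    have : p 0 ^ 2 = 1 := by linarith
    rcases sq_eq_one_iff.1 this with h1 | h1
    · exact h1
    · have h2 := (h (|b 0| + 1) 0).1 ⟨⟨le_rfl, hw.le⟩, by positivity⟩
      rw [h1] at h2
      linarith [le_abs_self (b 0), h2.1.1, h2.2]
  have hq0 : q 0 = 0 := by rw [hp0] at n3; linarith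
  have hq1 : q 1 ^ 2 = 1 := by rw [hq0] at n2; linarith
  rw [hp0, hq0] at h hww
  rcases sq_eq_one_iff.1 hq1 with h1 | h1
  · rw [h1] at h hww
    have hb1 : b 1 = 0 := by linarith [h00.1.1, hww.1.2]
    have hb0 : b 0 = 0 := by
      have h2 := ((h (-b 0) 0).2 ⟨⟨by linarith, by linarith⟩, by linarith⟩).2
      linarith [h00.2]
    ext1 z
    rw [hAz, AffineIsometryEquiv.coe_refl, id]
    apply Plane.ext
    · simp [hp0, hq0, hb0]
    · simp [hp1, h1, hb1]
  · rw [h1] at h hww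
    have h2 := ((h (-b 0) w).2 ⟨⟨by linarith [hww.1.1], by linarith [h00.1.2]⟩, by linarith [h00.1.2]⟩).2
    linarith [h00.2, hww.1.1]

/-- The image of the top `(0, R)` has height at least `R - ε`, so the images of `(±ε, R - ε)` have
height at least `R`. Both would have to be the top itself, though they are different. -/
lemma not_isCentrallySymmetric_cap {R ε : ℝ} (hε : 0 < ε) (hεR : ε ≤ R) {M : Set Plane}
    (hM : ∀ z : Plane, z ∈ M ↔ z 0 ^ 2 + z 1 ^ 2 ≤ R ^ 2 ∧ R - ε ≤ z 1) : ¬ IsCentrallySymmetric M := by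
  rw [isCentrallySymmetric_iff]
  rintro ⟨c, h⟩
  have h1 := (hM _).1 (h !₂[0, R] ((hM _).2 (by simp; linarith)))
  have h2 := (hM _).1 (h !₂[ε, R - ε] ((hM _).2 (by simp; nlinarith)))
  have h3 := (hM _).1 (h !₂[-ε, R - ε] ((hM _).2 (by simp; nlinarith)))
  simp at h1 h2 h3
  nlinarith [sq_nonneg (2 * c 0 - ε), sq_nonneg (2 * c 0 + ε)]

lemma not_isCentrallySymmetric_quadrant {M : Set Plane}
    (hM : ∀ z : Plane, z ∈ M ↔ 0 ≤ z 0 ∧ 0 ≤ z 1) : ¬ IsCentrallySymmetric M := by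
  rw [isCentrallySymmetric_iff]
  rintro ⟨c, h⟩
  have h1 := (hM _).1 (h !₂[|2 * c 0| + 1, 0] ((hM _).2 (by simp; positivity)))
  simp at h1
  linarith [h1.1, le_abs_self (c 0)]

/-- Since `D ^ 2 + r ^ 2 = R ^ 2`, the vertical diameter of the small disk is a chord of the large
circle. It forces the centre to have abscissa `D`, and then the image of `(D - r, 0)` has abscissa
`D + r > R`. -/
lemma not_isCentrallySymmetric_lens {r R D : ℝ} (hr : 0 < r) (hD : 0 < D)
    (hD2 : D ^ 2 = R ^ 2 - r ^ 2) {M : Set Plane}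
    (hM : ∀ z : Plane, z ∈ M ↔ z 0 ^ 2 + z 1 ^ 2 ≤ R ^ 2 ∧ (z 0 - D) ^ 2 + z 1 ^ 2 ≤ r ^ 2) :
    ¬ IsCentrallySymmetric M := by
  rw [isCentrallySymmetric_iff]
  rintro ⟨c, h⟩
  have h1 := (hM _).1 (h !₂[D, r] ((hM _).2 (by simp; linarith)))
  have h2 := (hM _).1 (h !₂[D, -r] ((hM _).2 (by simp; linarith)))
  have h3 := (hM _).1 (h !₂[D - r, 0] ((hM _).2 (by simp; nlinarith [mul_pos hr hD])))
  simp at h1 h2 h3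
  have h4 : 2 * c 0 - D - D = 0 := by nlinarith [sq_nonneg (2 * c 0 - D - D), sq_nonneg (2 * c 1)]
  have h5 : 2 * c 0 = 2 * D := by linarith
  rw [h5] at h3
  nlinarith [mul_pos hr hD, sq_nonneg (2 * c 1)]

lemma Plane.mirror_zero (o e z : Plane) : Plane.mirror o e z 0 =
    o 0 + 2 * (e 0 * (z 0 - o 0) + e 1 * (z 1 - o 1)) * e 0 - (z 0 - o 0) := by
  simp [Plane.mirror, Plane.inner_eq]

lemma Plane.mirror_one (o e z : Plane) : Plane.mirror o e z 1 =
    o 1 + 2 * (e 0 * (z 0 - o 0) + e 1 * (z 1 - o 1)) * e 1 - (z 1 - o 1) := by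
  simp [Plane.mirror, Plane.inner_eq]

/-- The long diagonal of the parallelogram `0 ≤ y ≤ w`, `0 ≤ x - y ≤ a` is its only diameter. -/
lemma parallelogram_diameter {w a x y x' y' : ℝ} (hw : 0 < w)
    (h1 : 0 ≤ y) (h2 : y ≤ w) (h3 : y ≤ x) (h4 : x - y ≤ a) (h1' : 0 ≤ y') (h2' : y' ≤ w) (h3' : y' ≤ x')
    (h4' : x' - y' ≤ a) (hd : (x - x') ^ 2 + (y - y') ^ 2 = (a + w) ^ 2 + w ^ 2) :
    (x = 0 ∧ y = 0 ∧ x' = a + w ∧ y' = w) ∨ (x = a + w ∧ y = w ∧ x' = 0 ∧ y' = 0) := by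
  have b1 : (y - y') ^ 2 ≤ w ^ 2 := sq_le_sq' (by linarith) (by linarith)
  have b2 : (x - x') ^ 2 ≤ (a + w) ^ 2 := sq_le_sq' (by linarith) (by linarith)
  have e1 : (y - y') ^ 2 = w ^ 2 := by linarith
  have e2 : (x - x') ^ 2 = (a + w) ^ 2 := by linarith
  rcases sq_eq_sq_iff_eq_or_eq_neg.1 e1 with h | h <;> rcases sq_eq_sq_iff_eq_or_eq_neg.1 e2 with h' | h'
  · right; refine ⟨?_, ?_, ?_, ?_⟩ <;> linarith
  · linarith
  · linarith
  · left; refine ⟨?_, ?_, ?_, ?_⟩ <;> linarith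

/-- A reflection preserves the long diagonal, so its axis is that diagonal or its perpendicular
bisector. The image of the vertex `(a, 0)` then stays in the parallelogram only if `a ^ 2 = 2 * w ^
2`, that is for a rhombus. -/
lemma not_isAxiallySymmetric_parallelogram {w a : ℝ} (hw : 0 < w) (ha : 0 < a) (hne : a ^ 2 ≠ 2 * w ^ 2)
    {M : Set Plane} (hM : ∀ z : Plane, z ∈ M ↔ (0 ≤ z 1 ∧ z 1 ≤ w) ∧ z 1 ≤ z 0 ∧ z 0 - z 1 ≤ a) :
    ¬ IsAxiallySymmetric M := by
  intro hsym
  obtain ⟨o, e, he, h⟩ := hsym.exists_mirror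
  have g0 := (hM _).1 (h !₂[0, 0] ((hM _).2 (by simp; constructor <;> linarith)))
  have gd := (hM _).1 (h !₂[a + w, w] ((hM _).2 (by simp; constructor <;> linarith)))
  have gA := (hM _).1 (h !₂[a, 0] ((hM _).2 (by simp; constructor <;> linarith)))
  rw [Plane.norm_eq_one_iff] at he
  simp only [Plane.mirror_zero, Plane.mirror_one, Matrix.cons_val_zero, Matrix.cons_val_one] at g0 gd gA
  set N := (a + w) ^ 2 + w ^ 2 with hN
  have hNpos : 0 < N := by positivity
  refine hne ?_
  rcases parallelogram_diameter hw g0.1.1 g0.1.2 g0.2.1 g0.2.2 gd.1.1 gd.1.2 gd.2.1 gd.2.2 (by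
    linear_combination 4 * (e 0 * (a + w) + e 1 * w) ^ 2 * he) with ⟨a1, a2, a3, a4⟩ | ⟨a1, a2, a3, a4⟩
  · have k0 : (e 0 * (a + w) + e 1 * w) * e 0 = a + w := by linear_combination (a3 - a1) / 2
    have k1 : (e 0 * (a + w) + e 1 * w) * e 1 = w := by linear_combination (a4 - a2) / 2
    set k := e 0 * (a + w) + e 1 * w with hk
    have hk2 : k ^ 2 = N := by rw [hN]; linear_combination k * hk + (a + w) * k0 + w * k1
    obtain ⟨⟨-, g1⟩, g2, -⟩ := gA
    have q1 : 2 * a * (e 0 * e 1) ≤ w := by linarith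
    have q2 : 2 * a * (e 0 * e 1) ≤ 2 * a * e 0 ^ 2 - a := by linarith
    have m1 : N * (e 0 * e 1) = (a + w) * w := by
      rw [← hk2]; linear_combination k * e 1 * k0 + (a + w) * k1
    have m2 : N * e 0 ^ 2 = (a + w) ^ 2 := by
      rw [← hk2]; linear_combination (k * e 0 + (a + w)) * k0
    have r1 := mul_le_mul_of_nonneg_left q1 hNpos.le
    have r2 := mul_le_mul_of_nonneg_left q2 hNpos.le
    have s1 : w * (2 * a * (a + w)) ≤ w * N := by linear_combination r1 - 2 * a * m1
    have s2 : a * N ≤ a * (2 * a * (a + w)) := by linear_combination r2 - 2 * a * m1 + 2 * a * m2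
    have t1 := le_of_mul_le_mul_left s1 hw
    have t2 := le_of_mul_le_mul_left s2 ha
    linarith
  · have k0 : (e 0 * (a + w) + e 1 * w) * e 0 = 0 := by linear_combination (a3 - a1) / 2
    have k1 : (e 0 * (a + w) + e 1 * w) * e 1 = 0 := by linear_combination (a4 - a2) / 2
    have hk : e 0 * (a + w) + e 1 * w = 0 := by
      linear_combination e 0 * k0 + e 1 * k1 - (e 0 * (a + w) + e 1 * w) * he
    obtain ⟨⟨g1, -⟩, -, g2⟩ := gA
    have q1 : 0 ≤ w + 2 * a * (e 0 * e 1) := by linarith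
    have q2 : 2 * a * e 0 ^ 2 - 2 * a * (e 0 * e 1) ≤ a := by linarith
    have m2 : N * e 0 ^ 2 = w ^ 2 := by
      rw [hN]; linear_combination (e 0 * (a + w) - e 1 * w) * hk + w ^ 2 * he
    have m1 : N * (e 0 * e 1) = -((a + w) * w) := by
      rw [hN]; linear_combination ((a + w) * e 1 + w * e 0) * hk - (a + w) * w * he
    have r1 := mul_nonneg hNpos.le q1
    have r2 := mul_le_mul_of_nonneg_left q2 hNpos.le
    have s1 : w * (2 * a * (a + w)) ≤ w * N := by linear_combination r1 + 2 * a * m1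
    have s2 : a * (2 * w * (a + 2 * w)) ≤ a * N := by linear_combination r2 + 2 * a * m1 - 2 * a * m2
    have t1 := le_of_mul_le_mul_left s1 hw
    have t2 := le_of_mul_le_mul_left s2 ha
    linarith

/-! ### Placements that defeat a given symmetry. -/

lemma AllIntersections.of_image {P : Set Plane → Prop} {K L A B : Set Plane} (H : AllIntersections P K L)
    (hA : ∃ φ : Plane ≃ᵃⁱ[ℝ] Plane, OrientationPreserving φ ∧ φ '' K = A)
    (hB : ∃ ψ : Plane ≃ᵃⁱ[ℝ] Plane, OrientationPreserving ψ ∧ ψ '' L = B)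
    (h : (interior (A ∩ B)).Nonempty) : P (A ∩ B) := by
  obtain ⟨φ, hφ, rfl⟩ := hA
  obtain ⟨ψ, hψ, rfl⟩ := hB
  exact H φ ψ hφ hψ h

lemma not_allIntersections_strip_halfPlane {K L : Set Plane} (hK : IsParallelStrip K) (hL : IsHalfPlane L) :
    ¬ AllIntersections AdmitsNontrivialCongruence K L := by
  obtain ⟨u, a, b, hu, hab, rfl⟩ := hK
  obtain ⟨v, c, hv, rfl⟩ := hL
  intro H
  have hw : 0 < b - a := sub_pos.2 hab
  have hM : ∀ z, z ∈ strip !₂[0, 1] 0 (0 + (b - a)) ∩ halfPlane !₂[1 / √2, -1 / √2] 0 ↔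
      (0 ≤ z 1 ∧ z 1 ≤ b - a) ∧ z 1 ≤ z 0 := fun z => by
    rw [mem_inter_iff, mem_strip_e₂, mem_halfPlane_diag, zero_add]
  refine not_admitsNontrivialCongruence_strip_inter_halfPlane hw hM (H.of_image
    (exists_image_strip hu Plane.norm_e₂ a b 0) (exists_image_halfPlane hv Plane.norm_diag c 0) ?_)
  refine Convex.interior_nonempty_of_corner ((convex_strip _ _ _).inter (convex_halfPlane _ _))
    (d := !₂[b - a, 0]) hw ?_ ?_ ?_ <;> rw [hM] <;> simp <;> linarith

lemma interior_cap_nonempty {R ε : ℝ} (hε : 0 < ε) (hεR : ε ≤ R) {M : Set Plane} (hc : Convex ℝ M)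
    (hM : ∀ z : Plane, z ∈ M ↔ z 0 ^ 2 + z 1 ^ 2 ≤ R ^ 2 ∧ R - ε ≤ z 1) : (interior M).Nonempty := by
  refine Convex.interior_nonempty_of_corner hc (d := !₂[0, R - ε]) hε ?_ ?_ ?_ <;> rw [hM] <;> simp <;>
    nlinarith

lemma not_allIntersections_disk_halfPlane {K L : Set Plane} (hK : IsCircle K) (hL : IsHalfPlane L) :
    ¬ AllIntersections IsCentrallySymmetric K L := by
  obtain ⟨c, R, hR, rfl⟩ := hK
  obtain ⟨v, a, hv, rfl⟩ := hL
  intro H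
  have hM : ∀ z, z ∈ Metric.closedBall 0 R ∩ halfPlane !₂[0, 1] (R - R) ↔
      z 0 ^ 2 + z 1 ^ 2 ≤ R ^ 2 ∧ R - R ≤ z 1 := fun z => by
    rw [mem_inter_iff, mem_halfPlane_e₂, mem_disk_iff hR.le]; simp
  exact not_isCentrallySymmetric_cap hR le_rfl hM (H.of_image (exists_image_disk c 0 R)
    (exists_image_halfPlane hv Plane.norm_e₂ a _)
    (interior_cap_nonempty hR le_rfl ((convex_closedBall _ _).inter (convex_halfPlane _ _)) hM))

lemma not_allIntersections_disk_strip {K L : Set Plane} (hK : IsCircle K) (hL : IsParallelStrip L) :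
    ¬ AllIntersections IsCentrallySymmetric K L := by
  obtain ⟨c, R, hR, rfl⟩ := hK
  obtain ⟨v, a, b, hv, hab, rfl⟩ := hL
  intro H
  -- The bound `ε ≤ b - a` puts the upper edge of the strip at or above the top of the disk, so only
  -- the lower edge cuts.
  set ε := min R (b - a) with hεdef
  have hε : 0 < ε := lt_min hR (sub_pos.2 hab)
  have hεR : ε ≤ R := min_le_left _ _
  have hεw : ε ≤ b - a := min_le_right _ _
  have hM : ∀ z, z ∈ Metric.closedBall 0 R ∩ strip !₂[0, 1] (R - ε) (R - ε + (b - a)) ↔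
      z 0 ^ 2 + z 1 ^ 2 ≤ R ^ 2 ∧ R - ε ≤ z 1 := fun z => by
    rw [mem_inter_iff, mem_strip_e₂, mem_disk_iff hR.le]
    simp only [PiLp.zero_apply, sub_zero]
    refine and_congr_right fun h1 => and_iff_left ?_
    have := abs_le_of_sq_le_sq' (show z 1 ^ 2 ≤ R ^ 2 by linarith [sq_nonneg (z 0)]) hR.le
    linarith [this.2]
  exact not_isCentrallySymmetric_cap hε hεR hM (H.of_image (exists_image_disk c 0 R)
    (exists_image_strip hv Plane.norm_e₂ a b _)
    (interior_cap_nonempty hε hεR ((convex_closedBall _ _).inter (convex_strip _ _ _)) hM))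

lemma not_allIntersections_halfPlane_halfPlane {K L : Set Plane} (hK : IsHalfPlane K) (hL : IsHalfPlane L) :
    ¬ AllIntersections IsCentrallySymmetric K L := by
  obtain ⟨u, a, hu, rfl⟩ := hK
  obtain ⟨v, b, hv, rfl⟩ := hL
  intro H
  have hM : ∀ z, z ∈ halfPlane !₂[1, 0] 0 ∩ halfPlane !₂[0, 1] 0 ↔ 0 ≤ z 0 ∧ 0 ≤ z 1 := fun z => by
    rw [mem_inter_iff, mem_halfPlane_e₁, mem_halfPlane_e₂]
  have h1 : ‖(!₂[1, 0] : Plane)‖ = 1 := by rw [Plane.norm_eq_one_iff]; simp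
  refine not_isCentrallySymmetric_quadrant hM (H.of_image
    (exists_image_halfPlane hu h1 a 0) (exists_image_halfPlane hv Plane.norm_e₂ b 0) ?_)
  refine Convex.interior_nonempty_of_corner ((convex_halfPlane _ _).inter (convex_halfPlane _ _))
    (d := !₂[0, 0]) one_pos ?_ ?_ ?_ <;> rw [hM] <;> simp

lemma not_allIntersections_disk_disk {c d : Plane} {r R : ℝ} (hr : 0 < r) (hrR : r < R) :
    ¬ AllIntersections IsCentrallySymmetric (Metric.closedBall c R) (Metric.closedBall d r) := by
  intro H
  have hR : 0 < R := hr.trans hrR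
  have hpos : 0 < R ^ 2 - r ^ 2 := sub_pos.2 (pow_lt_pow_left₀ hrR hr.le two_ne_zero)
  set D := √(R ^ 2 - r ^ 2) with hDdef
  have hD : 0 < D := Real.sqrt_pos.2 hpos
  have hD2 : D ^ 2 = R ^ 2 - r ^ 2 := Real.sq_sqrt hpos.le
  have hDR : D < R := lt_of_pow_lt_pow_left₀ 2 hR.le (by rw [hD2]; linarith [sq_nonneg r, pow_pos hr 2])
  have hM : ∀ z, z ∈ Metric.closedBall 0 R ∩ Metric.closedBall !₂[D, 0] r ↔
      z 0 ^ 2 + z 1 ^ 2 ≤ R ^ 2 ∧ (z 0 - D) ^ 2 + z 1 ^ 2 ≤ r ^ 2 := fun z => by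
    rw [mem_inter_iff, mem_disk_iff hR.le, mem_disk_iff hr.le]; simp
  refine not_isCentrallySymmetric_lens hr hD hD2 hM (H.of_image (exists_image_disk c 0 R)
    (exists_image_disk d _ r) ?_)
  have hη : 0 < min r (R - D) := lt_min hr (sub_pos.2 hDR)
  have h1 := min_le_left r (R - D)
  have h2 := min_le_right r (R - D)
  set η := min r (R - D)
  have h3 : η ^ 2 ≤ r ^ 2 := pow_le_pow_left₀ hη.le h1 2
  refine Convex.interior_nonempty_of_corner ((convex_closedBall _ _).inter (convex_closedBall _ _))
    (d := !₂[D, 0]) hη ?_ ?_ ?_ <;> rw [hM] <;> simp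
  · exact ⟨pow_le_pow_left₀ hD.le hDR.le 2, sq_nonneg r⟩
  · exact ⟨pow_le_pow_left₀ (by positivity) (by linarith) 2, h3⟩
  · exact ⟨by linarith, h3⟩

lemma AllIntersections.areCongruent_disk {K L : Set Plane} (hK : IsCircle K) (hL : IsCircle L)
    (H : AllIntersections IsCentrallySymmetric K L) : AreCongruent K L := by
  obtain ⟨c, r, hr, rfl⟩ := hK
  obtain ⟨d, s, hs, rfl⟩ := hL
  rcases lt_trichotomy r s with h | rfl | h
  · exact absurd H.swap (not_allIntersections_disk_disk hr h)
  · obtain ⟨φ, -, hφ⟩ := exists_image_disk c d r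
    exact ⟨φ, hφ⟩
  · exact absurd H (not_allIntersections_disk_disk hs h)

lemma AllIntersections.areCongruent_strip {K L : Set Plane} (hK : IsParallelStrip K) (hL : IsParallelStrip L)
    (H : AllIntersections IsAxiallySymmetric K L) : AreCongruent K L := by
  obtain ⟨u, a, b, hu, hab, rfl⟩ := hK
  obtain ⟨v, c, d, hv, hcd, rfl⟩ := hL
  have hw : 0 < b - a := sub_pos.2 hab
  have hw' : 0 < d - c := sub_pos.2 hcd
  have h2 : 0 < √(2 : ℝ) := by positivity
  by_cases hne : b - a = d - c
  · obtain ⟨φ, -, hφ⟩ := exists_image_strip hu hv a b c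
    refine ⟨φ, hφ.trans ?_⟩
    rw [hne, add_sub_cancel]; rfl
  exfalso
  -- Strips crossing at `45°` give a parallelogram with `a = (d - c) * √2`, which is a rhombus only
  -- if the widths agree.
  have hM : ∀ z, z ∈ strip !₂[0, 1] 0 (0 + (b - a)) ∩ strip !₂[1 / √2, -1 / √2] 0 (0 + (d - c)) ↔
      (0 ≤ z 1 ∧ z 1 ≤ b - a) ∧ z 1 ≤ z 0 ∧ z 0 - z 1 ≤ (d - c) * √2 := fun z => by
    rw [mem_inter_iff, mem_strip_e₂, zero_add, zero_add, mem_strip_diag]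
  have ha : 0 < (d - c) * √2 := mul_pos hw' h2
  refine not_isAxiallySymmetric_parallelogram hw ha ?_ hM (H.of_image
    (exists_image_strip hu Plane.norm_e₂ a b 0) (exists_image_strip hv Plane.norm_diag c d 0) ?_)
  · rw [mul_pow, Real.sq_sqrt (by norm_num)]
    intro h
    exact hne ((sq_eq_sq₀ hw.le hw'.le).1 (by linarith))
  · have hη : 0 < min (b - a) ((d - c) * √2) / 2 := half_pos (lt_min hw ha)
    have h3 := min_le_left (b - a) ((d - c) * √2)
    have h4 := min_le_right (b - a) ((d - c) * √2)
    set η := min (b - a) ((d - c) * √2) / 2 with hηdef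
    refine Convex.interior_nonempty_of_corner ((convex_strip _ _ _).inter (convex_strip _ _ _))
      (d := !₂[η, 0]) hη ?_ ?_ ?_ <;> rw [hM] <;> simp <;> refine ⟨?_, ?_⟩ <;> try constructor
    all_goals linarith

/-! ### Symmetry of all intersections -/

lemma IsCircle.image {K : Set Plane} (hK : IsCircle K) (φ : Plane ≃ᵃⁱ[ℝ] Plane) : IsCircle (φ '' K) := by
  obtain ⟨c, r, hr, rfl⟩ := hK
  exact ⟨φ c, r, hr, φ.image_disk c r⟩

lemma IsParallelStrip.image {K : Set Plane} (hK : IsParallelStrip K) (φ : Plane ≃ᵃⁱ[ℝ] Plane) :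
    IsParallelStrip (φ '' K) := by
  obtain ⟨u, a, b, hu, hab, rfl⟩ := hK
  obtain ⟨d, hd⟩ := φ.image_strip u a b
  exact ⟨_, a + d, b + d, by rwa [LinearIsometryEquiv.norm_map], by linarith, hd⟩

lemma IsHalfPlane.image {K : Set Plane} (hK : IsHalfPlane K) (φ : Plane ≃ᵃⁱ[ℝ] Plane) :
    IsHalfPlane (φ '' K) := by
  obtain ⟨u, a, hu, rfl⟩ := hK
  obtain ⟨d, hd⟩ := φ.image_halfPlane u a
  exact ⟨_, a + d, by rwa [LinearIsometryEquiv.norm_map], hd⟩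

lemma allIntersections_disk_disk {K L : Set Plane} (hK : IsCircle K) (hL : IsCircle L) :
    AllIntersections IsAxiallySymmetric K L := fun φ ψ _ _ _ => by
  obtain ⟨c, r, -, h1⟩ := hK.image φ
  obtain ⟨d, s, -, h2⟩ := hL.image ψ
  rw [h1, h2]
  exact isAxiallySymmetric_disk_inter_disk c d r s

lemma allIntersections_disk_strip_or_halfPlane {K L : Set Plane} (hK : IsCircle K)
    (hL : IsParallelStrip L ∨ IsHalfPlane L) : AllIntersections IsAxiallySymmetric K L :=
  fun φ ψ _ _ _ => by
  obtain ⟨c, r, -, h1⟩ := hK.image φ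
  rw [h1]
  rcases hL with hL | hL
  · obtain ⟨u, a, b, hu, -, h2⟩ := hL.image ψ
    rw [h2]
    exact isAxiallySymmetric_disk_inter hu c r (T := Icc a b) fun z => Iff.rfl
  · obtain ⟨u, a, hu, h2⟩ := hL.image ψ
    rw [h2]
    exact isAxiallySymmetric_disk_inter hu c r (T := Ici a) fun z => Iff.rfl

lemma allIntersections_halfPlane_halfPlane {K L : Set Plane} (hK : IsHalfPlane K) (hL : IsHalfPlane L) :
    AllIntersections IsAxiallySymmetric K L := fun φ ψ _ _ _ => by
  obtain ⟨u, a, hu, h1⟩ := hK.image φ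
  obtain ⟨v, b, hv, h2⟩ := hL.image ψ
  rw [h1, h2]
  exact isAxiallySymmetric_halfPlane_inter_halfPlane hu hv a b

lemma allIntersections_strip_strip {K L : Set Plane} (hK : IsParallelStrip K) (hL : IsParallelStrip L) :
    AllIntersections IsCentrallySymmetric K L := fun φ ψ _ _ _ => by
  obtain ⟨u, a, b, hu, -, h1⟩ := hK.image φ
  obtain ⟨v, c, d, hv, -, h2⟩ := hL.image ψ
  rw [h1, h2]
  exact isCentrallySymmetric_strip_inter_strip hu hv a b c d

lemma allIntersections_congruent_strips {K L : Set Plane} (hK : IsParallelStrip K) (h : AreCongruent K L) :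
    AllIntersections IsAxiallySymmetric K L := fun φ ψ _ _ _ => by
  obtain ⟨χ, rfl⟩ := h
  obtain ⟨u, a, b, hu, -, rfl⟩ := hK
  have h2 : ψ '' (χ '' strip u a b) = (χ.trans ψ) '' strip u a b := by
    rw [image_image]; rfl
  obtain ⟨d, hd⟩ := φ.image_strip u a b
  obtain ⟨e, he⟩ := (χ.trans ψ).image_strip u a b
  have e1 : b + d = a + d + (b - a) := by ring
  have e2 : b + e = a + e + (b - a) := by ring
  change IsAxiallySymmetric (φ '' strip u a b ∩ ψ '' (χ '' strip u a b))
  rw [h2, hd, he, e1, e2]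
  exact isAxiallySymmetric_strip_inter_strip (by rwa [LinearIsometryEquiv.norm_map])
    (by rwa [LinearIsometryEquiv.norm_map]) _ _ _

lemma allIntersections_congruent_disks {K L : Set Plane} (hK : IsCircle K) (h : AreCongruent K L) :
    AllIntersections IsCentrallySymmetric K L := fun φ ψ _ _ _ => by
  obtain ⟨χ, rfl⟩ := h
  obtain ⟨c, r, -, rfl⟩ := hK
  rw [χ.image_disk, φ.image_disk, ψ.image_disk]
  exact isCentrallySymmetric_disk_inter_disk _ _ r

lemma AllIntersections.shapes {K L : Set Plane} (hK : IsProperClosedConvex K) (hL : IsProperClosedConvex L)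
    (H : AllIntersections AdmitsNontrivialCongruence K L) :
    (IsCircle K ∧ IsCircle L) ∨
      (IsCircle K ∧ (IsParallelStrip L ∨ IsHalfPlane L)) ∨
      (IsCircle L ∧ (IsParallelStrip K ∨ IsHalfPlane K)) ∨
      (IsParallelStrip K ∧ IsParallelStrip L) ∨
      (IsHalfPlane K ∧ IsHalfPlane L) := by
  have h1 : ¬ (IsParallelStrip K ∧ IsHalfPlane L) :=
    fun h => not_allIntersections_strip_halfPlane h.1 h.2 H
  have h2 : ¬ (IsParallelStrip L ∧ IsHalfPlane K) :=
    fun h => not_allIntersections_strip_halfPlane h.1 h.2 H.swap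
  have h3 := H.classification hK hL
  have h4 := H.swap.classification hL hK
  tauto

end

/-! ### Assembly of the three equivalences. -/

theorem theorem3 (K L : Set Plane) (hK : IsProperClosedConvex K) (hL : IsProperClosedConvex L) :
    (AllIntersections AdmitsNontrivialCongruence K L ↔
      (IsCircle K ∧ IsCircle L) ∨
      (IsCircle K ∧ (IsParallelStrip L ∨ IsHalfPlane L)) ∨
      (IsCircle L ∧ (IsParallelStrip K ∨ IsHalfPlane K)) ∨
      (IsParallelStrip K ∧ IsParallelStrip L) ∨
      (IsHalfPlane K ∧ IsHalfPlane L)) ∧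
    (AllIntersections IsCentrallySymmetric K L ↔
      (IsCircle K ∧ IsCircle L ∧ AreCongruent K L) ∨
      (IsParallelStrip K ∧ IsParallelStrip L)) ∧
    (AllIntersections IsAxiallySymmetric K L ↔
      (IsCircle K ∧ IsCircle L) ∨
      (IsCircle K ∧ (IsParallelStrip L ∨ IsHalfPlane L)) ∨
      (IsCircle L ∧ (IsParallelStrip K ∨ IsHalfPlane K)) ∨
      (IsParallelStrip K ∧ IsParallelStrip L ∧ AreCongruent K L) ∨
      (IsHalfPlane K ∧ IsHalfPlane L)) := by
  have axial : ∀ {K L : Set Plane}, AllIntersections IsAxiallySymmetric K L →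
      AllIntersections AdmitsNontrivialCongruence K L :=
    fun H => H.mono fun _ => IsAxiallySymmetric.admitsNontrivialCongruence
  have central : ∀ {K L : Set Plane}, AllIntersections IsCentrallySymmetric K L →
      AllIntersections AdmitsNontrivialCongruence K L :=
    fun H => H.mono fun _ => IsCentrallySymmetric.admitsNontrivialCongruence
  refine ⟨⟨fun H => H.shapes hK hL, ?_⟩, ⟨fun H => ?_, ?_⟩, ⟨fun H => ?_, ?_⟩⟩
  · rintro (⟨h1, h2⟩ | ⟨h1, h2⟩ | ⟨h1, h2⟩ | ⟨h1, h2⟩ | ⟨h1, h2⟩)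
    · exact axial (allIntersections_disk_disk h1 h2)
    · exact axial (allIntersections_disk_strip_or_halfPlane h1 h2)
    · exact axial (allIntersections_disk_strip_or_halfPlane h1 h2).swap
    · exact central (allIntersections_strip_strip h1 h2)
    · exact axial (allIntersections_halfPlane_halfPlane h1 h2)
  · rcases (central H).shapes hK hL with
      ⟨h1, h2⟩ | ⟨h1, h2 | h2⟩ | ⟨h1, h2 | h2⟩ | ⟨h1, h2⟩ | ⟨h1, h2⟩
    · exact Or.inl ⟨h1, h2, H.areCongruent_disk h1 h2⟩
    · exact absurd H (not_allIntersections_disk_strip h1 h2)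
    · exact absurd H (not_allIntersections_disk_halfPlane h1 h2)
    · exact absurd H.swap (not_allIntersections_disk_strip h1 h2)
    · exact absurd H.swap (not_allIntersections_disk_halfPlane h1 h2)
    · exact Or.inr ⟨h1, h2⟩
    · exact absurd H (not_allIntersections_halfPlane_halfPlane h1 h2)
  · rintro (⟨h1, -, h⟩ | ⟨h1, h2⟩)
    · exact allIntersections_congruent_disks h1 h
    · exact allIntersections_strip_strip h1 h2
  · rcases (axial H).shapes hK hL with h | h | h | ⟨h1, h2⟩ | h
    · exact Or.inl h
    · exact Or.inr (Or.inl h)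
    · exact Or.inr (Or.inr (Or.inl h))
    · exact Or.inr (Or.inr (Or.inr (Or.inl ⟨h1, h2, H.areCongruent_strip h1 h2⟩)))
    · exact Or.inr (Or.inr (Or.inr (Or.inr h)))
  · rintro (⟨h1, h2⟩ | ⟨h1, h2⟩ | ⟨h1, h2⟩ | ⟨h1, -, h⟩ | ⟨h1, h2⟩)
    · exact allIntersections_disk_disk h1 h2
    · exact allIntersections_disk_strip_or_halfPlane h1 h2
    · exact (allIntersections_disk_strip_or_halfPlane h1 h2).swap
    · exact allIntersections_congruent_strips h1 h
    · exact allIntersections_halfPlane_halfPlane h1 h2
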